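/- Let $k$ be a field, $V$ a finite-dimensional $k$-vector space, $G$ a finite subgroup of $GL(V)$ and $\Gamma$ a finite group. Let $k[V]$ be the polynomial algebra $\operatorname{Sym}(V^*)$, on which $G$ acts by linear change of coordinates, let $R=k[V]^G$ be the graded algebra of invariants, $R_+$ its ideal of invariants without constant term (so that $k=R/R_+$ is an $R$-module), and $K=k(V)^G$ the (ungraded) field of fractions of $R$. Let $U$ be a finite-dimensional $(k\Gamma,kG)$-bimodule (a finite-dimensional $k$-vector space with a linear left action of $\Gamma$ and a commuting linear right action of $G$), and let $M=(U\otimes_k k[V])^G$ be the module of relative invariants, where $g(u\otimes p)=ug^{-1}\otimes gp$. It is a graded $R$-module on which $\Gamma$ acts $R$-linearly through $U$, so $M\otimes_R k$ and $\operatorname{Tor}_i^R(M,k)$ are graded $k\Gamma$-modules; their components of degree $j$ are denoted by a subscript $j$. Let $\operatorname{Groth}(k\Gamma)$ be the Grothendieck group of finite-dimensional $k\Gamma$-modules: it is generated by the classes $[N]$ of these modules, with a relation $[N']-[N]+[N'']=0$ for each short exact sequence $0\to N'\to N\to N''\to 0$. Write $x\ge y$ if $x-y=[N]$ for some finite-dimensional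 $k\Gamma$-module $N$. The classes of simple modules form a $\mathbb Z$-basis, and the coefficient of $[S]$ in $[N]$ is the multiplicity of $S$ as a composition factor of $N$. The modules $M\otimes_R k$ and $\operatorname{Tor}_i^R(M,k)$ ($i\ge 0$) are finite-dimensional over $k$; for each $i$ only finitely many $\operatorname{Tor}_i^R(M,k)_j$ are non-zero, and for each $j$ only finitely many $\operatorname{Tor}_i^R(M,k)_j$ are non-zero. Moreover: (i) In $\operatorname{Groth}(k\Gamma)$ one has $[M\otimes_R k]\ge [U]$, with equality if and only if $M$ is a free $R$-module. If $M$ is free, then the $K\Gamma$-module $K\otimes_k U$ has a finite filtration $0=\mathcal F_{-1}\subseteq\mathcal F_0\subseteq\mathcal F_1\subseteq\cdots\subseteq\mathcal F_d=K\otimes_k U$ by $K\Gamma$-submodules (with $\mathcal F_j=\mathcal F_d$ for $j\ge d$) such that $\mathcal F_j/\mathcal F_{j-1}\cong K\otimes_k (M\otimes_R k)_j$ as $K\Gamma$-modules for all $j\ge 0$. (ii) For every $m\ge 0$, in $\operatorname{Groth}(k\Gamma)$, $$\sum_{i=0}^m(-1)^i\sum_{j\ge 0}\bigl[\operatorname{Tor}_i^R(M,k)_j\bigr]\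 \begin{cases}\ \ge [U] & \text{if } m \text{ is even},\\ \ \le [U] & \text{if } m\text{ is odd},\end{cases}$$ with equality if and only if $\operatorname{Tor}_i^R(M,k)=0$ for all $i>m$. (iii) Consider the formal power series $$\sum_{j\ge 0}\Bigl(\sum_{i\ge 0}(-1)^i\bigl[\operatorname{Tor}_i^R(M,k)_j\bigr]\Bigr)t^j\in\operatorname{Groth}(k\Gamma)[[t]].$$ For each simple $k\Gamma$-module $S$, the power series in $\mathbb Z[[t]]$ that gives the coefficient of $[S]$ is the expansion of a rational function in $\mathbb Q(t)$; this rational function is regular at $t=1$, and its value there is the coefficient of $[S]$ in $[U]$. In other words, the series evaluates to $[U]$ at $t=1$. -/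

import Mathlib

open scoped TensorProduct
universe u v

namespace JordanHolder

variable {A : Type*} [Ring A]

/-- `IsFactor S X Y`: the factor `Y / X` (for `X ≤ Y`) is isomorphic to `S`. -/
def IsFactor (S : Type*) [AddCommGroup S] [Module A S]
    {M : Type*} [AddCommGroup M] [Module A M] (X Y : Submodule A M) : Prop :=
  Nonempty ((Y ⧸ X.submoduleOf Y) ≃ₗ[A] S)

open Classical in
/-- The number of composition factors of the composition series `s` isomorphic to `S`. -/
noncomputable def seriesCount (S : Type*) [AddCommGroup S] [Module A S]
    {M : Type*} [AddCommGroup M] [Module A M] (s : CompositionSeries (Submodule A M)) : ℕ :=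
  ∑ i : Fin s.length, if IsFactor S (s i.castSucc) (s i.succ) then 1 else 0

open Classical in
/-- The multiplicity `[M : S]` of `S` as a composition factor of a module `M` of finite length. -/
noncomputable def factorMultiplicity (A : Type*) [Ring A] (S : Type*) [AddCommGroup S] [Module A S]
    (M : Type*) [AddCommGroup M] [Module A M] : ℕ :=
  if h : ∃ s : CompositionSeries (Submodule A M), s.head = ⊥ ∧ s.last = ⊤ then
    seriesCount S h.choose else 0

variable {S : Type*} [AddCommGroup S] [Module A S]

lemma seriesCount_eq {M : Type*} [AddCommGroup M] [Module A M]
    {s t : CompositionSeries (Submodule A M)} (h : s.Equivalent t) :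
    seriesCount S s = seriesCount S t := by
  classical
  obtain ⟨f, hf⟩ := h
  refine Fintype.sum_equiv f _ _ fun i => ?_
  have e := (hf i).linearEquiv
  have : IsFactor S (s i.castSucc) (s i.succ) ↔
      IsFactor S (t (f i).castSucc) (t (f i).succ) :=
    ⟨fun ⟨g⟩ => ⟨e.symm.trans g⟩, fun ⟨g⟩ => ⟨e.trans g⟩⟩
  exact if_congr this rfl rfl

lemma factorMultiplicity_eq {M : Type*} [AddCommGroup M] [Module A M]
    (s : CompositionSeries (Submodule A M)) (h0 : s.head = ⊥) (h1 : s.last = ⊤) :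
    factorMultiplicity A S M = seriesCount S s := by
  have h : ∃ s : CompositionSeries (Submodule A M), s.head = ⊥ ∧ s.last = ⊤ := ⟨s, h0, h1⟩
  rw [factorMultiplicity, dif_pos h]
  exact seriesCount_eq (CompositionSeries.jordan_holder _ _ (h.choose_spec.1.trans h0.symm)
    (h.choose_spec.2.trans h1.symm))

lemma seriesCount_smash {M : Type*} [AddCommGroup M] [Module A M]
    (s t : CompositionSeries (Submodule A M)) (h : s.last = t.head) :
    seriesCount S (s.smash t h) = seriesCount S s + seriesCount S t := by
  classical
  unfold seriesCount
  refine (Fin.sum_univ_add (a := s.length) (b := t.length) _).trans ?_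
  congr 1
  · refine Finset.sum_congr rfl fun i _ => ?_
    exact if_congr (iff_of_eq (congrArg₂ (IsFactor S) (RelSeries.smash_castAdd h i)
      (RelSeries.smash_succ_castAdd h i))) rfl rfl
  · refine Finset.sum_congr rfl fun i _ => ?_
    exact if_congr (iff_of_eq (congrArg₂ (IsFactor S) (RelSeries.smash_natAdd h i)
      (RelSeries.smash_succ_natAdd h i))) rfl rfl

lemma isFactor_map_iff {M N : Type*} [AddCommGroup M] [Module A M] [AddCommGroup N] [Module A N]
    (f : N →ₗ[A] M) (hf : Function.Injective f) (X Y : Submodule A N) :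
    IsFactor S (X.map f) (Y.map f) ↔ IsFactor S X Y := by
  have e : (Y ⧸ X.submoduleOf Y) ≃ₗ[A] (Y.map f ⧸ (X.map f).submoduleOf (Y.map f)) := by
    refine Submodule.Quotient.equiv _ _ (Submodule.equivMapOfInjective f hf Y) ?_
    ext ⟨y, hy⟩
    simp only [Submodule.submoduleOf, Submodule.mem_map, Submodule.mem_comap]
    constructor
    · rintro ⟨z, hz, hzy⟩
      exact ⟨z, hz, by simpa using congrArg Subtype.val hzy⟩
    · rintro ⟨z, hz, hzy⟩
      obtain ⟨w, hw, rfl⟩ := hy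
      exact ⟨⟨w, hw⟩, by simpa [hf hzy] using hz, Subtype.ext (by simp)⟩
  exact ⟨fun ⟨g⟩ => ⟨e.trans g⟩, fun ⟨g⟩ => ⟨e.symm.trans g⟩⟩

lemma isFactor_comap_iff {M N : Type*} [AddCommGroup M] [Module A M] [AddCommGroup N] [Module A N]
    (g : M →ₗ[A] N) (hg : Function.Surjective g) (X Y : Submodule A N) :
    IsFactor S (X.comap g) (Y.comap g) ↔ IsFactor S X Y := by
  let φ : Y.comap g →ₗ[A] Y ⧸ X.submoduleOf Y :=
    (X.submoduleOf Y).mkQ ∘ₗ g.restrict (p := Y.comap g) (q := Y) (fun _ h => h)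
  have hφ : Function.Surjective φ := by
    refine (Submodule.mkQ_surjective _).comp ?_
    rintro ⟨y, hy⟩
    obtain ⟨x, rfl⟩ := hg y
    exact ⟨⟨x, hy⟩, rfl⟩
  have hk : LinearMap.ker φ = (X.comap g).submoduleOf (Y.comap g) := by
    ext ⟨x, hx⟩
    simp only [φ, LinearMap.mem_ker, LinearMap.comp_apply, Submodule.mkQ_apply,
      Submodule.Quotient.mk_eq_zero]
    rfl
  have e : (Y.comap g ⧸ (X.comap g).submoduleOf (Y.comap g)) ≃ₗ[A] Y ⧸ X.submoduleOf Y :=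
    (Submodule.quotEquivOfEq _ _ hk.symm).trans (φ.quotKerEquivOfSurjective hφ)
  exact ⟨fun ⟨g⟩ => ⟨e.symm.trans g⟩, fun ⟨g⟩ => ⟨e.trans g⟩⟩

lemma factorMultiplicity_add {L M N : Type*} [AddCommGroup L] [Module A L] [AddCommGroup M] [Module A M]
    [AddCommGroup N] [Module A N] (f : L →ₗ[A] M) (g : M →ₗ[A] N)
    (hf : Function.Injective f) (hg : Function.Surjective g) (H : Function.Exact f g)
    (hL : IsFiniteLength A L) (hN : IsFiniteLength A N) :
    factorMultiplicity A S M = factorMultiplicity A S L + factorMultiplicity A S N := by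
  classical
  obtain ⟨s, hs₁, hs₂⟩ := isFiniteLength_iff_exists_compositionSeries.mp hN
  obtain ⟨t, ht₁, ht₂⟩ := isFiniteLength_iff_exists_compositionSeries.mp hL
  let s' : CompositionSeries (Submodule A M) :=
    s.map ⟨Submodule.comap g, Submodule.comap_covBy_of_surjective hg⟩
  let t' : CompositionSeries (Submodule A M) :=
    t.map ⟨Submodule.map f, Submodule.map_covBy_of_injective hf⟩
  have hfg : Submodule.map f ⊤ = Submodule.comap g ⊥ := by
    rw [Submodule.map_top, Submodule.comap_bot, LinearMap.exact_iff.mp H]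
  have hts : t'.last = s'.head := by
    change Submodule.map f t.last = Submodule.comap g s.head
    rw [ht₂, hs₁, hfg]
  rw [factorMultiplicity_eq s hs₁ hs₂, factorMultiplicity_eq t ht₁ ht₂, factorMultiplicity_eq (t'.smash s' hts),
    seriesCount_smash]
  · congr 1
    · refine Finset.sum_congr rfl fun i _ => ?_
      have := isFactor_map_iff (S := S) f hf (t i.castSucc) (t i.succ)
      exact if_congr this rfl rfl
    · refine Finset.sum_congr rfl fun i _ => ?_
      have := isFactor_comap_iff (S := S) g hg (s i.castSucc) (s i.succ)
      exact if_congr this rfl rfl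
  · rw [RelSeries.head_smash]
    change Submodule.map f t.head = ⊥
    rw [ht₁, Submodule.map_bot]
  · rw [RelSeries.last_smash]
    change Submodule.comap g s.last = ⊤
    rw [hs₂, Submodule.comap_top]

end JordanHolder

/-- The representation of `Γ` on a finite-dimensional `kΓ`-module. -/
noncomputable abbrev FDRep.rep {k : Type u} {Γ : Type v} [Field k] [Group Γ] (X : FDRep k Γ) :
    Representation k Γ X := X.ρ

/-- The subgroup of relations `[X] - [Y] + [Z]`, one for each short exact sequence
`0 → X → Y → Z → 0` of finite-dimensional `kΓ`-modules. (They identify isomorphic modules.) -/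
def grothRel (k : Type u) (Γ : Type v) [Field k] [Group Γ] :
    AddSubgroup (FreeAbelianGroup (FDRep k Γ)) :=
  AddSubgroup.closure {x | ∃ (X Y Z : FDRep k Γ)
    (f : X.rep.IntertwiningMap Y.rep) (g : Y.rep.IntertwiningMap Z.rep),
    Function.Injective f ∧ Function.Exact f g ∧ Function.Surjective g ∧
      x = FreeAbelianGroup.of X - FreeAbelianGroup.of Y + FreeAbelianGroup.of Z}

/-- The Grothendieck group of finite-dimensional `kΓ`-modules. -/
def Groth (k : Type u) (Γ : Type v) [Field k] [Group Γ] : Type (max (u + 1) v) :=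
  FreeAbelianGroup (FDRep k Γ) ⧸ grothRel k Γ

namespace Groth

variable {k : Type u} {Γ : Type v} [Field k] [Group Γ]

instance : AddCommGroup (Groth k Γ) :=
  inferInstanceAs (AddCommGroup (FreeAbelianGroup (FDRep k Γ) ⧸ grothRel k Γ))

/-- The class `[X]` of a finite-dimensional `kΓ`-module `X`. -/
def of (X : FDRep k Γ) : Groth k Γ :=
  QuotientAddGroup.mk (s := grothRel k Γ) (FreeAbelianGroup.of X)

/-- The class in the Grothendieck group of a finite-dimensional representation. -/
noncomputable def cls {W : Type u} [AddCommGroup W] [Module k W] [Module.Finite k W]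
    (ρ : Representation k Γ W) : Groth k Γ :=
  of (FDRep.of ρ)

/-- `x ≤ y` if `y - x` is the class of a genuine module. -/
instance : LE (Groth k Γ) := ⟨fun x y => ∃ N : FDRep k Γ, y - x = of N⟩

lemma isFiniteLength (X : FDRep k Γ) : IsFiniteLength (MonoidAlgebra k Γ) X.rep.asModule := by
  have : Module.Finite k X.rep.asModule := inferInstanceAs (Module.Finite k X)
  have : IsNoetherian (MonoidAlgebra k Γ) X.rep.asModule := isNoetherian_of_tower k inferInstance
  have : IsArtinian (MonoidAlgebra k Γ) X.rep.asModule := isArtinian_of_tower k inferInstance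
  exact isFiniteLength_iff_isNoetherian_isArtinian.mpr ⟨inferInstance, inferInstance⟩

/-- For a simple module `S`, the coefficient of `[S]` in an element of the Grothendieck group (with
respect to the basis of classes of simple modules): the additive map that sends `[X]` to the
multiplicity `[X : S]` of `S` as a composition factor of `X`. -/
noncomputable def mult (S : FDRep k Γ) : Groth k Γ →+ ℤ :=
  QuotientAddGroup.lift (grothRel k Γ)
    (FreeAbelianGroup.lift fun X : FDRep k Γ =>
      (JordanHolder.factorMultiplicity (MonoidAlgebra k Γ) S.rep.asModule X.rep.asModule : ℤ)) (by
    rw [grothRel, AddSubgroup.closure_le]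
    rintro x ⟨X, Y, Z, f, g, hf, hfg, hg, rfl⟩
    have h := JordanHolder.factorMultiplicity_add (A := MonoidAlgebra k Γ) (S := S.rep.asModule)
      (Representation.IntertwiningMap.equivLinearMapAsModule _ _ f)
      (Representation.IntertwiningMap.equivLinearMapAsModule _ _ g) hf hg hfg
      (isFiniteLength X) (isFiniteLength Z)
    simp [h])

end Groth

/-- The `k`-linear representation underlying an `R`-linear one, for a `k`-algebra `R`. -/
def restrictRep (k : Type*) {R Γ M : Type*} [CommRing k] [CommRing R] [Algebra k R] [Group Γ]
    [AddCommGroup M] [Module k M] [Module R M] [IsScalarTower k R M]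
    (ρ : Representation R Γ M) : Representation k Γ M where
  toFun γ := (ρ γ).restrictScalars k
  map_one' := by ext; simp
  map_mul' _ _ := by ext; simp

namespace BarComplex

section Complex
variable (k : Type u) [CommRing k] {R : Type u} [CommRing R] [Algebra k R] (I : Ideal R)
  (M : Type u) [AddCommGroup M] [Module k M]

/-- `M ⊗ I ⊗ ⋯ ⊗ I` with `n` factors `I`, all tensor products over `k`. -/
noncomputable def obj : ℕ → ModuleCat.{u} k
  | 0 => ModuleCat.of k M
  | n + 1 => ModuleCat.of k (obj n ⊗[k] I)

/-- The element `x ⊗ r` of `obj (n + 1) = obj n ⊗ I`. -/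
noncomputable def cons (n : ℕ) : obj k I M n →ₗ[k] I →ₗ[k] obj k I M (n + 1) :=
  TensorProduct.mk k (obj k I M n) I

lemma ext_cons {n : ℕ} {N : Type*} [AddCommGroup N] [Module k N]
    {f g : obj k I M (n + 1) →ₗ[k] N}
    (h : ∀ x r, f (cons k I M n x r) = g (cons k I M n x r)) : f = g :=
  TensorProduct.ext' (M := obj k I M n) (N := I) h

/-- The map `f ⊗ id : obj m ⊗ I → obj n ⊗ I` induced by `f : obj m → obj n`. -/
noncomputable def consMap {m n : ℕ} (f : obj k I M m →ₗ[k] obj k I M n) :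
    obj k I M (m + 1) →ₗ[k] obj k I M (n + 1) :=
  LinearMap.rTensor I f

lemma consMap_cons {m n : ℕ} (f : obj k I M m →ₗ[k] obj k I M n) (x : obj k I M m) (r : I) :
    consMap k I M f (cons k I M m x r) = cons k I M n (f x) r := rfl

variable [Module R M] [IsScalarTower k R M]

/-- Multiplication `I ⊗ I → I`. -/
noncomputable def mulI : I ⊗[k] I →ₗ[k] I :=
  TensorProduct.lift ((LinearMap.lsmul R I).restrictScalars₁₂ k k ∘ₗ (I.subtype.restrictScalars k))

/-- The map `obj n ⊗ I → obj n` multiplying the last tensor factor by an element of `I`: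
`(m ⊗ r₁ ⊗ ⋯ ⊗ rₙ) ⊗ r ↦ m ⊗ r₁ ⊗ ⋯ ⊗ rₙ r`, and `m ⊗ r ↦ r m` for `n = 0`. -/
noncomputable def act : ∀ n, obj k I M (n + 1) →ₗ[k] obj k I M n
  | 0 => (TensorProduct.lift ((LinearMap.lsmul R M).restrictScalars₁₂ k k ∘ₗ
      (I.subtype.restrictScalars k)).flip : M ⊗[k] I →ₗ[k] M)
  | n + 1 => (mulI k I).lTensor (obj k I M n) ∘ₗ
      (TensorProduct.assoc k (obj k I M n) I I).toLinearMap

/-- The differential of the (reduced) bar complex: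
`d (m ⊗ r₁ ⊗ ⋯ ⊗ rₙ₊₁) = r₁ m ⊗ r₂ ⊗ ⋯ ⊗ rₙ₊₁ + ∑ (-1) ^ i • m ⊗ r₁ ⊗ ⋯ ⊗ rᵢ rᵢ₊₁ ⊗ ⋯ ⊗ rₙ₊₁`,
the sum being over `1 ≤ i ≤ n`. -/
noncomputable def d : ∀ n, obj k I M (n + 1) →ₗ[k] obj k I M n
  | 0 => act k I M 0
  | n + 1 => consMap k I M (d n) + (-1 : k) ^ (n + 1) • act k I M (n + 1)

lemma act_zero_cons (m : M) (r : I) : act k I M 0 (cons k I M 0 m r) = ((r : R) • m : M) := rfl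

lemma act_succ_cons (n : ℕ) (x : obj k I M n) (r s : I) :
    act k I M (n + 1) (cons k I M (n + 1) (cons k I M n x r) s) =
      cons k I M n x ((r : R) • s) := rfl

lemma d_zero : d k I M 0 = act k I M 0 := rfl

lemma d_succ_cons (n : ℕ) (x : obj k I M (n + 1)) (r : I) :
    d k I M (n + 1) (cons k I M (n + 1) x r) = cons k I M n (d k I M n x) r +
      (-1 : k) ^ (n + 1) • act k I M (n + 1) (cons k I M (n + 1) x r) := rfl

lemma act_act (n : ℕ) (x : obj k I M n) (r s : I) :
    act k I M n (cons k I M n (act k I M n (cons k I M n x r)) s) =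
      act k I M n (cons k I M n x ((r : R) • s)) := by
  cases n with
  | zero =>
    change (s : R) • ((r : R) • (show M from x)) = ((r : R) * (s : R)) • (show M from x)
    rw [smul_smul, mul_comm]
  | succ n =>
    suffices h : act k I M (n + 1) ∘ₗ (cons k I M (n + 1)).flip s ∘ₗ act k I M (n + 1) ∘ₗ
        (cons k I M (n + 1)).flip r =
        act k I M (n + 1) ∘ₗ (cons k I M (n + 1)).flip ((r : R) • s) from LinearMap.congr_fun h x
    refine ext_cons k I M fun y t => ?_
    simp only [LinearMap.comp_apply, LinearMap.flip_apply, act_succ_cons]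
    congr 1
    exact Subtype.ext (mul_assoc _ _ _)

lemma d_act (n : ℕ) (x : obj k I M (n + 1)) (s : I) :
    d k I M n (act k I M (n + 1) (cons k I M (n + 1) x s)) =
      act k I M n (cons k I M n (d k I M n x) s) := by
  suffices h : d k I M n ∘ₗ act k I M (n + 1) ∘ₗ (cons k I M (n + 1)).flip s =
      act k I M n ∘ₗ (cons k I M n).flip s ∘ₗ d k I M n from LinearMap.congr_fun h x
  refine ext_cons k I M fun y r => ?_
  simp only [LinearMap.comp_apply, LinearMap.flip_apply, act_succ_cons]
  cases n with
  | zero => rw [d_zero, act_act]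
  | succ n =>
    rw [d_succ_cons, d_succ_cons, map_add, LinearMap.add_apply, map_add,
      (cons k I M (n + 1)).map_smul, LinearMap.smul_apply, (act k I M (n + 1)).map_smul,
      act_succ_cons, act_act]

/-- The differential of the bar complex squares to zero. -/
lemma d_d (n : ℕ) (x : obj k I M (n + 2)) : d k I M n (d k I M (n + 1) x) = 0 := by
  induction n with
  | zero =>
    suffices h : d k I M 0 ∘ₗ d k I M 1 = 0 from LinearMap.congr_fun h x
    refine ext_cons k I M fun y r => ?_
    rw [LinearMap.comp_apply, d_succ_cons, map_add, map_smul, d_act]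
    simp [d_zero]
  | succ n ih =>
    suffices h : d k I M (n + 1) ∘ₗ d k I M (n + 2) = 0 from LinearMap.congr_fun h x
    refine ext_cons k I M fun y r => ?_
    rw [LinearMap.comp_apply, d_succ_cons, map_add, map_smul, d_act, d_succ_cons, ih,
      pow_succ _ (n + 1)]
    simp

/-- The `n`-cycles of the bar complex. -/
noncomputable def cycles : ∀ n, Submodule k (obj k I M n)
  | 0 => ⊤
  | n + 1 => LinearMap.ker (d k I M n)

/-- The `n`-boundaries of the bar complex. -/
noncomputable def boundaries (n : ℕ) : Submodule k (obj k I M n) := LinearMap.range (d k I M n)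

lemma boundaries_le_cycles (n : ℕ) : boundaries k I M n ≤ cycles k I M n := by
  rintro _ ⟨x, rfl⟩
  cases n with
  | zero => trivial
  | succ n => exact d_d k I M n x

/-- `Tor_n^R(M, R / I)`, as the homology of the reduced bar complex
`⋯ → M ⊗ I ⊗ I → M ⊗ I → M`. This computes `Tor` when `k` is a field and `I` is the augmentation
ideal of the `k`-algebra `R`, i.e. `R = k ⊕ I`, so that `R / I = k`. Mathlib's `Tor` over `R` carries
no internal grading, whereas here it is inherited from the gradings of `R` and `M`. -/
abbrev Tor (n : ℕ) : Type u :=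
  cycles k I M n ⧸ (boundaries k I M n).submoduleOf (cycles k I M n)

end Complex

section Action
variable {k : Type u} [CommRing k] {R : Type u} [CommRing R] [Algebra k R] (I : Ideal R)
  {M : Type u} [AddCommGroup M] [Module k M] [Module R M] [IsScalarTower k R M]
  {Γ : Type v} [Group Γ] (ρ : Representation R Γ M)

/-- The action of `Γ` on the bar complex through its action on `M`. -/
noncomputable def objRep : ∀ n, Representation k Γ (obj k I M n)
  | 0 => (restrictRep k ρ : Representation k Γ M)
  | n + 1 => (objRep n).tprod (Representation.trivial k Γ I)

lemma objRep_zero (γ : Γ) (m : M) : objRep (k := k) I ρ 0 γ m = (ρ γ m : M) := rfl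

lemma objRep_cons (n : ℕ) (γ : Γ) (x : obj k I M n) (r : I) :
    objRep I ρ (n + 1) γ (cons k I M n x r) = cons k I M n (objRep I ρ n γ x) r := rfl

lemma act_equivariant (n : ℕ) (γ : Γ) (x : obj k I M (n + 1)) :
    act k I M n (objRep I ρ (n + 1) γ x) = objRep I ρ n γ (act k I M n x) := by
  suffices h : act k I M n ∘ₗ objRep I ρ (n + 1) γ = objRep I ρ n γ ∘ₗ act k I M n from
    LinearMap.congr_fun h x
  refine ext_cons k I M fun y r => ?_
  cases n with
  | zero => exact ((ρ γ).map_smul (r : R) (show M from y)).symm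
  | succ n =>
    suffices h : act k I M (n + 1) ∘ₗ objRep I ρ (n + 2) γ ∘ₗ (cons k I M (n + 1)).flip r =
        objRep I ρ (n + 1) γ ∘ₗ act k I M (n + 1) ∘ₗ (cons k I M (n + 1)).flip r from
      LinearMap.congr_fun h y
    exact ext_cons k I M fun z s => rfl

lemma d_equivariant (n : ℕ) (γ : Γ) (x : obj k I M (n + 1)) :
    d k I M n (objRep I ρ (n + 1) γ x) = objRep I ρ n γ (d k I M n x) := by
  induction n with
  | zero => exact act_equivariant I ρ 0 γ x
  | succ n ih =>
    suffices h : d k I M (n + 1) ∘ₗ objRep I ρ (n + 2) γ = objRep I ρ (n + 1) γ ∘ₗ d k I M (n + 1)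
      from LinearMap.congr_fun h x
    refine ext_cons k I M fun y r => ?_
    rw [LinearMap.comp_apply, LinearMap.comp_apply, objRep_cons, d_succ_cons, d_succ_cons,
      ← objRep_cons, act_equivariant, ih, map_add, map_smul, objRep_cons]

lemma cycles_invariant (n : ℕ) (γ : Γ) :
    cycles k I M n ≤ (cycles k I M n).comap (objRep I ρ n γ) := by
  cases n with
  | zero => exact fun _ _ => trivial
  | succ n =>
    intro x hx
    have hx' : d k I M n x = 0 := hx
    change d k I M n _ = 0
    rw [d_equivariant, hx', map_zero]

lemma boundaries_invariant (n : ℕ) (γ : Γ) :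
    boundaries k I M n ≤ (boundaries k I M n).comap (objRep I ρ n γ) := by
  rintro _ ⟨x, rfl⟩
  exact ⟨objRep I ρ (n + 1) γ x, d_equivariant I ρ n γ x⟩

/-- The action of `Γ` on `Tor_n^R(M, R / I)`. -/
noncomputable def torRep (n : ℕ) : Representation k Γ (Tor k I M n) :=
  ((objRep I ρ n).subrepresentation (cycles k I M n) (cycles_invariant I ρ n)).quotient
    ((boundaries k I M n).submoduleOf (cycles k I M n))
    (fun γ _ hx => boundaries_invariant I ρ n γ hx)

variable (𝒜 : ℕ → Submodule k R) (ℳ : ℕ → Submodule k M)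

/-- The internal grading of the bar complex: the degree `j` part of `M ⊗ I ⊗ ⋯ ⊗ I` is spanned by
the tensors `m ⊗ r₁ ⊗ ⋯ ⊗ rₙ` of homogeneous elements whose degrees add up to `j`. Here `𝒜` and `ℳ`
are the gradings of `R` and `M`. -/
noncomputable def degree : ∀ n, ℕ → Submodule k (obj k I M n)
  | 0 => ℳ
  | n + 1 => fun j => ⨆ p : {p : ℕ × ℕ // p.1 + p.2 = j},
      Submodule.map₂ (cons k I M n) (degree n p.1.1) ((𝒜 p.1.2).comap (I.subtype.restrictScalars k))

/-- The graded component `Tor_n^R(M, R / I)_j`: the classes of cycles of internal degree `j`. -/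
noncomputable def torDegree (n j : ℕ) : Submodule k (Tor k I M n) :=
  ((degree I 𝒜 ℳ n j).submoduleOf (cycles k I M n)).map
    ((boundaries k I M n).submoduleOf (cycles k I M n)).mkQ

lemma degree_invariant (hℳ : ∀ γ j, ℳ j ≤ (ℳ j).comap (restrictRep k ρ γ)) (n j : ℕ) (γ : Γ) :
    degree I 𝒜 ℳ n j ≤ (degree I 𝒜 ℳ n j).comap (objRep I ρ n γ) := by
  induction n generalizing j with
  | zero => exact hℳ γ j
  | succ n ih =>
    refine iSup_le fun p => Submodule.map₂_le.mpr fun x hx r hr => ?_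
    exact Submodule.mem_iSup_of_mem p (Submodule.apply_mem_map₂ (cons k I M n) (ih _ hx) hr)

lemma torDegree_invariant (hℳ : ∀ γ j, ℳ j ≤ (ℳ j).comap (restrictRep k ρ γ)) (n j : ℕ) (γ : Γ) :
    torDegree I 𝒜 ℳ n j ≤ (torDegree I 𝒜 ℳ n j).comap (torRep I ρ n γ) := by
  rintro _ ⟨x, hx, rfl⟩
  exact ⟨_, degree_invariant I ρ 𝒜 ℳ hℳ n j γ hx, rfl⟩

/-- The action of `Γ` on `Tor_n^R(M, R / I)_j`, when `Γ` preserves the grading `ℳ` of `M`. -/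
noncomputable def torDegreeRep (hℳ : ∀ γ j, ℳ j ≤ (ℳ j).comap (restrictRep k ρ γ)) (n j : ℕ) :
    Representation k Γ (torDegree I 𝒜 ℳ n j) :=
  (torRep I ρ n).subrepresentation _ (torDegree_invariant I ρ 𝒜 ℳ hℳ n j)

end Action
end BarComplex

/-- The representation `M ⊗_R (R / I)` of `Γ`, for an `R`-linear representation `ρ` on `M`. -/
noncomputable def fiberRep (k : Type*) {R Γ M : Type*} [CommRing k] [CommRing R] [Algebra k R]
    [Group Γ] [AddCommGroup M] [Module k M] [Module R M] [IsScalarTower k R M] (I : Ideal R)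
    (ρ : Representation R Γ M) : Representation k Γ (M ⊗[R] (R ⧸ I)) where
  toFun γ := ((ρ γ).rTensor (R ⧸ I)).restrictScalars k
  map_one' := by
    rw [map_one, Module.End.one_eq_id, LinearMap.rTensor_id]
    rfl
  map_mul' _ _ := by
    rw [map_mul, Module.End.mul_eq_comp, LinearMap.rTensor_comp]
    rfl

/-- The homogeneous component `(M ⊗_R (R / I))_j`: the image of the component `ℳ j` of `M`. -/
noncomputable def fiberDegree {k R M : Type*} [CommRing k] [CommRing R] [Algebra k R]
    [AddCommGroup M] [Module k M] [Module R M] [IsScalarTower k R M] (I : Ideal R)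
    (ℳ : ℕ → Submodule k M) (j : ℕ) : Submodule k (M ⊗[R] (R ⧸ I)) :=
  (ℳ j).map (((TensorProduct.mk R M (R ⧸ I)).flip 1).restrictScalars k)

/-- The action of `Γ` on `(M ⊗_R (R / I))_j`, when `Γ` preserves the grading `ℳ` of `M`. -/
noncomputable def fiberDegreeRep {k R Γ M : Type*} [CommRing k] [CommRing R] [Algebra k R]
    [Group Γ] [AddCommGroup M] [Module k M] [Module R M] [IsScalarTower k R M] (I : Ideal R)
    (ρ : Representation R Γ M) (ℳ : ℕ → Submodule k M)
    (hℳ : ∀ γ j, ℳ j ≤ (ℳ j).comap (restrictRep k ρ γ)) (j : ℕ) :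
    Representation k Γ (fiberDegree I ℳ j) :=
  (fiberRep k I ρ).subrepresentation _ (by
    rintro γ _ ⟨m, hm, rfl⟩
    exact ⟨ρ γ m, hℳ γ j hm, rfl⟩)

/-- Extension of scalars `K ⊗_k W` of a representation `W` over `k`. -/
noncomputable def baseChangeRep {k : Type*} (K : Type*) {Γ W : Type*} [CommRing k] [CommRing K]
    [Algebra k K] [Group Γ] [AddCommGroup W] [Module k W] (ρ : Representation k Γ W) :
    Representation K Γ (K ⊗[k] W) where
  toFun γ := (ρ γ).baseChange K
  map_one' := by ext; simp
  map_mul' _ _ := by ext; simp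

/-- The `KΓ`-module `τ` has a finite exhaustive filtration
`0 = F_{-1} ⊆ F_0 ⊆ F_1 ⊆ ⋯` by `KΓ`-submodules with `F_j / F_{j-1}` isomorphic to `ν j` for all
`j ≥ 0`. (The submodule `F_{j-1}` is written `F j`.) -/
def HasFiltration {K Γ W : Type*} [CommRing K] [Group Γ] [AddCommGroup W] [Module K W]
    (τ : Representation K Γ W) {N : ℕ → Type*} [∀ j, AddCommGroup (N j)] [∀ j, Module K (N j)]
    (ν : ∀ j, Representation K Γ (N j)) : Prop :=
  ∃ F : ℕ → Submodule (MonoidAlgebra K Γ) τ.asModule,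
    F 0 = ⊥ ∧ Monotone F ∧ (∃ d, F d = ⊤) ∧
    ∀ j, Nonempty ((F (j + 1) ⧸ (F j).submoduleOf (F (j + 1))) ≃ₗ[MonoidAlgebra K Γ] (ν j).asModule)

namespace RelativeInvariants

/-- The polynomial algebra `k[V]`, i.e. the symmetric algebra on the dual space of `V`. -/
def Poly (k V : Type u) [Field k] [AddCommGroup V] [Module k V] : Type u :=
  SymmetricAlgebra k (Module.Dual k V)

section Poly
variable {k V : Type u} [Field k] [AddCommGroup V] [Module k V]

noncomputable instance : CommRing (Poly k V) :=
  inferInstanceAs (CommRing (SymmetricAlgebra k (Module.Dual k V)))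

noncomputable instance : Algebra k (Poly k V) :=
  inferInstanceAs (Algebra k (SymmetricAlgebra k (Module.Dual k V)))

/-- The inclusion of the linear forms on `V` in `k[V]`. -/
noncomputable def linearForm (k V : Type u) [Field k] [AddCommGroup V] [Module k V] :
    Module.Dual k V →ₗ[k] Poly k V :=
  SymmetricAlgebra.ι k (Module.Dual k V)

lemma poly_hom_ext {A : Type*} [CommRing A] [Algebra k A] {F H : Poly k V →ₐ[k] A}
    (h : ∀ f, F (linearForm k V f) = H (linearForm k V f)) : F = H :=
  SymmetricAlgebra.algHom_ext (LinearMap.ext h)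

/-- The algebra endomorphism of `k[V]` that acts on linear forms by `f ↦ f ∘ a`. -/
noncomputable def polyMap (a : V →ₗ[k] V) : Poly k V →ₐ[k] Poly k V :=
  SymmetricAlgebra.lift (linearForm k V ∘ₗ Module.Dual.transpose (R := k) a)

lemma polyMap_linearForm (a : V →ₗ[k] V) (f : Module.Dual k V) :
    polyMap a (linearForm k V f) = linearForm k V (f ∘ₗ a) :=
  SymmetricAlgebra.lift_ι_apply (linearForm k V ∘ₗ Module.Dual.transpose (R := k) a) f

lemma polyMap_id : polyMap (LinearMap.id : V →ₗ[k] V) = AlgHom.id k _ :=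
  poly_hom_ext fun f => polyMap_linearForm _ f

lemma polyMap_comp (a b : V →ₗ[k] V) : polyMap (a ∘ₗ b) = (polyMap b).comp (polyMap a) :=
  poly_hom_ext fun f => by
    rw [AlgHom.comp_apply, polyMap_linearForm, polyMap_linearForm, polyMap_linearForm,
      LinearMap.comp_assoc]

/-- The action of `GL(V)` on `k[V]` by linear change of coordinates: `g` acts as the algebra
automorphism that sends a linear form `f` to `f ∘ g⁻¹`. -/
noncomputable def polyRep : Representation k (LinearMap.GeneralLinearGroup k V) (Poly k V) where
  toFun g := (polyMap ((g⁻¹ : LinearMap.GeneralLinearGroup k V) : V →ₗ[k] V)).toLinearMap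
  map_one' := by
    rw [inv_one, Units.val_one, Module.End.one_eq_id, polyMap_id]
    rfl
  map_mul' g h := by
    rw [mul_inv_rev, Units.val_mul, Module.End.mul_eq_comp, polyMap_comp]
    rfl

lemma polyRep_one (g : LinearMap.GeneralLinearGroup k V) : polyRep g (1 : Poly k V) = 1 :=
  map_one (polyMap _)

lemma polyRep_mul (g : LinearMap.GeneralLinearGroup k V) (p q : Poly k V) :
    polyRep g (p * q) = polyRep g p * polyRep g q :=
  map_mul (polyMap _) p q

/-- The homogeneous polynomials of degree `d`: the span of the `d`-fold products of linear forms. -/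
noncomputable def polyDegree (k V : Type u) [Field k] [AddCommGroup V] [Module k V] (d : ℕ) :
    Submodule k (Poly k V) :=
  LinearMap.range (linearForm k V) ^ d

variable (G : Subgroup (LinearMap.GeneralLinearGroup k V))

/-- The algebra of invariants `k[V]^G`. -/
noncomputable def invariants : Subalgebra k (Poly k V) where
  carrier := {p | ∀ g ∈ G, polyRep g p = p}
  mul_mem' hp hq g hg := by rw [polyRep_mul, hp g hg, hq g hg]
  add_mem' hp hq g hg := by rw [map_add, hp g hg, hq g hg]
  algebraMap_mem' c g _ := by rw [Algebra.algebraMap_eq_smul_one, map_smul, polyRep_one]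

/-- The ideal `k[V]^G_+` of `k[V]^G` of invariants without constant term, spanned by the
homogeneous invariants of positive degree. -/
noncomputable def invariantsPlus : Ideal (invariants G) :=
  Ideal.span {r | ∃ d, 0 < d ∧ (r : Poly k V) ∈ polyDegree k V d}

/-- The component `(k[V]^G)_d` of degree `d` of the algebra of invariants. -/
noncomputable def invariantsDegree (d : ℕ) : Submodule k (invariants G) :=
  (polyDegree k V d).comap (invariants G).val.toLinearMap

end Poly

section Module
variable {k V U : Type u} [Field k] [AddCommGroup V] [Module k V] [AddCommGroup U] [Module k U]
  (G : Subgroup (LinearMap.GeneralLinearGroup k V)) (σ : Representation k (G)ᵐᵒᵖ U)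

/-- The diagonal action `g (u ⊗ p) = u g⁻¹ ⊗ g p` of `G` on `U ⊗ k[V]`, where `σ` is the right action
of `G` on `U`. We write the tensor factors in the order `k[V] ⊗ U`, so that Mathlib's module
structure over `k[V]` on the tensor product is the one coming from the factor `k[V]`. -/
noncomputable def diagonal (g : G) : Poly k V ⊗[k] U →ₗ[k] Poly k V ⊗[k] U :=
  TensorProduct.map (polyRep (g : LinearMap.GeneralLinearGroup k V)) (σ (MulOpposite.op g⁻¹))

lemma diagonal_smul (g : G) (r : invariants G) (x : Poly k V ⊗[k] U) :
    diagonal G σ g (r • x) = r • diagonal G σ g x := by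
  induction x using TensorProduct.induction_on with
  | zero => simp
  | add y z hy hz => rw [smul_add, map_add, map_add, smul_add, hy, hz]
  | tmul p u =>
    change polyRep (g : LinearMap.GeneralLinearGroup k V) ((r : Poly k V) * p) ⊗ₜ[k] _ =
      ((r : Poly k V) * polyRep (g : LinearMap.GeneralLinearGroup k V) p) ⊗ₜ[k] _
    rw [polyRep_mul, r.2 g g.2]

/-- The relative invariants `(U ⊗ k[V])^G`, as a `k[V]^G`-submodule of `U ⊗ k[V]`. -/
noncomputable def relInvSubmodule : Submodule (invariants G) (Poly k V ⊗[k] U) where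
  carrier := {x | ∀ g : G, diagonal G σ g x = x}
  zero_mem' _ := map_zero _
  add_mem' hx hy g := by rw [map_add, hx g, hy g]
  smul_mem' r x hx g := by rw [diagonal_smul, hx g]

/-- The module `M = (U ⊗ k[V])^G` of relative invariants. -/
def RelInv : Type u := relInvSubmodule G σ

noncomputable instance : AddCommGroup (RelInv G σ) :=
  inferInstanceAs (AddCommGroup (relInvSubmodule G σ))

noncomputable instance : Module (invariants G) (RelInv G σ) :=
  inferInstanceAs (Module (invariants G) (relInvSubmodule G σ))

noncomputable instance : Module k (RelInv G σ) :=
  inferInstanceAs (Module k (relInvSubmodule G σ))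

instance : IsScalarTower k (invariants G) (RelInv G σ) :=
  inferInstanceAs (IsScalarTower k (invariants G) (relInvSubmodule G σ))

/-- The inclusion of the module of relative invariants in `U ⊗ k[V]`. -/
noncomputable def relInvVal : RelInv G σ →ₗ[invariants G] Poly k V ⊗[k] U :=
  (relInvSubmodule G σ).subtype

/-- The homogeneous component of degree `d` of the module of relative invariants: those elements
that lie in `U ⊗ k[V]_d`. -/
noncomputable def relInvDegree (d : ℕ) : Submodule k (RelInv G σ) :=
  (LinearMap.range ((polyDegree k V d).subtype.rTensor U)).comap
    ((relInvVal G σ).restrictScalars k)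

variable {Γ : Type v} [Group Γ] (ρ : Representation k Γ U)

/-- The action of `γ ∈ Γ` on `U ⊗ k[V]` through `U`. -/
noncomputable def leftAct (γ : Γ) : Poly k V ⊗[k] U →ₗ[invariants G] Poly k V ⊗[k] U :=
  TensorProduct.AlgebraTensorModule.lTensor (invariants G) (Poly k V) (ρ γ)

lemma leftAct_tmul (γ : Γ) (p : Poly k V) (u : U) :
    leftAct G ρ γ (p ⊗ₜ u) = p ⊗ₜ ρ γ u := rfl

lemma diagonal_tmul (g : G) (p : Poly k V) (u : U) :
    diagonal G σ g (p ⊗ₜ u) =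
      polyRep (g : LinearMap.GeneralLinearGroup k V) p ⊗ₜ σ (MulOpposite.op g⁻¹) u := rfl

lemma leftAct_mem (hcomm : ∀ (γ : Γ) (g : G), Commute (ρ γ) (σ (MulOpposite.op g)))
    (γ : Γ) (x : Poly k V ⊗[k] U) (hx : x ∈ relInvSubmodule G σ) :
    leftAct G ρ γ x ∈ relInvSubmodule G σ := by
  intro g
  have h : ∀ y : Poly k V ⊗[k] U,
      diagonal G σ g (leftAct G ρ γ y) = leftAct G ρ γ (diagonal G σ g y) := by
    intro y
    induction y using TensorProduct.induction_on with
    | zero => simp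
    | add y z hy hz => rw [map_add, map_add, map_add, map_add, hy, hz]
    | tmul p u =>
      rw [leftAct_tmul, diagonal_tmul, diagonal_tmul, leftAct_tmul]
      exact congrArg _ (LinearMap.congr_fun (hcomm γ g⁻¹).eq u).symm
  rw [h, hx g]

variable (hcomm : ∀ (γ : Γ) (g : G), Commute (ρ γ) (σ (MulOpposite.op g)))

/-- The action of `Γ` on the module of relative invariants by `k[V]^G`-linear maps, induced by an
action `ρ` of `Γ` on `U` that commutes with the right action of `G`. -/
noncomputable def relInvRep : Representation (invariants G) Γ (RelInv G σ) where
  toFun γ := ((leftAct G ρ γ).restrict (leftAct_mem G σ ρ hcomm γ) :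
    relInvSubmodule G σ →ₗ[invariants G] relInvSubmodule G σ)
  map_one' := by
    refine LinearMap.ext fun x => Subtype.ext ?_
    change (ρ 1).lTensor (Poly k V) (relInvVal G σ x) = relInvVal G σ x
    rw [map_one, Module.End.one_eq_id, LinearMap.lTensor_id, LinearMap.id_apply]
  map_mul' γ δ := by
    refine LinearMap.ext fun x => Subtype.ext ?_
    change (ρ (γ * δ)).lTensor (Poly k V) (relInvVal G σ x) =
      (ρ γ).lTensor (Poly k V) ((ρ δ).lTensor (Poly k V) (relInvVal G σ x))
    rw [map_mul, Module.End.mul_eq_comp, LinearMap.lTensor_comp, LinearMap.comp_apply]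

lemma relInvDegree_invariant (γ : Γ) (d : ℕ) : relInvDegree G σ d ≤
    (relInvDegree G σ d).comap (restrictRep k (relInvRep G σ ρ hcomm) γ) := by
  rintro x ⟨y, hy⟩
  refine ⟨(ρ γ).lTensor (polyDegree k V d) y, ?_⟩
  change (polyDegree k V d).subtype.rTensor U ((ρ γ).lTensor (polyDegree k V d) y) =
    (ρ γ).lTensor (Poly k V) (relInvVal G σ x)
  have hy' : (polyDegree k V d).subtype.rTensor U y = relInvVal G σ x := hy
  rw [← hy', ← LinearMap.comp_apply, ← LinearMap.comp_apply, LinearMap.rTensor_comp_lTensor,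
    LinearMap.lTensor_comp_rTensor]

/-- `M ⊗_{k[V]^G} k` for the module `M` of relative invariants, where
`k = k[V]^G / k[V]^G_+`. -/
abbrev Fiber : Type u := RelInv G σ ⊗[invariants G] (invariants G ⧸ invariantsPlus G)

/-- The `kΓ`-module structure of `M ⊗_{k[V]^G} k`. -/
noncomputable def relFiberRep : Representation k Γ (Fiber G σ) :=
  fiberRep k (invariantsPlus G) (relInvRep G σ ρ hcomm)

/-- The homogeneous component `(M ⊗_{k[V]^G} k)_j`. -/
noncomputable abbrev relFiberDegree (j : ℕ) : Submodule k (Fiber G σ) :=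
  fiberDegree (invariantsPlus G) (relInvDegree G σ) j

/-- The `kΓ`-module structure of `(M ⊗_{k[V]^G} k)_j`. -/
noncomputable def relFiberDegreeRep (j : ℕ) : Representation k Γ (relFiberDegree G σ j) :=
  fiberDegreeRep (invariantsPlus G) (relInvRep G σ ρ hcomm) (relInvDegree G σ)
    (relInvDegree_invariant G σ ρ hcomm) j

/-- `Tor_i(M, k)` over `k[V]^G`, for the module `M` of relative invariants. -/
abbrev RelTor (i : ℕ) : Type u := BarComplex.Tor k (invariantsPlus G) (RelInv G σ) i

/-- The homogeneous component `Tor_i(M, k)_j` of `Tor_i(M, k)` over `k[V]^G`. -/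
noncomputable abbrev relTorDegree (i j : ℕ) : Submodule k (RelTor G σ i) :=
  BarComplex.torDegree (invariantsPlus G) (invariantsDegree G)
    (relInvDegree G σ) i j

/-- The `kΓ`-module structure of `Tor_i(M, k)_j`. -/
noncomputable def relTorDegreeRep (i j : ℕ) : Representation k Γ (relTorDegree G σ i j) :=
  BarComplex.torDegreeRep (invariantsPlus G) (relInvRep G σ ρ hcomm)
    (invariantsDegree G) (relInvDegree G σ) (relInvDegree_invariant G σ ρ hcomm) i j

end Module
end RelativeInvariants

/-! Write `M_U` for the module of relative invariants of `U`, and call `dim eX` the dimension of the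
part of a `kΓ`-module `X` cut out by an idempotent `e` of `kΓ`.

Removing `Γ`. The functor `X ↦ eX` is exact, so `dim eX` is an additive function on the Grothendieck
group (`Groth.idemDim`). For every simple `S` some `e` does not kill `S` but kills all other simple
modules, and then `dim eX` is a fixed positive multiple of the multiplicity of `S` in `X`
(`exists_idemDim_eq_mult`). Thus equalities and inequalities of classes can be tested on the numbers
`dim eX`. As `Γ` commutes with `G`, the space `eU` is stable under `G`, and the `e`-part of
`Tor_i(M_U, k)_j` is `Tor_i(M_{eU}, k)_j` (`idemRank_relTorDegreeRep`). What remains are statements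
about dimensions of `Tor`, for the graded modules `M_{eU}`.

Rank. The rank of `M_U` over `R` is `dim U` (`finrank_relInv`): elements of `M_U` independent over
`R` stay independent over `k[V]`, and by Dedekind's independence of characters a functional on `k[V]
⊗ U` that kills `M_U` is zero.

Parts (i) and (ii). Let `F → N` be a minimal graded free cover with kernel `L`. Then `dim Tor_0(N,
k) = rank F = rank N + rank L` and `Tor_{i+1}(N, k) ≅ Tor_i(L, k)`. By iteration the alternating sum
up to `m` equals `rank N + (-1)^m s`, where `s` is the rank of the syzygy reached after `m + 1`
covers (`exists_sum_finrank_tor`). This syzygy lies in a free module, so `s = 0` exactly if it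
vanishes, that is, if `Tor_i = 0` for all `i > m`. The case `m = 0` gives the first half of (i).

Filtration. By the normal basis theorem some polynomial `p` has a `G`-orbit that is independent over
`R`, and `u ↦ ∑ g (u ⊗ p)` then induces a `Γ`-isomorphism `K ⊗ U ≅ K ⊗ M` (`exists_generic_equiv`).
Filter by the spans of the components of `M` of bounded degree. The degree `j` part of `R_+ M` comes
from lower degrees, so the `j`-th layer is a quotient of `K ⊗ (M ⊗ k)_j`; for `M` free the
dimensions add up to `dim U`, and all these quotient maps are isomorphisms
(`hasFiltration_of_span_eq_top`).

Part (iii). The bar complex shows that the Euler series of `Tor` times the Hilbert series of `R` is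
the Hilbert series of the module (`hilbertSeries_tor_mul`). By Hilbert–Serre the quotient is
rational. A torsion-free graded module of rank `r` contains a graded free module with generators in
degrees `a_1, …, a_r`, and is carried into it by a nonzero homogeneous element of some degree `d`.
So for `0 < t < 1` the quotient lies between `∑ t^{a_i}` and `t^{-d} ∑ t^{a_i}`, and it tends to `r`
as `t` tends to `1` from below (`exists_ratFunc_of_le`). -/

/-! ### Dimensions of the parts cut out by an idempotent of the group algebra -/

section AsAlgebraHom
variable {k G V W : Type*} [CommRing k] [Monoid G] [AddCommGroup V] [Module k V]
  [AddCommGroup W] [Module k W] {ρ : Representation k G V} {σ : Representation k G W}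

lemma Representation.asAlgebraHom_comm (f : V →ₗ[k] W) (hf : ∀ g x, f (ρ g x) = σ g (f x))
    (e : MonoidAlgebra k G) (x : V) : f (ρ.asAlgebraHom e x) = σ.asAlgebraHom e (f x) := by
  induction e using MonoidAlgebra.induction_on with
  | of g => simp [hf]
  | add a b ha hb => simp [ha, hb]
  | smul r a ha => simp [ha]

end AsAlgebraHom

section IdemRank
variable {k G : Type*} [Field k] [Group G]

/-- The dimension of `e W` for a representation on `W` and an element `e` of the group algebra. -/
noncomputable def idemRank (e : MonoidAlgebra k G) {W : Type*} [AddCommGroup W] [Module k W]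
    (ρ : Representation k G W) : ℕ :=
  Module.finrank k (LinearMap.range (ρ.asAlgebraHom e))

variable {X Y Z : Type*} [AddCommGroup X] [Module k X] [AddCommGroup Y] [Module k Y]
  [AddCommGroup Z] [Module k Z]
  {ρX : Representation k G X} {ρY : Representation k G Y} {ρZ : Representation k G Z}

/-- The sequence of `e`-parts is again exact. In the middle this uses `e² = e`: if `y = e y` is the
image of `x`, then `y` is also the image of `e x`. -/
lemma idemRank_add [Module.Finite k Y] {e : MonoidAlgebra k G} (he : IsIdempotentElem e)
    (f : X →ₗ[k] Y) (g : Y →ₗ[k] Z)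
    (hf : ∀ a x, f (ρX a x) = ρY a (f x)) (hg : ∀ a x, g (ρY a x) = ρZ a (g x))
    (hinj : Function.Injective f) (hex : Function.Exact f g) (hsurj : Function.Surjective g) :
    idemRank e ρY = idemRank e ρX + idemRank e ρZ := by
  have hf' := Representation.asAlgebraHom_comm f hf e
  have hg' := Representation.asAlgebraHom_comm g hg e
  have hid (y : Y) : ρY.asAlgebraHom e (ρY.asAlgebraHom e y) = ρY.asAlgebraHom e y := by
    rw [← Module.End.mul_apply, ← map_mul, he.eq]
  let E := LinearMap.range (ρY.asAlgebraHom e)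
  have h1 := LinearMap.finrank_range_add_finrank_ker (g.domRestrict E)
  have h2 : LinearMap.range (g.domRestrict E) = LinearMap.range (ρZ.asAlgebraHom e) := by
    ext z
    constructor
    · rintro ⟨⟨_, y, rfl⟩, rfl⟩
      exact ⟨g y, (hg' y).symm⟩
    · rintro ⟨z, rfl⟩
      obtain ⟨y, rfl⟩ := hsurj z
      exact ⟨⟨_, y, rfl⟩, hg' y⟩
  have h3 : (LinearMap.ker (g.domRestrict E)).map E.subtype =
      (LinearMap.range (ρX.asAlgebraHom e)).map f := by
    ext y
    constructor
    · rintro ⟨⟨_, y, rfl⟩, hy, rfl⟩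
      obtain ⟨x, hx⟩ := (hex _).1 hy
      refine ⟨_, ⟨x, rfl⟩, ?_⟩
      rw [hf', hx]
      exact hid y
    · rintro ⟨_, ⟨x, rfl⟩, rfl⟩
      exact ⟨⟨_, f x, (hf' x).symm⟩, (hex _).2 ⟨_, rfl⟩, rfl⟩
  have h4 := LinearEquiv.finrank_eq
    (Submodule.equivMapOfInjective E.subtype E.injective_subtype (LinearMap.ker (g.domRestrict E)))
  have h5 := LinearEquiv.finrank_eq
    (Submodule.equivMapOfInjective f hinj (LinearMap.range (ρX.asAlgebraHom e)))
  rw [h3] at h4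
  unfold idemRank
  rw [h2] at h1
  change _ = Module.finrank k E at h1
  change Module.finrank k E = _
  omega

lemma idemRank_congr (e : MonoidAlgebra k G) (f : X ≃ₗ[k] Y)
    (hf : ∀ a x, f (ρX a x) = ρY a (f x)) : idemRank e ρX = idemRank e ρY := by
  have hf' := Representation.asAlgebraHom_comm f.toLinearMap hf e
  refine LinearEquiv.finrank_eq (f.submoduleMap _ ≪≫ₗ LinearEquiv.ofEq _ _ ?_)
  ext y
  constructor
  · rintro ⟨_, ⟨x, rfl⟩, rfl⟩
    exact ⟨f x, (hf' x).symm⟩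
  · rintro ⟨y, rfl⟩
    exact ⟨_, ⟨f.symm y, rfl⟩, by simpa using hf' (f.symm y)⟩

end IdemRank

/-! ### Additive functions on the Grothendieck group -/

namespace Groth
variable {k : Type u} {Γ : Type v} [Field k] [Group Γ]

lemma cls_add {X Y Z : Type u} [AddCommGroup X] [Module k X] [Module.Finite k X]
    [AddCommGroup Y] [Module k Y] [Module.Finite k Y] [AddCommGroup Z] [Module k Z]
    [Module.Finite k Z] (ρX : Representation k Γ X) (ρY : Representation k Γ Y)
    (ρZ : Representation k Γ Z) (f : X →ₗ[k] Y) (g : Y →ₗ[k] Z)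
    (hf : ∀ a x, f (ρX a x) = ρY a (f x)) (hg : ∀ a x, g (ρY a x) = ρZ a (g x))
    (hinj : Function.Injective f) (hex : Function.Exact f g) (hsurj : Function.Surjective g) :
    cls ρY = cls ρX + cls ρZ := by
  have : FreeAbelianGroup.of (FDRep.of ρX) - FreeAbelianGroup.of (FDRep.of ρY) +
      FreeAbelianGroup.of (FDRep.of ρZ) ∈ grothRel k Γ :=
    AddSubgroup.subset_closure ⟨FDRep.of ρX, FDRep.of ρY, FDRep.of ρZ,
      ⟨f, fun a => LinearMap.ext (hf a)⟩, ⟨g, fun a => LinearMap.ext (hg a)⟩, hinj, hex, hsurj, rfl⟩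
  have h := (QuotientAddGroup.eq_zero_iff _).2 this
  have h' : cls ρX - cls ρY + cls ρZ = 0 := h
  rw [← sub_eq_zero, ← neg_eq_zero, ← h']
  abel

/-- The two objects are the first terms of an exact sequence whose last term is the zero
representation, and the class of the latter vanishes. -/
lemma of_eq_cls (X : FDRep k Γ) : of X = cls X.rep := by
  have : Subsingleton (Module.End k PUnit.{u+1}) := inferInstance
  let τ : Representation k Γ PUnit.{u+1} := 1
  have h0 : cls τ = 0 := by
    have := cls_add τ τ τ LinearMap.id LinearMap.id (fun _ _ => rfl) (fun _ _ => rfl)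
      (fun _ _ h => h) (fun x => by simp) (fun x => ⟨x, rfl⟩)
    simpa using this
  have : FreeAbelianGroup.of X - FreeAbelianGroup.of (FDRep.of X.rep) +
      FreeAbelianGroup.of (FDRep.of τ) ∈ grothRel k Γ :=
    AddSubgroup.subset_closure ⟨X, FDRep.of X.rep, FDRep.of τ,
      ⟨LinearMap.id, fun _ => rfl⟩, ⟨0, fun a => by ext⟩, fun _ _ h => h,
      fun x => ⟨fun _ => ⟨x, rfl⟩, fun _ => rfl⟩, fun x => ⟨0, rfl⟩, rfl⟩
  have h := (QuotientAddGroup.eq_zero_iff _).2 this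
  have h' : of X - cls X.rep + cls τ = 0 := h
  rwa [h0, add_zero, sub_eq_zero] at h'

/-- The additive function `[X] ↦ dim e X` on the Grothendieck group, for an idempotent `e` of the
group algebra. -/
noncomputable def idemDim {e : MonoidAlgebra k Γ} (he : IsIdempotentElem e) : Groth k Γ →+ ℤ :=
  QuotientAddGroup.lift (grothRel k Γ)
    (FreeAbelianGroup.lift fun X : FDRep k Γ => (idemRank e X.rep : ℤ)) (by
    rw [grothRel, AddSubgroup.closure_le]
    rintro x ⟨X, Y, Z, f, g, hf, hfg, hg, rfl⟩
    have h := idemRank_add (ρX := X.rep) (ρY := Y.rep) (ρZ := Z.rep) he f.toLinearMap g.toLinearMap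
      (fun a x => Representation.IntertwiningMap.isIntertwining _ _ f a x)
      (fun a x => Representation.IntertwiningMap.isIntertwining _ _ g a x) hf hfg hg
    simp [h])

lemma idemDim_of {e : MonoidAlgebra k Γ} (he : IsIdempotentElem e) (X : FDRep k Γ) :
    idemDim he (of X) = idemRank e X.rep := by
  change FreeAbelianGroup.lift _ (FreeAbelianGroup.of X) = _
  simp

lemma idemDim_cls {e : MonoidAlgebra k Γ} (he : IsIdempotentElem e) {W : Type u} [AddCommGroup W]
    [Module k W] [Module.Finite k W] (ρ : Representation k Γ W) :
    idemDim he (cls ρ) = idemRank e ρ :=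
  idemDim_of he (FDRep.of ρ)

lemma mult_of (S X : FDRep k Γ) : mult S (of X) =
    JordanHolder.factorMultiplicity (MonoidAlgebra k Γ) S.rep.asModule X.rep.asModule := by
  change FreeAbelianGroup.lift _ (FreeAbelianGroup.of X) = _
  simp

end Groth

/-! ### Idempotents that separate simple modules -/

/-- Modulo the radical `J`, the annihilator of a nonzero `s₀ ∈ S` has a complementary left ideal
`L`, isomorphic to `S` and generated by an idempotent; as `J` is nilpotent, this idempotent lifts to
`e`. If `e t ≠ 0` in a simple module `T`, then the annihilator of `e s₀` kills `e t`, and by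
maximality the two annihilators agree. -/
lemma exists_isIdempotentElem_of_isSimpleModule {A : Type*} [Ring A] [IsArtinianRing A]
    (S : Type u) [AddCommGroup S] [Module A S] [IsSimpleModule A S] :
    ∃ e : A, IsIdempotentElem e ∧ (∃ s : S, e • s ≠ 0) ∧
      ∀ (T : Type u) [AddCommGroup T] [Module A T] [IsSimpleModule A T] (t : T), e • t ≠ 0 →
        Nonempty (S ≃ₗ[A] T) := by
  have := IsSimpleModule.nontrivial A S
  let J := Ring.jacobson A
  have hJ (T : Type u) [AddCommGroup T] [Module A T] [IsSimpleModule A T] (a : A) (ha : a ∈ J)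
      (t : T) : a • t = 0 :=
    Module.mem_annihilator.1 (IsSemisimpleModule.jacobson_le_annihilator A T ha) t
  obtain ⟨s₀, hs₀⟩ := exists_ne (0 : S)
  let π := Ideal.Quotient.mk J
  have hπ : Function.Surjective π := Ideal.Quotient.mk_surjective
  let m := LinearMap.ker (LinearMap.toSpanSingleton A S s₀)
  -- Since `J` kills `S`, the annihilator of `s₀` can be recognized modulo `J`.
  have hm (a : A) : π a ∈ Ideal.map π m ↔ a • s₀ = 0 := by
    rw [Ideal.mem_map_iff_of_surjective π hπ]
    constructor
    · rintro ⟨b, hb, hab⟩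
      have hb' : b • s₀ = 0 := hb
      have := hJ S (b - a) (Ideal.Quotient.eq.1 hab) s₀
      rw [sub_smul, hb', zero_sub, neg_eq_zero] at this
      exact this
    · exact fun h => ⟨a, h, rfl⟩
  obtain ⟨L, hL⟩ := exists_isCompl (Ideal.map π m)
  obtain ⟨ē, hē, hLe⟩ := IsSemisimpleRing.ideal_eq_span_idempotent L
  obtain ⟨e, he, hee⟩ := exists_isIdempotentElem_eq_of_ker_isNilpotent π (fun x hx => by
      obtain ⟨n, hn⟩ := IsSemiprimaryRing.isNilpotent (R := A)
      refine ⟨n, ?_⟩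
      have := Ideal.pow_mem_pow (I := J) (Ideal.Quotient.eq_zero_iff_mem.1 hx) n
      rw [hn] at this
      exact this) ē (hπ ē) hē
  have heL : π e ∈ L := by rw [hLe, hee]; exact Ideal.mem_span_singleton_self _
  have hne : e • s₀ ≠ 0 := by
    intro h
    have h0 : π e = 0 := by
      have := hL.disjoint.le_bot (show π e ∈ Ideal.map π m ⊓ L from ⟨(hm e).2 h, heL⟩)
      simpa using this
    rw [hLe, ← hee, h0] at hL
    have h1 : (1 : A ⧸ J) ∈ Ideal.map π m := by
      have := hL.codisjoint.eq_top
      rw [Ideal.span_singleton_eq_bot.2 rfl, sup_bot_eq] at this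
      rw [this]; trivial
    rw [← map_one π, hm, one_smul] at h1
    exact hs₀ h1
  refine ⟨e, he, ⟨s₀, hne⟩, fun T _ _ _ t ht => ?_⟩
  let f := LinearMap.toSpanSingleton A S (e • s₀)
  let g := LinearMap.toSpanSingleton A T (e • t)
  have hfs : Function.Surjective f := IsSimpleModule.toSpanSingleton_surjective A hne
  have hgs : Function.Surjective g := IsSimpleModule.toSpanSingleton_surjective A ht
  -- If `a e s₀ = 0`, the class of `a e` lies both in the annihilator and in its complement `L`; so
  -- `a e ∈ J`, which kills `T`.
  have hle : LinearMap.ker f ≤ LinearMap.ker g := by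
    intro a ha
    have ha' : a • e • s₀ = 0 := ha
    rw [smul_smul] at ha'
    have h0 : π (a * e) = 0 := by
      have := hL.disjoint.le_bot (show π (a * e) ∈ Ideal.map π m ⊓ L from
        ⟨(hm _).2 ha', by rw [map_mul]; exact L.mul_mem_left _ heL⟩)
      simpa using this
    change a • e • t = 0
    rw [smul_smul]
    exact hJ T _ (Ideal.Quotient.eq_zero_iff_mem.1 h0) t
  have hf : IsCoatom (LinearMap.ker f) := by
    rw [← isSimpleModule_iff_isCoatom]
    exact IsSimpleModule.congr (f.quotKerEquivOfSurjective hfs)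
  have hg : LinearMap.ker g ≠ ⊤ := fun h => ht (by
    have : (1 : A) ∈ LinearMap.ker g := by rw [h]; trivial
    simpa [g] using this)
  have heq : LinearMap.ker f = LinearMap.ker g := (hf.le_iff.1 hle).resolve_left hg |>.symm
  exact ⟨(f.quotKerEquivOfSurjective hfs).symm ≪≫ₗ Submodule.quotEquivOfEq _ _ heq ≪≫ₗ
    g.quotKerEquivOfSurjective hgs⟩

namespace JordanHolder
variable {A : Type*} [Ring A]

lemma factorMultiplicity_of_isSimpleModule (S T : Type*) [AddCommGroup S] [Module A S]
    [AddCommGroup T] [Module A T] [IsSimpleModule A T] :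
    (Nonempty (T ≃ₗ[A] S) → factorMultiplicity A S T = 1) ∧
      (¬ Nonempty (T ≃ₗ[A] S) → factorMultiplicity A S T = 0) := by
  classical
  let s : CompositionSeries (Submodule A T) :=
    { length := 1
      toFun := ![⊥, ⊤]
      step := fun i => by
        fin_cases i
        exact bot_covBy_top }
  have e : ((⊤ : Submodule A T) ⧸ (⊥ : Submodule A T).submoduleOf ⊤) ≃ₗ[A] T :=
    (Submodule.quotEquivOfEqBot _ (by simp [Submodule.submoduleOf])) ≪≫ₗ Submodule.topEquiv
  have h : IsFactor S (⊥ : Submodule A T) ⊤ ↔ Nonempty (T ≃ₗ[A] S) :=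
    ⟨fun ⟨g⟩ => ⟨e.symm ≪≫ₗ g⟩, fun ⟨g⟩ => ⟨e ≪≫ₗ g⟩⟩
  have hs : seriesCount S s = if IsFactor S (⊥ : Submodule A T) ⊤ then 1 else 0 :=
    Fin.sum_univ_one _
  rw [factorMultiplicity_eq s rfl rfl, hs, h]
  exact ⟨fun h => if_pos h, fun h => if_neg h⟩

end JordanHolder

/-- The `k[G]`-linear equivalence of an equivariantly embedded representation with a submodule. -/
noncomputable def Representation.asModuleSubEquiv {k G V W : Type*} [CommRing k] [Monoid G]
    [AddCommGroup V] [Module k V] [AddCommGroup W] [Module k W] (σ : Representation k G V)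
    (ρ : Representation k G W) (f : V →ₗ[k] W) (hf : ∀ g x, f (σ g x) = ρ g (f x))
    (hinj : Function.Injective f) (T : Submodule (MonoidAlgebra k G) ρ.asModule)
    (hT : ∀ x : W, (show ρ.asModule from x) ∈ T ↔ x ∈ LinearMap.range f) :
    σ.asModule ≃ₗ[MonoidAlgebra k G] T :=
  LinearEquiv.ofBijective
    ({ toFun := fun x => ⟨f x, (hT _).2 ⟨x, rfl⟩⟩
       map_add' := fun x y => Subtype.ext (f.map_add x y)
       map_smul' := fun a x => Subtype.ext (Representation.asAlgebraHom_comm f hf a x) } :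
      σ.asModule →ₗ[MonoidAlgebra k G] T)
    ⟨fun x y h => hinj (congrArg Subtype.val h), fun ⟨y, hy⟩ => by
      obtain ⟨x, hx⟩ := (hT y).1 hy
      exact ⟨x, Subtype.ext hx⟩⟩

/-! ### The cone of classes of modules, and its description by multiplicities -/

namespace Groth
variable {k : Type u} {Γ : Type v} [Field k] [Group Γ]

lemma cls_of_subsingleton {W : Type u} [AddCommGroup W] [Module k W] [Module.Finite k W]
    [Subsingleton W] (ρ : Representation k Γ W) : cls ρ = 0 := by
  have := cls_add ρ ρ ρ LinearMap.id LinearMap.id (fun _ _ => rfl) (fun _ _ => rfl)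
    (fun _ _ h => h) (fun x => by simp [Subsingleton.elim x 0]) (fun x => ⟨x, rfl⟩)
  simpa using this

lemma cls_congr {X Y : Type u} [AddCommGroup X] [Module k X] [Module.Finite k X]
    [AddCommGroup Y] [Module k Y] [Module.Finite k Y] {ρX : Representation k Γ X}
    {ρY : Representation k Γ Y} (f : X ≃ₗ[k] Y) (hf : ∀ a x, f (ρX a x) = ρY a (f x)) :
    cls ρX = cls ρY := by
  let τ : Representation k Γ PUnit.{u+1} := 1
  have := cls_add ρX ρY τ f.toLinearMap 0 hf (fun _ _ => rfl) f.injective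
    (fun y => ⟨fun _ => ⟨f.symm y, by simp⟩, fun _ => rfl⟩) (fun x => ⟨0, rfl⟩)
  rw [this, cls_of_subsingleton τ, add_zero]

variable (k Γ) in
/-- The submonoid of the Grothendieck group generated by the classes of simple modules. -/
noncomputable def effective : AddSubmonoid (Groth k Γ) :=
  AddSubmonoid.closure {x | ∃ S : FDRep k Γ, S.rep.IsIrreducible ∧ x = of S}

/-- Induction on the dimension, splitting off a simple submodule of a nonzero module. -/
lemma cls_mem_effective {W : Type u} [AddCommGroup W] [Module k W] [Module.Finite k W]
    (ρ : Representation k Γ W) : cls ρ ∈ effective k Γ := by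
  induction h : Module.finrank k W using Nat.strong_induction_on generalizing W with
  | _ n ih =>
  rcases subsingleton_or_nontrivial W with hW | hW
  · rw [cls_of_subsingleton]
    exact zero_mem _
  have : IsArtinian (MonoidAlgebra k Γ) ρ.asModule := by
    have : Module.Finite k ρ.asModule := inferInstanceAs (Module.Finite k W)
    exact isArtinian_of_tower k inferInstance
  have : Nontrivial ρ.asModule := hW
  obtain ⟨T, hT⟩ := IsAtomic.exists_atom (Submodule (MonoidAlgebra k Γ) ρ.asModule)
  let T' := Subrepresentation.ofSubmodule' T
  have hT' : ∀ g : Γ, T'.toSubmodule ≤ T'.toSubmodule.comap (ρ g) := fun g x hx =>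
    T'.apply_mem_toSubmodule g hx
  have hirr : T'.toRepresentation.IsIrreducible := by
    rw [Representation.irreducible_iff_isSimpleModule_asModule]
    have := isSimpleModule_iff_isAtom.2 hT
    exact IsSimpleModule.congr (T'.toRepresentation.asModuleSubEquiv ρ T'.toSubmodule.subtype
      (fun _ _ => rfl) Subtype.val_injective T fun x => by
        rw [Submodule.range_subtype]; rfl)
  have hadd := cls_add T'.toRepresentation ρ (ρ.quotient T'.toSubmodule hT') T'.toSubmodule.subtype
    T'.toSubmodule.mkQ (fun _ _ => rfl) (fun _ _ => rfl) Subtype.val_injective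
    (LinearMap.exact_subtype_mkQ _) (Submodule.mkQ_surjective _)
  rw [hadd]
  refine add_mem (AddSubmonoid.subset_closure ⟨FDRep.of T'.toRepresentation, hirr, rfl⟩) ?_
  refine ih _ ?_ _ rfl
  rw [← h]
  have h2 := Submodule.finrank_quotient_add_finrank T'.toSubmodule
  have h3 : 0 < Module.finrank k T'.toSubmodule := by
    rw [Nat.pos_iff_ne_zero, ne_eq, Submodule.finrank_eq_zero]
    intro h0
    refine hT.1 (eq_bot_iff.2 fun x hx => ?_)
    have : x ∈ T'.toSubmodule := hx
    rw [h0] at this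
    exact this
  omega

section Mult
variable (S : FDRep k Γ)

lemma mult_nonneg (X : FDRep k Γ) : 0 ≤ mult S (of X) := by
  rw [mult_of]; positivity

lemma mult_nonneg_of_mem_effective {x : Groth k Γ} (hx : x ∈ effective k Γ) : 0 ≤ mult S x := by
  induction hx using AddSubmonoid.closure_induction with
  | mem x hx => obtain ⟨T, -, rfl⟩ := hx; exact mult_nonneg S T
  | zero => simp
  | add x y _ _ hx hy => rw [map_add]; positivity

lemma mult_self (hS : S.rep.IsIrreducible) : mult S (of S) = 1 := by
  have := (Representation.irreducible_iff_isSimpleModule_asModule _).1 hS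
  rw [mult_of, (JordanHolder.factorMultiplicity_of_isSimpleModule _ _).1 ⟨LinearEquiv.refl _ _⟩]
  rfl

lemma mult_irreducible (T : FDRep k Γ) (hT : T.rep.IsIrreducible) :
    (Nonempty (T.rep.asModule ≃ₗ[MonoidAlgebra k Γ] S.rep.asModule) ∧ mult S (of T) = 1) ∨
    (¬ Nonempty (T.rep.asModule ≃ₗ[MonoidAlgebra k Γ] S.rep.asModule) ∧ mult S (of T) = 0) := by
  have := (Representation.irreducible_iff_isSimpleModule_asModule _).1 hT
  rw [mult_of]
  by_cases h : Nonempty (T.rep.asModule ≃ₗ[MonoidAlgebra k Γ] S.rep.asModule)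
  · left
    rw [(JordanHolder.factorMultiplicity_of_isSimpleModule _ _).1 h]
    exact ⟨h, rfl⟩
  · right
    rw [(JordanHolder.factorMultiplicity_of_isSimpleModule _ _).2 h]
    exact ⟨h, rfl⟩

lemma of_eq_of_asModuleEquiv {T : FDRep k Γ}
    (f : T.rep.asModule ≃ₗ[MonoidAlgebra k Γ] S.rep.asModule) : of T = of S := by
  rw [of_eq_cls, of_eq_cls]
  refine cls_congr (f.restrictScalars k : T.rep.asModule ≃ₗ[k] S.rep.asModule) ?_
  intro a (x : T.rep.asModule)
  have := f.map_smul (MonoidAlgebra.single a 1) x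
  rw [Representation.single_smul, Representation.single_smul, one_smul, one_smul] at this
  exact this

/-- This stands in for the fact that the simple classes form a basis. The simple summands of `y` are
removed from `x` one at a time: as long as the multiplicity of `S` in `x` is positive, one of the
simple summands of `x` is isomorphic to `S`. -/
lemma exists_add_of_le {y : Groth k Γ} (hy : y ∈ effective k Γ) :
    ∀ x ∈ effective k Γ, (∀ S : FDRep k Γ, S.rep.IsIrreducible → mult S y ≤ mult S x) →
      ∃ z ∈ effective k Γ, x = y + z := by
  induction hy using AddSubmonoid.closure_induction with
  | zero => exact fun x hx _ => ⟨x, hx, by simp⟩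
  | add y₁ y₂ h₁ h₂ ih₁ ih₂ =>
    intro x hx h
    obtain ⟨z, hz, rfl⟩ := ih₁ x hx fun S hS => by
      have := h S hS
      have := mult_nonneg_of_mem_effective S h₂
      rw [map_add] at *
      omega
    obtain ⟨w, hw, rfl⟩ := ih₂ z hz fun S hS => by
      have := h S hS
      rw [map_add, map_add] at this
      omega
    exact ⟨w, hw, by abel⟩
  | mem y hy =>
    obtain ⟨S, hS, rfl⟩ := hy
    intro x hx h
    have h1 := h S hS
    rw [mult_self S hS] at h1
    clear h
    induction hx using AddSubmonoid.closure_induction with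
    | zero => simp at h1
    | mem x hx =>
      obtain ⟨T, hT, rfl⟩ := hx
      rcases mult_irreducible S T hT with ⟨⟨f⟩, -⟩ | ⟨-, h⟩
      · exact ⟨0, zero_mem _, by rw [of_eq_of_asModuleEquiv S f, add_zero]⟩
      · omega
    | add x₁ x₂ h₁ h₂ ih₁ ih₂ =>
      rw [map_add] at h1
      by_cases h : 1 ≤ mult S x₁
      · obtain ⟨z, hz, rfl⟩ := ih₁ h
        exact ⟨z + x₂, add_mem hz h₂, by abel⟩
      · obtain ⟨z, hz, rfl⟩ := ih₂ (by omega)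
        exact ⟨z + x₁, add_mem hz h₁, by abel⟩

lemma exists_of_mem_effective {x : Groth k Γ} (hx : x ∈ effective k Γ) :
    ∃ N : FDRep k Γ, x = of N := by
  induction hx using AddSubmonoid.closure_induction with
  | zero => exact ⟨FDRep.of (1 : Representation k Γ PUnit.{u+1}), (cls_of_subsingleton _).symm⟩
  | mem x hx => obtain ⟨T, -, rfl⟩ := hx; exact ⟨T, rfl⟩
  | add x y _ _ hx hy =>
    obtain ⟨X, rfl⟩ := hx
    obtain ⟨Y, rfl⟩ := hy
    refine ⟨FDRep.of (X.rep.prod Y.rep), ?_⟩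
    rw [of_eq_cls X, of_eq_cls Y]
    exact (cls_add X.rep (X.rep.prod Y.rep) Y.rep (LinearMap.inl k _ _) (LinearMap.snd k _ _)
      (fun _ _ => by simp [Representation.prod]) (fun _ _ => rfl) LinearMap.inl_injective
      Function.Exact.inl_snd LinearMap.snd_surjective).symm

lemma exists_eq_sub (x : Groth k Γ) : ∃ y ∈ effective k Γ, ∃ z ∈ effective k Γ, x = y - z := by
  obtain ⟨x, rfl⟩ := QuotientAddGroup.mk_surjective x
  induction x using FreeAbelianGroup.induction_on with
  | zero => exact ⟨0, zero_mem _, 0, zero_mem _, by rw [sub_zero]; rfl⟩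
  | of X => exact ⟨of X, of_eq_cls X ▸ cls_mem_effective _, 0, zero_mem _, by rw [sub_zero]; rfl⟩
  | neg X _ => exact ⟨0, zero_mem _, of X, of_eq_cls X ▸ cls_mem_effective _, by rw [zero_sub]; rfl⟩
  | add x y hx hy =>
    obtain ⟨a, ha, b, hb, h1⟩ := hx
    obtain ⟨c, hc, d, hd, h2⟩ := hy
    refine ⟨a + c, add_mem ha hc, b + d, add_mem hb hd, ?_⟩
    rw [add_sub_add_comm, ← h1, ← h2]
    rfl

lemma mem_effective_of_mult_nonneg {x : Groth k Γ}
    (h : ∀ S : FDRep k Γ, S.rep.IsIrreducible → 0 ≤ mult S x) : x ∈ effective k Γ := by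
  obtain ⟨y, hy, z, hz, rfl⟩ := exists_eq_sub x
  obtain ⟨w, hw, rfl⟩ := exists_add_of_le hz y hy fun S hS => by
    have := h S hS
    rw [map_sub] at this
    omega
  simpa using hw

/-- Such an element is a sum of classes of simple modules, and a summand `[S]` would contribute `1`
to the multiplicity of `S`, with nothing to cancel it. -/
lemma eq_zero_of_mult_eq_zero {x : Groth k Γ}
    (h : ∀ S : FDRep k Γ, S.rep.IsIrreducible → mult S x = 0) : x = 0 := by
  have hx := mem_effective_of_mult_nonneg fun S hS => (h S hS).ge
  obtain ⟨z, hz, h0⟩ := exists_add_of_le hx 0 (zero_mem _) fun S hS => by simp [h S hS]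
  induction hx using AddSubmonoid.closure_induction generalizing z with
  | zero => rfl
  | mem x hx =>
    obtain ⟨S, hS, rfl⟩ := hx
    have := h S hS
    rw [mult_self S hS] at this
    omega
  | add x y hx hy hx' hy' =>
    have h' (S : FDRep k Γ) (hS : S.rep.IsIrreducible) : mult S x = 0 ∧ mult S y = 0 := by
      have := h S hS
      have := mult_nonneg_of_mem_effective S hx
      have := mult_nonneg_of_mem_effective S hy
      rw [map_add] at *
      omega
    rw [hx' (fun S hS => (h' S hS).1) (y + z) (add_mem hy hz) (by rw [h0]; abel),
      hy' (fun S hS => (h' S hS).2) (x + z) (add_mem hx hz) (by rw [h0]; abel), add_zero]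

end Mult

/-- For every simple module `S` there is an idempotent `e` of the group algebra such that the
multiplicity of `S` in `X` is proportional to `dim e X`. -/
lemma exists_idemDim_eq_mult [Finite Γ] (S : FDRep k Γ) (hS : S.rep.IsIrreducible) :
    ∃ (e : MonoidAlgebra k Γ) (he : IsIdempotentElem e) (c : ℕ), 0 < c ∧
      ∀ x : Groth k Γ, idemDim he x = c * mult S x := by
  have : IsArtinianRing (MonoidAlgebra k Γ) := isArtinian_of_tower k inferInstance
  have := (Representation.irreducible_iff_isSimpleModule_asModule _).1 hS
  obtain ⟨e, he, ⟨s, hs⟩, hT⟩ :=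
    exists_isIdempotentElem_of_isSimpleModule (A := MonoidAlgebra k Γ) S.rep.asModule
  -- The factor is `c = dim e S`, which is positive because `e` does not kill `S`.
  refine ⟨e, he, idemRank e S.rep, ?_, fun x => ?_⟩
  · rw [idemRank, Module.finrank_pos_iff_exists_ne_zero]
    exact ⟨⟨_, s, rfl⟩, fun h => hs (congrArg Subtype.val h)⟩
  -- Both sides are additive, so only simple `T` matter: either `T ≅ S`, or `e T = 0` and the
  -- multiplicity is zero.
  have key {x} (hx : x ∈ effective k Γ) : idemDim he x = idemRank e S.rep * mult S x := by
    induction hx using AddSubmonoid.closure_induction with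
    | zero => simp
    | add x y _ _ hx hy => rw [map_add, map_add, hx, hy, mul_add]
    | mem x hx =>
      obtain ⟨T, hTi, rfl⟩ := hx
      have := (Representation.irreducible_iff_isSimpleModule_asModule _).1 hTi
      rcases mult_irreducible S T hTi with ⟨⟨f⟩, h⟩ | ⟨hn, h⟩
      · rw [h, of_eq_of_asModuleEquiv S f, idemDim_of, mul_one]
      · rw [h, mul_zero, idemDim_of, idemRank, Nat.cast_eq_zero]
        have : LinearMap.range (T.rep.asAlgebraHom e) = ⊥ := by
          rw [LinearMap.range_eq_bot]
          ext t
          by_contra h0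
          exact hn ((hT T.rep.asModule t h0).map LinearEquiv.symm)
        rw [this, finrank_bot]
  obtain ⟨y, hy, z, hz, rfl⟩ := exists_eq_sub x
  rw [map_sub, map_sub, key hy, key hz, mul_sub]

/-- The idempotent attached to a simple `S` turns the hypothesis into an inequality between
multiplicities of `S`, and these decide membership in the cone. Through this criterion the
inequalities of classes become dimension counts. -/
lemma le_of_idemDim_le [Finite Γ] {x y : Groth k Γ}
    (h : ∀ (e : MonoidAlgebra k Γ) (he : IsIdempotentElem e), idemDim he x ≤ idemDim he y) :
    x ≤ y := by
  refine exists_of_mem_effective (mem_effective_of_mult_nonneg fun S hS => ?_)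
  obtain ⟨e, he, c, hc, hec⟩ := exists_idemDim_eq_mult S hS
  have h1 := h e he
  rw [hec, hec] at h1
  rw [map_sub, sub_nonneg]
  exact le_of_mul_le_mul_left h1 (by exact_mod_cast hc)

lemma eq_of_idemDim_eq [Finite Γ] {x y : Groth k Γ}
    (h : ∀ (e : MonoidAlgebra k Γ) (he : IsIdempotentElem e), idemDim he x = idemDim he y) :
    x = y := by
  refine sub_eq_zero.1 (eq_zero_of_mult_eq_zero fun S hS => ?_)
  obtain ⟨e, he, c, hc, hec⟩ := exists_idemDim_eq_mult S hS
  have h1 := h e he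
  rw [hec, hec] at h1
  rw [map_sub, sub_eq_zero]
  exact mul_left_cancel₀ (by exact_mod_cast hc.ne') h1

end Groth

/-! ### Graded modules, with explicit projections -/

/-- A grading of the `k`-module `N` by the submodules `𝒩 j`, given by the projections. -/
structure Grading {k N : Type*} [CommRing k] [AddCommMonoid N] [Module k N]
    (𝒩 : ℕ → Submodule k N) where
  /-- The projection to the component of degree `j`. -/
  proj : ℕ → N →ₗ[k] N
  proj_mem : ∀ j x, proj j x ∈ 𝒩 j
  proj_same : ∀ {j x}, x ∈ 𝒩 j → proj j x = x
  proj_ne : ∀ {i j x}, x ∈ 𝒩 i → i ≠ j → proj j x = 0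
  iSup_eq : ⨆ j, 𝒩 j = ⊤

/-- The sum is direct: `π a` is the identity on `X a` and kills the other summands. -/
lemma Submodule.finrank_biSup_of_proj {k N ι : Type*} [Field k] [AddCommGroup N] [Module k N]
    (X : ι → Submodule k N) [∀ i, Module.Finite k (X i)] (π : ι → N →ₗ[k] N)
    (h1 : ∀ {i x}, x ∈ X i → π i x = x) (h2 : ∀ {i j x}, x ∈ X i → i ≠ j → π j x = 0)
    (s : Finset ι) :
    Module.finrank k (⨆ i ∈ s, X i : Submodule k N) = ∑ i ∈ s, Module.finrank k (X i) := by
  classical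
  induction s using Finset.induction_on with
  | empty =>
    have : (⨆ i ∈ (∅ : Finset ι), X i) = ⊥ := by simp
    rw [this, finrank_bot, Finset.sum_empty]
  | insert a s ha ih =>
    rw [Finset.sum_insert ha, Finset.iSup_insert, ← ih]
    have : Module.Finite k (⨆ i ∈ s, X i : Submodule k N) := by
      rw [iSup_subtype']
      exact Submodule.finite_iSup _
    have h := Submodule.finrank_sup_add_finrank_inf_eq (X a) (⨆ i ∈ s, X i)
    have h0 : X a ⊓ (⨆ i ∈ s, X i) = ⊥ := by
      rw [eq_bot_iff]
      rintro x ⟨hx, hx'⟩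
      have : (⨆ i ∈ s, X i) ≤ LinearMap.ker (π a) :=
        iSup₂_le fun i hi y hy => h2 hy (fun h => ha (h ▸ hi))
      have := this hx'
      rw [LinearMap.mem_ker, h1 hx] at this
      exact this
    rw [h0, finrank_bot, add_zero] at h
    exact h

namespace Grading
variable {k N N' : Type*} [CommRing k] [AddCommMonoid N] [Module k N]
  {𝒩 : ℕ → Submodule k N} (g : Grading 𝒩)

include g in
lemma induction {p : N → Prop} (hom : ∀ j, ∀ x ∈ 𝒩 j, p x) (add : ∀ x y, p x → p y → p (x + y))
    (x : N) : p x :=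
  Submodule.iSup_induction 𝒩 (motive := p) (g.iSup_eq ▸ Submodule.mem_top) hom (hom 0 0 (zero_mem _)) add

end Grading

namespace Grading
variable {k N N' : Type*} [CommRing k] [AddCommGroup N] [Module k N] [AddCommGroup N'] [Module k N']
  {𝒩 : ℕ → Submodule k N} {𝒩' : ℕ → Submodule k N'} (g : Grading 𝒩) (g' : Grading 𝒩')

lemma exists_sum_proj (x : N) : ∃ n, (∀ j, n ≤ j → g.proj j x = 0) ∧
    ∑ j ∈ Finset.range n, g.proj j x = x := by
  -- Requiring the identity for all large `m` makes it stable under sums, by taking the larger of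
  -- two bounds.
  have key : ∃ n, ∀ m, n ≤ m → g.proj m x = 0 ∧ ∑ j ∈ Finset.range m, g.proj j x = x := by
    induction x using Grading.induction g with
    | hom j x hx =>
      refine ⟨j + 1, fun m hm => ⟨g.proj_ne hx (by omega), ?_⟩⟩
      rw [Finset.sum_eq_single_of_mem j (Finset.mem_range.2 (by omega)) fun i _ hi =>
        g.proj_ne hx hi.symm, g.proj_same hx]
    | add x y hx hy =>
      obtain ⟨n, hn⟩ := hx
      obtain ⟨m, hm⟩ := hy
      refine ⟨max n m, fun l hl => ?_⟩
      have h1 := hn l (le_trans (le_max_left _ _) hl)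
      have h2 := hm l (le_trans (le_max_right _ _) hl)
      simp only [map_add, Finset.sum_add_distrib, h1, h2, add_zero, true_and]
  obtain ⟨n, hn⟩ := key
  exact ⟨n, fun j hj => (hn j hj).1, (hn n le_rfl).2⟩

lemma ext {x y : N} (h : ∀ j, g.proj j x = g.proj j y) : x = y := by
  obtain ⟨n, -, hn⟩ := g.exists_sum_proj (x - y)
  rw [← sub_eq_zero, ← hn]
  exact Finset.sum_eq_zero fun j _ => by rw [map_sub, h, sub_self]

lemma map_proj (f : N →ₗ[k] N') (d : ℕ) (hf : ∀ j, ∀ x ∈ 𝒩 j, f x ∈ 𝒩' (j + d)) (j : ℕ) (x : N) :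
    f (g.proj j x) = g'.proj (j + d) (f x) := by
  induction x using Grading.induction g with
  | hom i x hx =>
    by_cases h : i = j
    · subst h
      rw [g.proj_same hx, g'.proj_same (hf _ _ hx)]
    · rw [g.proj_ne hx h, map_zero, g'.proj_ne (hf _ _ hx) (by omega)]
  | add x y hx hy => simp only [map_add, hx, hy]

include g in
lemma proj_map_of_lt (f : N →ₗ[k] N') (d : ℕ) (hf : ∀ j, ∀ x ∈ 𝒩 j, f x ∈ 𝒩' (j + d)) {j : ℕ}
    (hj : j < d) (x : N) : g'.proj j (f x) = 0 := by
  induction x using Grading.induction g with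
  | hom i x hx => rw [g'.proj_ne (hf _ _ hx) (by omega)]
  | add x y hx hy => simp only [map_add, hx, hy, add_zero]

/-- The grading induced on a homogeneous submodule. -/
noncomputable def comap (f : N' →ₗ[k] N) (hf : Function.Injective f)
    (h : ∀ j x, g.proj j (f x) ∈ LinearMap.range f) : Grading (fun j => (𝒩 j).comap f) where
  proj j := (LinearEquiv.ofInjective f hf).symm.toLinearMap ∘ₗ
    (g.proj j ∘ₗ f).codRestrict (LinearMap.range f) (h j)
  proj_mem j x := by
    rw [Submodule.mem_comap, LinearMap.comp_apply, LinearEquiv.coe_coe,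
      LinearEquiv.ofInjective_symm_apply]
    exact g.proj_mem j _
  proj_same {j x} hx := by
    apply hf
    rw [LinearMap.comp_apply, LinearEquiv.coe_coe, LinearEquiv.ofInjective_symm_apply]
    exact g.proj_same hx
  proj_ne {i j x} hx hij := by
    apply hf
    rw [LinearMap.comp_apply, LinearEquiv.coe_coe, LinearEquiv.ofInjective_symm_apply, map_zero]
    exact g.proj_ne hx hij
  iSup_eq := by
    rw [eq_top_iff]
    rintro x -
    have hp (j : ℕ) : ∃ y, f y = g.proj j (f x) := h j x
    choose y hy using hp
    obtain ⟨n, -, hn⟩ := g.exists_sum_proj (f x)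
    have : x = ∑ j ∈ Finset.range n, y j := hf (by simp [hy, hn])
    rw [this]
    refine Submodule.sum_mem _ fun j _ => Submodule.mem_iSup_of_mem j ?_
    rw [Submodule.mem_comap, hy]
    exact g.proj_mem j _

@[simp]
lemma comap_proj (f : N' →ₗ[k] N) (hf : Function.Injective f)
    (h : ∀ j x, g.proj j (f x) ∈ LinearMap.range f) (j : ℕ) (x : N') :
    f ((g.comap f hf h).proj j x) = g.proj j (f x) := by
  simp only [comap]
  rw [LinearMap.comp_apply, LinearEquiv.coe_coe, LinearEquiv.ofInjective_symm_apply]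
  rfl

/-- The grading induced on a quotient by a homogeneous submodule. -/
noncomputable def map (f : N →ₗ[k] N') (hf : Function.Surjective f)
    (h : ∀ j x, f x = 0 → f (g.proj j x) = 0) : Grading (fun j => (𝒩 j).map f) :=
  have hp (j : ℕ) (x : N) : ((LinearMap.ker f).liftQ (f ∘ₗ g.proj j) (h j) ∘ₗ
      (f.quotKerEquivOfSurjective hf).symm.toLinearMap) (f x) = f (g.proj j x) := by
    rw [LinearMap.comp_apply, LinearEquiv.coe_coe, LinearMap.quotKerEquivOfSurjective_symm_apply]
    rfl
  { proj := fun j => (LinearMap.ker f).liftQ (f ∘ₗ g.proj j) (h j) ∘ₗ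
      (f.quotKerEquivOfSurjective hf).symm.toLinearMap
    proj_mem := fun j x => by
      obtain ⟨x, rfl⟩ := hf x
      rw [hp]
      exact ⟨_, g.proj_mem j x, rfl⟩
    proj_same := by
      rintro j _ ⟨x, hx, rfl⟩
      rw [hp, g.proj_same hx]
    proj_ne := by
      rintro i j _ ⟨x, hx, rfl⟩ hij
      rw [hp, g.proj_ne hx hij, map_zero]
    iSup_eq := by
      rw [← Submodule.map_iSup, g.iSup_eq, Submodule.map_top, LinearMap.range_eq_top.2 hf] }

end Grading

namespace Grading
variable {k N N' : Type*} [CommRing k] [AddCommMonoid N] [Module k N] [AddCommMonoid N'] [Module k N']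
  {𝒩 : ℕ → Submodule k N} {𝒩' : ℕ → Submodule k N'} (g : Grading 𝒩) (g' : Grading 𝒩')

/-- The grading of a tensor product of graded modules. -/
noncomputable def tensor : Grading (fun j => ⨆ p : {p : ℕ × ℕ // p.1 + p.2 = j},
    Submodule.map₂ (TensorProduct.mk k N N') (𝒩 p.1.1) (𝒩' p.1.2)) where
  proj j := ∑ p ∈ Finset.HasAntidiagonal.antidiagonal j, TensorProduct.map (g.proj p.1) (g'.proj p.2)
  proj_mem j x := by
    rw [LinearMap.sum_apply]
    refine Submodule.sum_mem _ fun p hp => ?_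
    refine Submodule.mem_iSup_of_mem ⟨p, Finset.HasAntidiagonal.mem_antidiagonal.1 hp⟩ ?_
    induction x using TensorProduct.induction_on with
    | zero => rw [map_zero]; exact zero_mem _
    | add x y hx hy => rw [map_add]; exact add_mem hx hy
    | tmul x y =>
      exact Submodule.apply_mem_map₂ (TensorProduct.mk k N N') (g.proj_mem _ _) (g'.proj_mem _ _)
  proj_same {j x} hx := by
    suffices h : (⨆ p : {p : ℕ × ℕ // p.1 + p.2 = j},
        Submodule.map₂ (TensorProduct.mk k N N') (𝒩 p.1.1) (𝒩' p.1.2)) ≤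
        LinearMap.eqLocus (∑ p ∈ Finset.HasAntidiagonal.antidiagonal j,
          TensorProduct.map (g.proj p.1) (g'.proj p.2)) LinearMap.id from h hx
    refine iSup_le fun p => Submodule.map₂_le.2 fun y hy z hz => ?_
    rw [LinearMap.mem_eqLocus, LinearMap.sum_apply, Finset.sum_eq_single_of_mem p.1
      (Finset.HasAntidiagonal.mem_antidiagonal.2 p.2)]
    · simp [g.proj_same hy, g'.proj_same hz]
    · rintro q hq hqp
      have : p.1.1 ≠ q.1 := by
        rintro h
        have := Finset.HasAntidiagonal.mem_antidiagonal.1 hq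
        have := p.2
        exact hqp (Prod.ext h.symm (by omega))
      simp [g.proj_ne hy this]
  proj_ne {i j x} hx hij := by
    suffices h : (⨆ p : {p : ℕ × ℕ // p.1 + p.2 = i},
        Submodule.map₂ (TensorProduct.mk k N N') (𝒩 p.1.1) (𝒩' p.1.2)) ≤
        LinearMap.ker (∑ p ∈ Finset.HasAntidiagonal.antidiagonal j,
          TensorProduct.map (g.proj p.1) (g'.proj p.2)) from h hx
    refine iSup_le fun p => Submodule.map₂_le.2 fun y hy z hz => ?_
    rw [LinearMap.mem_ker, LinearMap.sum_apply]
    refine Finset.sum_eq_zero fun q hq => ?_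
    have h1 := Finset.HasAntidiagonal.mem_antidiagonal.1 hq
    have h2 := p.2
    by_cases h : p.1.1 = q.1
    · have : p.1.2 ≠ q.2 := by omega
      simp [g'.proj_ne hz this]
    · simp [g.proj_ne hy h]
  iSup_eq := by
    rw [eq_top_iff, ← TensorProduct.span_tmul_eq_top, Submodule.span_le]
    rintro _ ⟨x, y, rfl⟩
    induction x using Grading.induction g with
    | add x x' hx hx' => rw [TensorProduct.add_tmul]; exact add_mem hx hx'
    | hom i x hx =>
      induction y using Grading.induction g' with
      | add y y' hy hy' => rw [TensorProduct.tmul_add]; exact add_mem hy hy'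
      | hom j y hy =>
        exact Submodule.mem_iSup_of_mem (i + j) (Submodule.mem_iSup_of_mem ⟨(i, j), rfl⟩
          (Submodule.apply_mem_map₂ (TensorProduct.mk k N N') hx hy))

end Grading

namespace Grading
variable {k N N' : Type*} [Field k] [AddCommGroup N] [Module k N] [AddCommGroup N'] [Module k N']
  {𝒩 : ℕ → Submodule k N} {𝒩' : ℕ → Submodule k N'} (g : Grading 𝒩) (g' : Grading 𝒩')

include g in
lemma finite_ne_bot [Module.Finite k N] : {j | 𝒩 j ≠ ⊥}.Finite := by
  obtain ⟨s, hs⟩ := (Module.Finite.fg_top : (⊤ : Submodule k N).FG)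
  have h (x : N) : ∃ n, ∀ j, n ≤ j → g.proj j x = 0 :=
    (g.exists_sum_proj x).imp fun n hn => hn.1
  choose n hn using h
  refine (Set.finite_lt_nat (s.sup n)).subset fun j hj => ?_
  by_contra hlt
  refine hj (eq_bot_iff.2 fun x hx => ?_)
  have : (⊤ : Submodule k N) ≤ LinearMap.ker (g.proj j) := by
    rw [← hs, Submodule.span_le]
    exact fun y hy => hn y j ((Finset.le_sup hy).trans (not_lt.1 hlt))
  rw [Submodule.mem_bot, ← g.proj_same hx]
  exact this trivial

include g in
lemma finsum_finrank [Module.Finite k N] : ∑ᶠ j, Module.finrank k (𝒩 j) = Module.finrank k N := by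
  have hf := g.finite_ne_bot
  rw [finsum_eq_sum_of_support_subset (s := hf.toFinset)]
  · rw [← Submodule.finrank_biSup_of_proj 𝒩 g.proj g.proj_same g.proj_ne]
    have : (⨆ j ∈ hf.toFinset, 𝒩 j) = ⊤ := by
      rw [eq_top_iff, ← g.iSup_eq]
      refine iSup_le fun j => ?_
      by_cases h : 𝒩 j = ⊥
      · rw [h]; exact bot_le
      · exact le_iSup₂_of_le j (by simpa using h) le_rfl
    rw [this, finrank_top]
  · intro j hj
    simp only [Set.Finite.coe_toFinset, Set.mem_ofPred_eq]
    rintro h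
    exact hj (by simp [h])

include g g' in
-- Over a field the products of components embed in the tensor product by flatness, and the tensor
-- products of the projections show that their sum is direct.
lemma finrank_tensor [∀ j, Module.Finite k (𝒩 j)] [∀ j, Module.Finite k (𝒩' j)] (j : ℕ) :
    Module.finrank k (⨆ p : {p : ℕ × ℕ // p.1 + p.2 = j},
      Submodule.map₂ (TensorProduct.mk k N N') (𝒩 p.1.1) (𝒩' p.1.2) : Submodule k (N ⊗[k] N')) =
      ∑ p ∈ Finset.HasAntidiagonal.antidiagonal j, Module.finrank k (𝒩 p.1) * Module.finrank k (𝒩' p.2) := by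
  have e : (⨆ p : {p : ℕ × ℕ // p.1 + p.2 = j},
      Submodule.map₂ (TensorProduct.mk k N N') (𝒩 p.1.1) (𝒩' p.1.2)) =
      ⨆ p ∈ Finset.HasAntidiagonal.antidiagonal j, Submodule.map₂ (TensorProduct.mk k N N') (𝒩 p.1) (𝒩' p.2) := by
    rw [iSup_subtype]
    simp only [Finset.HasAntidiagonal.mem_antidiagonal]
  have hinj (p : ℕ × ℕ) : Function.Injective (TensorProduct.mapIncl (𝒩 p.1) (𝒩' p.2)) :=
    TensorProduct.map_injective_of_flat_flat' _ _ Subtype.val_injective Subtype.val_injective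
  have : ∀ p : ℕ × ℕ, Module.Finite k
      (Submodule.map₂ (TensorProduct.mk k N N') (𝒩 p.1) (𝒩' p.2)) := fun p => by
    rw [← TensorProduct.range_mapIncl]; infer_instance
  rw [e, Submodule.finrank_biSup_of_proj _ (fun p => TensorProduct.map (g.proj p.1) (g'.proj p.2))]
  · refine Finset.sum_congr rfl fun p _ => ?_
    rw [← TensorProduct.range_mapIncl, LinearMap.finrank_range_of_inj (hinj p),
      Module.finrank_tensorProduct]
  · intro p x hx
    have h : Submodule.map₂ (TensorProduct.mk k N N') (𝒩 p.1) (𝒩' p.2) ≤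
        LinearMap.eqLocus (TensorProduct.map (g.proj p.1) (g'.proj p.2)) LinearMap.id :=
      Submodule.map₂_le.2 fun y hy z hz => by simp [g.proj_same hy, g'.proj_same hz]
    exact h hx
  · intro p q x hx hpq
    have h : Submodule.map₂ (TensorProduct.mk k N N') (𝒩 p.1) (𝒩' p.2) ≤
        LinearMap.ker (TensorProduct.map (g.proj q.1) (g'.proj q.2)) :=
      Submodule.map₂_le.2 fun y hy z hz => by
        by_cases h : p.1 = q.1
        · have : p.2 ≠ q.2 := fun h' => hpq (Prod.ext h h')
          simp [g'.proj_ne hz this]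
        · simp [g.proj_ne hy h]
    exact h hx

lemma finite_tensor [∀ j, Module.Finite k (𝒩 j)] [∀ j, Module.Finite k (𝒩' j)] (j : ℕ) :
    Module.Finite k (⨆ p : {p : ℕ × ℕ // p.1 + p.2 = j},
      Submodule.map₂ (TensorProduct.mk k N N') (𝒩 p.1.1) (𝒩' p.1.2) : Submodule k (N ⊗[k] N')) := by
  have : Finite {p : ℕ × ℕ // p.1 + p.2 = j} :=
    Finite.of_injective (β := Finset.HasAntidiagonal.antidiagonal j) (fun p => ⟨p.1, Finset.HasAntidiagonal.mem_antidiagonal.2 p.2⟩)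
      fun p q h => Subtype.ext (congrArg (fun x => x.1) h)
  have : ∀ p : ℕ × ℕ, Module.Finite k
      (Submodule.map₂ (TensorProduct.mk k N N') (𝒩 p.1) (𝒩' p.2)) := fun p => by
    rw [← TensorProduct.range_mapIncl]; infer_instance
  exact Submodule.finite_iSup _

end Grading

/-! ### Functoriality and internal grading of the bar complex -/

namespace BarComplex

section Functoriality
variable {k : Type u} [CommRing k] {R : Type u} [CommRing R] [Algebra k R] (I : Ideal R)
  {L M N : Type u} [AddCommGroup L] [Module k L] [AddCommGroup M] [Module k M]
  [AddCommGroup N] [Module k N]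

/-- The map of bar complexes induced by a map of modules. -/
noncomputable def objMap (f : M →ₗ[k] N) : ∀ n, obj k I M n →ₗ[k] obj k I N n
  | 0 => f
  | n + 1 => LinearMap.rTensor I (objMap f n)

lemma objMap_cons (f : M →ₗ[k] N) (n : ℕ) (x : obj k I M n) (r : I) :
    objMap I f (n + 1) (cons k I M n x r) = cons k I N n (objMap I f n x) r := rfl

lemma objMap_comp (g : M →ₗ[k] N) (f : L →ₗ[k] M) (n : ℕ) (x : obj k I L n) :
    objMap I (g ∘ₗ f) n x = objMap I g n (objMap I f n x) := by
  induction n with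
  | zero => rfl
  | succ n ih =>
    suffices h : objMap I (g ∘ₗ f) (n + 1) = objMap I g (n + 1) ∘ₗ objMap I f (n + 1) from
      LinearMap.congr_fun h x
    refine ext_cons k I L fun y r => ?_
    rw [LinearMap.comp_apply, objMap_cons, objMap_cons, objMap_cons, ih]

lemma objMap_id (n : ℕ) (x : obj k I M n) : objMap I LinearMap.id n x = x := by
  induction n with
  | zero => rfl
  | succ n ih =>
    suffices h : objMap I LinearMap.id (n + 1) = LinearMap.id from LinearMap.congr_fun h x
    refine ext_cons k I M fun y r => ?_
    rw [objMap_cons, ih]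
    rfl

lemma objMap_surjective {f : M →ₗ[k] N} (hf : Function.Surjective f) (n : ℕ) :
    Function.Surjective (objMap I f n) := by
  induction n with
  | zero => exact hf
  | succ n ih => exact LinearMap.rTensor_surjective I ih

lemma objMap_exact {f : L →ₗ[k] M} {g : M →ₗ[k] N} (hg : Function.Surjective g)
    (h : Function.Exact f g) (n : ℕ) : Function.Exact (objMap I f n) (objMap I g n) := by
  induction n with
  | zero => exact h
  | succ n ih => exact rTensor_exact I ih (objMap_surjective I hg n)

variable [Module R M] [IsScalarTower k R M] [Module R N] [IsScalarTower k R N]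
  [Module R L] [IsScalarTower k R L]

lemma act_objMap (f : M →ₗ[R] N) (n : ℕ) (x : obj k I M (n + 1)) :
    act k I N n (objMap I (f.restrictScalars k) (n + 1) x) =
      objMap I (f.restrictScalars k) n (act k I M n x) := by
  suffices h : act k I N n ∘ₗ objMap I (f.restrictScalars k) (n + 1) =
      objMap I (f.restrictScalars k) n ∘ₗ act k I M n from LinearMap.congr_fun h x
  refine ext_cons k I M fun y r => ?_
  cases n with
  | zero => exact (f.map_smul (r : R) (show M from y)).symm
  | succ n =>
    suffices h : act k I N (n + 1) ∘ₗ objMap I (f.restrictScalars k) (n + 2) ∘ₗ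
        (cons k I M (n + 1)).flip r =
        objMap I (f.restrictScalars k) (n + 1) ∘ₗ act k I M (n + 1) ∘ₗ
        (cons k I M (n + 1)).flip r from LinearMap.congr_fun h y
    exact ext_cons k I M fun z s => rfl

lemma d_objMap (f : M →ₗ[R] N) (n : ℕ) (x : obj k I M (n + 1)) :
    d k I N n (objMap I (f.restrictScalars k) (n + 1) x) =
      objMap I (f.restrictScalars k) n (d k I M n x) := by
  induction n with
  | zero => exact act_objMap I f 0 x
  | succ n ih =>
    suffices h : d k I N (n + 1) ∘ₗ objMap I (f.restrictScalars k) (n + 2) =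
        objMap I (f.restrictScalars k) (n + 1) ∘ₗ d k I M (n + 1) from LinearMap.congr_fun h x
    refine ext_cons k I M fun y r => ?_
    rw [LinearMap.comp_apply, LinearMap.comp_apply, objMap_cons, d_succ_cons, d_succ_cons,
      ← objMap_cons, act_objMap, ih, map_add, map_smul, objMap_cons]

lemma objMap_mem_cycles (f : M →ₗ[R] N) (n : ℕ) {x : obj k I M n} (hx : x ∈ cycles k I M n) :
    objMap I (f.restrictScalars k) n x ∈ cycles k I N n := by
  cases n with
  | zero => trivial
  | succ n =>
    have hx' : d k I M n x = 0 := hx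
    change d k I N n _ = 0
    rw [d_objMap, hx', map_zero]

lemma objMap_mem_boundaries (f : M →ₗ[R] N) (n : ℕ) {x : obj k I M n}
    (hx : x ∈ boundaries k I M n) :
    objMap I (f.restrictScalars k) n x ∈ boundaries k I N n := by
  obtain ⟨y, rfl⟩ := hx
  exact ⟨_, d_objMap I f n y⟩

/-- The map on `Tor` induced by a map of modules. -/
noncomputable def torMap (f : M →ₗ[R] N) (n : ℕ) : Tor k I M n →ₗ[k] Tor k I N n :=
  Submodule.mapQ _ _ ((objMap I (f.restrictScalars k) n).restrict
    fun _ hx => objMap_mem_cycles I f n hx) fun _ hx => objMap_mem_boundaries I f n hx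

lemma torMap_mk (f : M →ₗ[R] N) (n : ℕ) (x : cycles k I M n) :
    torMap I f n (Submodule.Quotient.mk x) = Submodule.Quotient.mk
      ⟨objMap I (f.restrictScalars k) n x, objMap_mem_cycles I f n x.2⟩ := rfl

lemma torMap_comp (g : M →ₗ[R] N) (f : L →ₗ[R] M) (n : ℕ) (x : Tor k I L n) :
    torMap I (g ∘ₗ f) n x = torMap I g n (torMap I f n x) := by
  obtain ⟨x, rfl⟩ := Submodule.Quotient.mk_surjective _ x
  rw [torMap_mk, torMap_mk, torMap_mk]
  congr 1
  exact Subtype.ext (objMap_comp I (g.restrictScalars k) (f.restrictScalars k) n x)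

lemma torMap_id (n : ℕ) (x : Tor k I M n) : torMap I LinearMap.id n x = x := by
  obtain ⟨x, rfl⟩ := Submodule.Quotient.mk_surjective _ x
  rw [torMap_mk]
  congr 1
  exact Subtype.ext (objMap_id I n x.1)

/-- The isomorphism on `Tor` induced by an isomorphism of modules. -/
noncomputable def torEquiv (f : M ≃ₗ[R] N) (n : ℕ) : Tor k I M n ≃ₗ[k] Tor k I N n :=
  LinearEquiv.ofLinearMap (torMap I f.toLinearMap n) (torMap I f.symm.toLinearMap n)
    (LinearMap.ext fun x => by
      rw [LinearMap.comp_apply, ← torMap_comp, LinearEquiv.comp_symm, torMap_id]; rfl)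
    (LinearMap.ext fun x => by
      rw [LinearMap.comp_apply, ← torMap_comp, LinearEquiv.symm_comp, torMap_id]; rfl)

variable (k M) in
/-- `Tor₀` is the quotient by `I`: the map from `M`. -/
noncomputable def toTorZero : M →ₗ[k] Tor k I M 0 :=
  Submodule.mkQ _ ∘ₗ (Submodule.topEquiv (R := k) (M := M)).symm.toLinearMap

lemma toTorZero_surjective : Function.Surjective (toTorZero k I M) :=
  (Submodule.mkQ_surjective _).comp (LinearEquiv.surjective _)

lemma toTorZero_eq_zero_iff (x : M) : toTorZero k I M x = 0 ↔ x ∈ I • (⊤ : Submodule R M) := by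
  have h : toTorZero k I M x = 0 ↔ x ∈ LinearMap.range (act k I M 0) := by
    change Submodule.Quotient.mk _ = _ ↔ _
    rw [Submodule.Quotient.mk_eq_zero]
    rfl
  rw [h]
  constructor
  · rintro ⟨y, rfl⟩
    suffices h : (act k I M 0) y ∈ (I • (⊤ : Submodule R M)).restrictScalars k from h
    have hle : (⊤ : Submodule k (M ⊗[k] I)) ≤
        ((I • (⊤ : Submodule R M)).restrictScalars k).comap (act k I M 0) := by
      rw [← TensorProduct.map₂_mk_top_top_eq_top]
      refine Submodule.map₂_le.2 fun m _ r _ => ?_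
      exact Submodule.smul_mem_smul r.2 trivial
    exact hle trivial
  · intro hx
    refine Submodule.smul_induction_on (M := M) (p := fun x => x ∈ LinearMap.range (act k I M 0)) hx
      (fun r hr m _ => ⟨cons k I M 0 m ⟨r, hr⟩, rfl⟩) fun x y hx hy => ?_
    exact Submodule.add_mem (LinearMap.range (act k I M 0)) hx hy

end Functoriality

section Grading
variable {k : Type u} [CommRing k] {R : Type u} [CommRing R] [Algebra k R] {I : Ideal R}

/-- A grading of the `k`-algebra `R` with `R₀ = k` and with irrelevant ideal `I`. -/
structure ConnectedGrading (I : Ideal R) (𝒜 : ℕ → Submodule k R) extends Grading 𝒜 where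
  one_mem : 1 ∈ 𝒜 0
  mul_mem : ∀ {i j a b}, a ∈ 𝒜 i → b ∈ 𝒜 j → a * b ∈ 𝒜 (i + j)
  exists_algebraMap : ∀ r ∈ 𝒜 0, ∃ c, algebraMap k R c = r
  mem_ideal : ∀ r, r ∈ I ↔ proj 0 r = 0

/-- Multiplication is compatible with the gradings of `R` and of the `R`-module `N`. -/
def IsGradedSMul (𝒜 : ℕ → Submodule k R) {N : Type*} [AddCommGroup N] [Module k N] [Module R N]
    (𝒩 : ℕ → Submodule k N) : Prop :=
  ∀ {i j : ℕ} {a : R} {x : N}, a ∈ 𝒜 i → x ∈ 𝒩 j → a • x ∈ 𝒩 (j + i)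

variable {𝒜 : ℕ → Submodule k R} (hR : ConnectedGrading I 𝒜)
  {N : Type u} [AddCommGroup N] [Module k N] {𝒩 : ℕ → Submodule k N} (g : Grading 𝒩)

/-- The grading of the irrelevant ideal. -/
noncomputable def ConnectedGrading.ideal :
    Grading (fun j => (𝒜 j).comap (I.subtype.restrictScalars k)) :=
  hR.toGrading.comap _ Subtype.val_injective fun j x => by
    refine ⟨⟨hR.proj j x, ?_⟩, rfl⟩
    rw [hR.mem_ideal]
    by_cases h : j = 0
    · subst h
      rw [(hR.mem_ideal _).1 x.2, map_zero]
    · exact hR.proj_ne (hR.proj_mem j _) h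

include hR in
lemma ConnectedGrading.ideal_zero : (𝒜 0).comap (I.subtype.restrictScalars k) = ⊥ := by
  rw [eq_bot_iff]
  intro x hx
  have h1 : hR.proj 0 (x : R) = x := hR.proj_same hx
  rw [(hR.mem_ideal _).1 x.2] at h1
  exact Subtype.ext h1.symm

/-- The grading of `obj n ⊗ I` induced by a grading of `obj n`. -/
noncomputable def objTensorGrading (n : ℕ) (h : Grading (degree I 𝒜 𝒩 n)) :=
  Grading.tensor h hR.ideal

/-- The grading of the bar complex. -/
noncomputable def objGrading : ∀ n, Grading (degree I 𝒜 𝒩 n)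
  | 0 => g
  | n + 1 => objTensorGrading hR n (objGrading n)

include hR in
-- Each factor `I` has degree at least `1`. This is why only finitely many `Tor_n` contribute in a
-- given internal degree.
lemma degree_eq_bot {n j : ℕ} (h : j < n) : degree I 𝒜 𝒩 n j = ⊥ := by
  induction n generalizing j with
  | zero => omega
  | succ n ih =>
    rw [eq_bot_iff]
    refine iSup_le fun p => Submodule.map₂_le.2 fun x hx r hr => ?_
    have hp := p.2
    by_cases h0 : p.1.2 = 0
    · rw [h0, hR.ideal_zero] at hr
      rw [(Submodule.mem_bot k).1 hr, map_zero]
      exact zero_mem _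
    · rw [ih (by omega)] at hx
      rw [(Submodule.mem_bot k).1 hx, map_zero]
      exact zero_mem _

variable [Module R N] [IsScalarTower k R N]

include hR in
lemma act_mem_degree (hs : IsGradedSMul 𝒜 𝒩) (n j : ℕ) :
    degree I 𝒜 𝒩 (n + 1) j ≤ (degree I 𝒜 𝒩 n j).comap (act k I N n) := by
  cases n with
  | zero =>
    refine iSup_le fun p => Submodule.map₂_le.2 fun x hx r hr => ?_
    have := hs (a := (r : R)) hr (show (show N from x) ∈ 𝒩 p.1.1 from hx)
    rw [p.2] at this
    exact this
  | succ n =>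
    refine iSup_le fun p => Submodule.map₂_le.2 fun x hx r hr => ?_
    suffices h : degree I 𝒜 𝒩 (n + 1) p.1.1 ≤
        (degree I 𝒜 𝒩 (n + 1) j).comap (act k I N (n + 1) ∘ₗ (cons k I N (n + 1)).flip r) from h hx
    refine iSup_le fun q => Submodule.map₂_le.2 fun y hy s hs' => ?_
    rw [Submodule.mem_comap, LinearMap.comp_apply, LinearMap.flip_apply, act_succ_cons]
    have h1 := p.2
    have h2 := q.2
    exact Submodule.mem_iSup_of_mem ⟨(q.1.1, q.1.2 + p.1.2), by simp only; omega⟩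
      (Submodule.apply_mem_map₂ (cons k I N n) hy (hR.mul_mem hs' hr))

include hR in
lemma d_mem_degree (hs : IsGradedSMul 𝒜 𝒩) (n j : ℕ) :
    degree I 𝒜 𝒩 (n + 1) j ≤ (degree I 𝒜 𝒩 n j).comap (d k I N n) := by
  induction n generalizing j with
  | zero => exact act_mem_degree hR hs 0 j
  | succ n ih =>
    refine iSup_le fun p => Submodule.map₂_le.2 fun x hx r hr => ?_
    change d k I N (n + 1) (cons k I N (n + 1) x r) ∈ degree I 𝒜 𝒩 (n + 1) j
    rw [d_succ_cons]
    refine add_mem ?_ (Submodule.smul_mem _ _ ?_)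
    · exact Submodule.mem_iSup_of_mem p (Submodule.apply_mem_map₂ (cons k I N n) (ih _ hx) hr)
    · exact act_mem_degree hR hs (n + 1) j (Submodule.mem_iSup_of_mem p
        (Submodule.apply_mem_map₂ (cons k I N (n + 1)) hx hr))

lemma d_proj (hs : IsGradedSMul 𝒜 𝒩) (n j : ℕ) (x : obj k I N (n + 1)) :
    d k I N n ((objGrading hR g (n + 1)).proj j x) = (objGrading hR g n).proj j (d k I N n x) :=
  (objGrading hR g (n + 1)).map_proj (objGrading hR g n) (d k I N n) 0
    (fun j _ hx => d_mem_degree hR hs n j hx) j x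

lemma proj_mem_cycles (hs : IsGradedSMul 𝒜 𝒩) (n j : ℕ) {x : obj k I N n}
    (hx : x ∈ cycles k I N n) : (objGrading hR g n).proj j x ∈ cycles k I N n := by
  cases n with
  | zero => trivial
  | succ n =>
    have hx' : d k I N n x = 0 := hx
    change d k I N n _ = 0
    rw [d_proj hR g hs, hx', map_zero]

/-- The grading of the cycles of the bar complex. -/
noncomputable def cyclesGrading (hs : IsGradedSMul 𝒜 𝒩) (n : ℕ) :
    Grading (fun j => (degree I 𝒜 𝒩 n j).submoduleOf (cycles k I N n)) :=
  (objGrading hR g n).comap (cycles k I N n).subtype Subtype.val_injective fun j x =>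
    ⟨⟨_, proj_mem_cycles hR g hs n j x.2⟩, rfl⟩

/-- The grading of `Tor`. -/
noncomputable def torGrading (hs : IsGradedSMul 𝒜 𝒩) (n : ℕ) : Grading (torDegree I 𝒜 𝒩 n) :=
  (cyclesGrading hR g hs n).map _ (Submodule.mkQ_surjective _) fun j x hx => by
    rw [Submodule.mkQ_apply, Submodule.Quotient.mk_eq_zero] at hx ⊢
    obtain ⟨y, hy⟩ := hx
    -- The differential commutes with the projections, so the components of a boundary are
    -- boundaries.
    refine ⟨(objGrading hR g (n + 1)).proj j y, ?_⟩
    rw [d_proj hR g hs, hy]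
    exact (Grading.comap_proj (objGrading hR g n) (cycles k I N n).subtype Subtype.val_injective
      (fun j x => ⟨⟨_, proj_mem_cycles hR g hs n j x.2⟩, rfl⟩) j x).symm

include hR in
lemma torDegree_eq_bot {n j : ℕ} (h : j < n) : torDegree I 𝒜 𝒩 n j = ⊥ := by
  rw [eq_bot_iff]
  rintro _ ⟨x, hx, rfl⟩
  have hx' : (x : obj k I N n) ∈ degree I 𝒜 𝒩 n j := hx
  rw [degree_eq_bot hR h, Submodule.mem_bot] at hx'
  rw [Subtype.ext (a1 := x) (a2 := 0) hx', map_zero]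
  exact zero_mem _

end Grading

end BarComplex

/-! ### Hilbert series and the Euler characteristic of the bar complex -/

/-- The Hilbert series of a graded module. -/
noncomputable def hilbertSeries {k N : Type*} [Field k] [AddCommGroup N] [Module k N]
    (𝒩 : ℕ → Submodule k N) : PowerSeries ℤ :=
  PowerSeries.mk fun j => (Module.finrank k (𝒩 j) : ℤ)

@[simp]
lemma coeff_hilbertSeries {k N : Type*} [Field k] [AddCommGroup N] [Module k N]
    (𝒩 : ℕ → Submodule k N) (j : ℕ) :
    PowerSeries.coeff j (hilbertSeries 𝒩) = Module.finrank k (𝒩 j) :=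
  PowerSeries.coeff_mk _ _

namespace BarComplex

section Euler
variable {k : Type u} [Field k] {R : Type u} [CommRing R] [Algebra k R] {I : Ideal R}
  {𝒜 : ℕ → Submodule k R} (hR : ConnectedGrading I 𝒜) [∀ j, Module.Finite k (𝒜 j)]
  {N : Type u} [AddCommGroup N] [Module k N] {𝒩 : ℕ → Submodule k N} (g : Grading 𝒩)
  [∀ j, Module.Finite k (𝒩 j)]

instance finite_ideal_degree (j : ℕ) :
    Module.Finite k ((𝒜 j).comap (I.subtype.restrictScalars k) : Submodule k I) :=
  Module.Finite.of_injective
    ((I.subtype.restrictScalars k).restrict (q := 𝒜 j) fun _ h => h)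
    fun _ _ h => Subtype.ext (Subtype.ext (congrArg (fun x : 𝒜 j => (x : R)) h))

omit [∀ j, Module.Finite k (𝒩 j)] in
include hR g in
lemma finrank_degree_succ (n j : ℕ) (h : ∀ j, Module.Finite k (degree I 𝒜 𝒩 n j)) :
    Module.finrank k (degree I 𝒜 𝒩 (n + 1) j) = ∑ p ∈ Finset.HasAntidiagonal.antidiagonal j,
      Module.finrank k (degree I 𝒜 𝒩 n p.1) *
        Module.finrank k ((𝒜 p.2).comap (I.subtype.restrictScalars k) : Submodule k I) := by
  have := Grading.finrank_tensor (objGrading hR g n) hR.ideal j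
  exact this

lemma finite_degree (n j : ℕ) : Module.Finite k (degree I 𝒜 𝒩 n j) := by
  induction n generalizing j with
  | zero => exact inferInstanceAs (Module.Finite k (𝒩 j))
  | succ n ih =>
    have := Grading.finite_tensor (𝒩 := degree I 𝒜 𝒩 n)
      (𝒩' := fun j => (𝒜 j).comap (I.subtype.restrictScalars k)) j
    exact this

omit [∀ j, Module.Finite k (𝒜 j)] in
include hR in
-- The ideal differs from `R` only in degree `0`, where `R` is the line `k` and the ideal is zero.
lemma finrank_ideal_degree [Nontrivial R] (j : ℕ) :
    (Module.finrank k ((𝒜 j).comap (I.subtype.restrictScalars k) : Submodule k I) : ℤ) =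
      PowerSeries.coeff j (hilbertSeries 𝒜 - 1) := by
  rw [map_sub, PowerSeries.coeff_one, coeff_hilbertSeries]
  by_cases h : j = 0
  · subst h
    rw [hR.ideal_zero, finrank_bot, if_pos rfl]
    have : Module.finrank k (𝒜 0) = 1 := by
      refine finrank_eq_one (⟨1, hR.one_mem⟩ : 𝒜 0) (fun h => one_ne_zero (congrArg Subtype.val h))
        fun r => ?_
      obtain ⟨c, hc⟩ := hR.exists_algebraMap r r.2
      exact ⟨c, Subtype.ext (by rw [← hc, Algebra.algebraMap_eq_smul_one]; rfl)⟩
    rw [this]; rfl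
  · rw [if_neg h, sub_zero, Nat.cast_inj]
    refine LinearEquiv.finrank_eq (LinearEquiv.ofBijective
      ((I.subtype.restrictScalars k).restrict (q := 𝒜 j) fun _ h => h) ⟨?_, fun x => ?_⟩)
    · exact fun _ _ h => Subtype.ext (Subtype.ext (congrArg (fun x : 𝒜 j => (x : R)) h))
    · exact ⟨⟨⟨x, (hR.mem_ideal _).2 (hR.proj_ne x.2 h)⟩, x.2⟩, rfl⟩

include hR g in
lemma hilbertSeries_degree [Nontrivial R] (n : ℕ) :
    hilbertSeries (degree I 𝒜 𝒩 n) = hilbertSeries 𝒩 * (hilbertSeries 𝒜 - 1) ^ n := by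
  induction n with
  | zero => rw [pow_zero, mul_one]; rfl
  | succ n ih =>
    rw [pow_succ, ← mul_assoc, ← ih]
    ext j
    rw [PowerSeries.coeff_mul, coeff_hilbertSeries,
      finrank_degree_succ hR g n j (finite_degree n), Nat.cast_sum]
    refine Finset.sum_congr rfl fun p _ => ?_
    rw [Nat.cast_mul, finrank_ideal_degree hR, coeff_hilbertSeries]

variable [Module R N] [IsScalarTower k R N]

omit [∀ j, Module.Finite k (𝒜 j)] [∀ j, Module.Finite k (𝒩 j)] in
include hR g in
lemma map_d_degree (hs : IsGradedSMul 𝒜 𝒩) (n j : ℕ) :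
    (degree I 𝒜 𝒩 (n + 1) j).map (d k I N n) = boundaries k I N n ⊓ degree I 𝒜 𝒩 n j := by
  ext x
  constructor
  · rintro ⟨y, hy, rfl⟩
    exact ⟨⟨y, rfl⟩, d_mem_degree hR hs n j hy⟩
  · rintro ⟨⟨y, rfl⟩, hx⟩
    refine ⟨(objGrading hR g (n + 1)).proj j y, Grading.proj_mem _ _ _, ?_⟩
    rw [d_proj hR g hs, Grading.proj_same _ hx]

omit [∀ j, Module.Finite k (𝒜 j)] [∀ j, Module.Finite k (𝒩 j)] in
-- Rank-nullity for the projection from the homogeneous cycles of degree `j` to `Tor`.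
lemma finrank_torDegree_add (n j : ℕ) [Module.Finite k (degree I 𝒜 𝒩 n j)] :
    Module.finrank k (torDegree I 𝒜 𝒩 n j) +
      Module.finrank k (boundaries k I N n ⊓ degree I 𝒜 𝒩 n j : Submodule k _) =
      Module.finrank k (cycles k I N n ⊓ degree I 𝒜 𝒩 n j : Submodule k _) := by
  let D := degree I 𝒜 𝒩 n j
  let Z := cycles k I N n
  let B := boundaries k I N n
  have e1 : (D.submoduleOf Z).map Z.subtype = Z ⊓ D := by
    rw [Submodule.submoduleOf, Submodule.map_comap_subtype]
  have hfin : Module.Finite k (Z ⊓ D : Submodule k _) :=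
    Submodule.finiteDimensional_of_le (inf_le_right : Z ⊓ D ≤ D)
  let e := Submodule.equivMapOfInjective Z.subtype Subtype.val_injective (D.submoduleOf Z)
  have : Module.Finite k (D.submoduleOf Z) := by
    rw [← e1] at hfin
    exact Module.Finite.equiv e.symm
  have h1 := LinearMap.finrank_range_add_finrank_ker
    ((B.submoduleOf Z).mkQ.domRestrict (D.submoduleOf Z))
  have h2 := e.finrank_eq
  rw [e1] at h2
  rw [← h2, ← h1, LinearMap.range_domRestrict]
  congr 1
  let ι := Z.subtype ∘ₗ (D.submoduleOf Z).subtype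
  have hι : Function.Injective ι := Subtype.val_injective.comp Subtype.val_injective
  have hker : B ⊓ D = (LinearMap.ker ((B.submoduleOf Z).mkQ.domRestrict (D.submoduleOf Z))).map ι := by
    ext x
    constructor
    · rintro ⟨hB, hD⟩
      exact ⟨⟨⟨x, boundaries_le_cycles k I N n hB⟩, hD⟩,
        (Submodule.Quotient.mk_eq_zero (B.submoduleOf Z)).2 hB, rfl⟩
    · rintro ⟨y, hy, rfl⟩
      exact ⟨(Submodule.Quotient.mk_eq_zero (B.submoduleOf Z)).1 hy, y.2⟩
  rw [(Submodule.equivMapOfInjective ι hι _).finrank_eq, ← hker]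

include hR g in
lemma finrank_degree_succ_eq (hs : IsGradedSMul 𝒜 𝒩) (n j : ℕ) :
    Module.finrank k (degree I 𝒜 𝒩 (n + 1) j) =
      Module.finrank k (boundaries k I N n ⊓ degree I 𝒜 𝒩 n j : Submodule k _) +
      Module.finrank k (cycles k I N (n + 1) ⊓ degree I 𝒜 𝒩 (n + 1) j : Submodule k _) := by
  let D := degree I 𝒜 𝒩 (n + 1) j
  have : Module.Finite k D := finite_degree (n + 1) j
  have h1 := LinearMap.finrank_range_add_finrank_ker ((d k I N n).domRestrict D)
  rw [LinearMap.range_domRestrict, map_d_degree hR g hs] at h1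
  have hker : (LinearMap.ker ((d k I N n).domRestrict D)).map D.subtype =
      cycles k I N (n + 1) ⊓ D := by
    ext x
    constructor
    · rintro ⟨y, hy, rfl⟩
      exact ⟨hy, y.2⟩
    · rintro ⟨hZ, hD⟩
      exact ⟨⟨x, hD⟩, hZ, rfl⟩
  rw [← h1, (Submodule.equivMapOfInjective D.subtype Subtype.val_injective _).finrank_eq, hker]

include hR g in
-- The Euler characteristic of a truncated complex: the ranks of the differentials cancel, except
-- that of the differential into the last term, which is the correction.
lemma sum_finrank_torDegree (hs : IsGradedSMul 𝒜 𝒩) (n j : ℕ) :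
    ∑ i ∈ Finset.range (n + 1), (-1 : ℤ) ^ i * Module.finrank k (torDegree I 𝒜 𝒩 i j) =
      ∑ i ∈ Finset.range (n + 1), (-1 : ℤ) ^ i * Module.finrank k (degree I 𝒜 𝒩 i j) -
      (-1) ^ n * Module.finrank k (boundaries k I N n ⊓ degree I 𝒜 𝒩 n j : Submodule k _) := by
  have := finite_degree (I := I) (𝒜 := 𝒜) (𝒩 := 𝒩)
  induction n with
  | zero =>
    have h := finrank_torDegree_add (I := I) (𝒜 := 𝒜) (𝒩 := 𝒩) 0 j
    have h0 : (cycles k I N 0 ⊓ degree I 𝒜 𝒩 0 j : Submodule k _) = degree I 𝒜 𝒩 0 j :=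
      top_inf_eq _
    rw [h0] at h
    simp only [zero_add, Finset.sum_range_one, pow_zero, one_mul]
    rw [← h]
    push_cast
    ring
  | succ n ih =>
    rw [Finset.sum_range_succ, ih, Finset.sum_range_succ _ (n + 1),
      finrank_degree_succ_eq hR g hs n j, ← finrank_torDegree_add]
    push_cast
    ring

include hR g in
/-- The Euler characteristic of `Tor` in a fixed internal degree. -/
lemma hilbertSeries_tor_mul [Nontrivial R] (hs : IsGradedSMul 𝒜 𝒩) :
    (PowerSeries.mk fun j => ∑ᶠ i, (-1 : ℤ) ^ i * Module.finrank k (torDegree I 𝒜 𝒩 i j)) *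
      hilbertSeries 𝒜 = hilbertSeries 𝒩 := by
  -- The partial sums of the geometric series for `H_N / H_R = H_N / (1 + (H_R - 1))`, where `H`
  -- denotes Hilbert series; `H_N (H_R - 1)^i` is the series of the `i`-th term of the bar complex.
  let T (m : ℕ) : PowerSeries ℤ :=
    ∑ i ∈ Finset.range (m + 1), (-1) ^ i * (hilbertSeries 𝒩 * (hilbertSeries 𝒜 - 1) ^ i)
  have hcoe (m j : ℕ) : PowerSeries.coeff j (T m) =
      ∑ i ∈ Finset.range (m + 1), (-1 : ℤ) ^ i * Module.finrank k (degree I 𝒜 𝒩 i j) := by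
    simp only [T, ← hilbertSeries_degree hR g, map_sum]
    refine Finset.sum_congr rfl fun i _ => ?_
    have : ((-1) ^ i : PowerSeries ℤ) = PowerSeries.C ((-1) ^ i) := by simp
    rw [this, PowerSeries.coeff_C_mul, coeff_hilbertSeries]
  -- Summing up to `m + 1 > j` makes the correction by boundaries vanish; the chains of index `m +
  -- 1` are zero in degree `j` as well.
  have hT (m j : ℕ) (h : j ≤ m) : ∑ᶠ i, (-1 : ℤ) ^ i * Module.finrank k (torDegree I 𝒜 𝒩 i j) =
      PowerSeries.coeff j (T m) := by
    rw [finsum_eq_sum_of_support_subset (s := Finset.range (m + 2)), sum_finrank_torDegree hR g hs,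
      hcoe, degree_eq_bot hR (show j < m + 1 by omega), inf_bot_eq, finrank_bot,
      Finset.sum_range_succ, degree_eq_bot hR (show j < m + 1 by omega), finrank_bot]
    · simp
    · intro i hi
      by_contra hlt
      have : j < i := by simp at hlt; omega
      refine hi ?_
      simp only
      rw [torDegree_eq_bot hR this, finrank_bot, Nat.cast_zero, mul_zero]
  have hmul (m : ℕ) : T m * hilbertSeries 𝒜 =
      hilbertSeries 𝒩 - (-1) ^ (m + 1) * hilbertSeries (degree I 𝒜 𝒩 (m + 1)) := by
    rw [hilbertSeries_degree hR g]
    induction m with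
    | zero => simp only [T, zero_add, Finset.sum_range_one]; ring
    | succ m ih =>
      have : T (m + 1) = T m + (-1) ^ (m + 1) * (hilbertSeries 𝒩 * (hilbertSeries 𝒜 - 1) ^ (m + 1)) :=
        Finset.sum_range_succ _ _
      rw [this, add_mul, ih]
      ring
  ext j
  -- The remainder of the geometric series is the Hilbert series of the term of index `j + 1`, which
  -- starts in degree `j + 1`.
  have h1 : PowerSeries.coeff j (T j * hilbertSeries 𝒜) = PowerSeries.coeff j (hilbertSeries 𝒩) := by
    rw [hmul, map_sub, sub_eq_self]
    have : ((-1) ^ (j + 1) : PowerSeries ℤ) = PowerSeries.C ((-1) ^ (j + 1)) := by simp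
    rw [this, PowerSeries.coeff_C_mul, coeff_hilbertSeries,
      degree_eq_bot hR (Nat.lt_succ_self j), finrank_bot, Nat.cast_zero, mul_zero]
  rw [← h1, PowerSeries.coeff_mul, PowerSeries.coeff_mul]
  refine Finset.sum_congr rfl fun p hp => ?_
  have := Finset.HasAntidiagonal.mem_antidiagonal.1 hp
  rw [PowerSeries.coeff_mk, hT j p.1 (by omega)]

end Euler
end BarComplex

/-! ### Free modules: shifted gradings, and the contraction of the bar complex -/

namespace Grading
variable {k N : Type*} [CommRing k] [AddCommGroup N] [Module k N] {𝒩 : ℕ → Submodule k N}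

/-- The grading of `N` with all degrees raised by `a`. -/
noncomputable def shift (g : Grading 𝒩) (a : ℕ) :
    Grading (fun j => if a ≤ j then 𝒩 (j - a) else ⊥) where
  proj j := if a ≤ j then g.proj (j - a) else 0
  proj_mem j x := by
    by_cases h : a ≤ j
    · simpa only [if_pos h] using g.proj_mem _ _
    · simp [if_neg h]
  proj_same {j x} hx := by
    by_cases h : a ≤ j
    · simp only [if_pos h] at hx ⊢
      exact g.proj_same hx
    · simp only [if_neg h, Submodule.mem_bot] at hx ⊢
      simp [hx]
  proj_ne {i j x} hx hij := by
    by_cases h : a ≤ j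
    · simp only [if_pos h]
      by_cases h' : a ≤ i
      · simp only [if_pos h'] at hx
        exact g.proj_ne hx (by omega)
      · simp only [if_neg h', Submodule.mem_bot] at hx
        simp [hx]
    · simp [if_neg h]
  iSup_eq := by
    rw [eq_top_iff, ← g.iSup_eq]
    refine iSup_le fun j => le_iSup_of_le (j + a) ?_
    simp

/-- The grading of a finite product of graded modules. -/
noncomputable def pi {ι : Type*} [Finite ι] {M : ι → Type*} [∀ i, AddCommGroup (M i)]
    [∀ i, Module k (M i)] {ℳ : ∀ i, ℕ → Submodule k (M i)} (g : ∀ i, Grading (ℳ i)) :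
    Grading (fun j => Submodule.pi Set.univ fun i => ℳ i j) where
  proj j := LinearMap.pi fun i => (g i).proj j ∘ₗ LinearMap.proj i
  proj_mem j x i _ := (g i).proj_mem j _
  proj_same hx := funext fun i => (g i).proj_same (hx i trivial)
  proj_ne hx hij := funext fun i => (g i).proj_ne (hx i trivial) hij
  iSup_eq := by
    classical
    have := Fintype.ofFinite ι
    rw [eq_top_iff]
    rintro x -
    rw [← Finset.univ_sum_single x]
    refine Submodule.sum_mem _ fun i _ => ?_
    generalize x i = y
    induction y using Grading.induction (g i) with
    | add y z hy hz => rw [Pi.single_add]; exact add_mem hy hz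
    | hom j y hy =>
      refine Submodule.mem_iSup_of_mem j fun i' _ => ?_
      by_cases h : i' = i
      · subst h; simpa using hy
      · simp [Pi.single_eq_of_ne h]

end Grading

/-- Two surjections with the same kernel have isomorphic targets. -/
noncomputable def LinearEquiv.ofKerEq {R M N P : Type*} [Ring R] [AddCommGroup M] [Module R M]
    [AddCommGroup N] [Module R N] [AddCommGroup P] [Module R P] (f : M →ₗ[R] N) (g : M →ₗ[R] P)
    (hf : Function.Surjective f) (hg : Function.Surjective g)
    (h : LinearMap.ker f = LinearMap.ker g) : N ≃ₗ[R] P :=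
  (f.quotKerEquivOfSurjective hf).symm ≪≫ₗ Submodule.quotEquivOfEq _ _ h ≪≫ₗ
    g.quotKerEquivOfSurjective hg

lemma LinearEquiv.ofKerEq_apply {R M N P : Type*} [Ring R] [AddCommGroup M] [Module R M]
    [AddCommGroup N] [Module R N] [AddCommGroup P] [Module R P] (f : M →ₗ[R] N) (g : M →ₗ[R] P)
    (hf : Function.Surjective f) (hg : Function.Surjective g)
    (h : LinearMap.ker f = LinearMap.ker g) (x : M) :
    LinearEquiv.ofKerEq f g hf hg h (f x) = g x := by
  simp [LinearEquiv.ofKerEq, LinearMap.quotKerEquivOfSurjective_symm_apply]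

namespace BarComplex

section Contraction
variable {k : Type u} [CommRing k] {R : Type u} [CommRing R] [Algebra k R] (I : Ideal R)
  {F : Type u} [AddCommGroup F] [Module k F] [Module R F] [IsScalarTower k R F]

/-- The contraction of the bar complex induced by a map `F → F ⊗ I`. -/
noncomputable def contraction (h : F →ₗ[k] obj k I F 1) : ∀ n, obj k I F n →ₗ[k] obj k I F (n + 1)
  | 0 => h
  | n + 1 => consMap k I F (contraction h n)

omit [Module R F] [IsScalarTower k R F] in
lemma contraction_cons (h : F →ₗ[k] obj k I F 1) (n : ℕ) (x : obj k I F n) (r : I) :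
    contraction I h (n + 1) (cons k I F n x r) = cons k I F (n + 1) (contraction I h n x) r := rfl

/-- The contraction changes only the leftmost factor, whereas `act` multiplies the two rightmost
ones. -/
lemma contraction_act (h : F →ₗ[k] obj k I F 1) (n : ℕ) (x : obj k I F (n + 1)) (r : I) :
    contraction I h (n + 1) (act k I F (n + 1) (cons k I F (n + 1) x r)) =
      act k I F (n + 2) (cons k I F (n + 2) (contraction I h (n + 1) x) r) := by
  suffices H : contraction I h (n + 1) ∘ₗ act k I F (n + 1) ∘ₗ (cons k I F (n + 1)).flip r =
      act k I F (n + 2) ∘ₗ (cons k I F (n + 2)).flip r ∘ₗ contraction I h (n + 1) from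
    LinearMap.congr_fun H x
  refine ext_cons k I F fun y t => ?_
  simp only [LinearMap.comp_apply, LinearMap.flip_apply, act_succ_cons, contraction_cons]

/-- The homotopy identity spreads from `F ⊗ I` to all degrees: the terms `act` in the two summands
are exchanged by the contraction and carry opposite signs, so they cancel, and the remaining terms
are the previous case tensored with `I`. -/
lemma d_contraction_add (h : F →ₗ[k] obj k I F 1)
    (h0 : ∀ (x : F) (r : I), d k I F 1 (cons k I F 1 (h x) r) + h ((r : R) • x) = cons k I F 0 x r)
    (n : ℕ) (x : obj k I F (n + 1)) :
    d k I F (n + 1) (contraction I h (n + 1) x) + contraction I h n (d k I F n x) = x := by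
  induction n with
  | zero =>
    suffices H : d k I F 1 ∘ₗ contraction I h 1 + contraction I h 0 ∘ₗ d k I F 0 = LinearMap.id from
      LinearMap.congr_fun H x
    exact ext_cons k I F fun y r => h0 y r
  | succ n ih =>
    suffices H : d k I F (n + 2) ∘ₗ contraction I h (n + 2) +
        contraction I h (n + 1) ∘ₗ d k I F (n + 1) = LinearMap.id from LinearMap.congr_fun H x
    refine ext_cons k I F fun y r => ?_
    rw [LinearMap.add_apply, LinearMap.comp_apply, LinearMap.comp_apply, contraction_cons,
      d_succ_cons, d_succ_cons, map_add, map_smul, contraction_cons, contraction_act,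
      LinearMap.id_apply]
    conv_rhs => rw [← ih y, map_add, LinearMap.add_apply]
    rw [pow_succ _ (n + 1), mul_neg_one, neg_smul]
    abel

variable {I} {𝒜 : ℕ → Submodule k R} (hR : ConnectedGrading I 𝒜)

/-- The projection of `R = k ⊕ I` to `I`. -/
noncomputable def ConnectedGrading.idealPart : R →ₗ[k] I :=
  (LinearMap.id - hR.proj 0).codRestrict (I.restrictScalars k) fun r => by
    rw [Submodule.restrictScalars_mem, hR.mem_ideal, LinearMap.sub_apply, LinearMap.id_apply,
      map_sub, hR.proj_same (hR.proj_mem 0 r), sub_self]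

lemma ConnectedGrading.coe_idealPart (r : R) : (hR.idealPart r : R) = r - hR.proj 0 r := rfl

/-- The map `F → F ⊗ I` for a free module `F` with finite basis. -/
noncomputable def freeContraction (c : ℕ) : (Fin c → R) →ₗ[k] obj k I (Fin c → R) 1 :=
  ∑ i, cons k I (Fin c → R) 0 (Pi.single i 1 : Fin c → R) ∘ₗ hR.idealPart ∘ₗ LinearMap.proj i

lemma freeContraction_apply (c : ℕ) (x : Fin c → R) : freeContraction hR c x =
    ∑ i, cons k I (Fin c → R) 0 (Pi.single i 1 : Fin c → R) (hR.idealPart (x i)) := by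
  rw [freeContraction, LinearMap.sum_apply]
  rfl

/-- The contraction is `x ↦ ∑ eᵢ ⊗ xᵢ⁺`, where `xᵢ = xᵢ⁺ + aᵢ` with `xᵢ⁺ ∈ I` and `aᵢ ∈ k`. The
scalars `aᵢ` can be moved across the tensor sign, and the terms `eᵢ ⊗ xᵢ⁺ r` cancel. -/
lemma freeContraction_spec (c : ℕ) (x : Fin c → R) (r : I) :
    d k I (Fin c → R) 1 (cons k I (Fin c → R) 1 (freeContraction hR c x) r) +
      freeContraction hR c ((r : R) • x) = cons k I (Fin c → R) 0 x r := by
  let φ : (Fin c → R) →ₗ[k] I →ₗ[k] obj k I (Fin c → R) 1 := cons k I (Fin c → R) 0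
  have hD (f : Fin c → R) (s r : I) : d k I (Fin c → R) 1 (cons k I (Fin c → R) 1 (φ f s) r) =
      φ ((s : R) • f) r - φ f ((s : R) • r) := by
    have h1 : d k I (Fin c → R) 1 (cons k I (Fin c → R) 1 (φ f s) r) = φ ((s : R) • f) r +
        (-1 : k) ^ 1 • act k I (Fin c → R) 1 (cons k I (Fin c → R) 1 (φ f s) r) :=
      d_succ_cons k I (Fin c → R) 0 (φ f s) r
    have h2 : act k I (Fin c → R) 1 (cons k I (Fin c → R) 1 (φ f s) r) = φ f ((s : R) • r) :=
      act_succ_cons k I (Fin c → R) 0 f s r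
    rw [h1, h2, pow_one, neg_smul, one_smul, ← sub_eq_add_neg]
  have hx : x = ∑ i, x i • (Pi.single i 1 : Fin c → R) := by
    rw [← Finset.univ_sum_single x]
    refine Finset.sum_congr rfl fun i _ => ?_
    rw [Finset.univ_sum_single, ← Pi.single_smul, smul_eq_mul, mul_one]
  have e (s : R) (f : Fin c → R) : φ (s • f) r =
      φ ((hR.idealPart s : R) • f) r - φ f ((hR.idealPart s : R) • r) +
      φ f (hR.idealPart ((r : R) * s)) := by
    obtain ⟨a, ha⟩ := hR.exists_algebraMap _ (hR.proj_mem 0 s)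
    have h1 : s = hR.idealPart s + algebraMap k R a := by rw [hR.coe_idealPart, ha]; ring
    have h2 : hR.idealPart ((r : R) * s) = (hR.idealPart s : R) • r + a • r := by
      apply Subtype.ext
      rw [hR.coe_idealPart, (hR.mem_ideal _).1 (I.mul_mem_right _ r.2), sub_zero]
      nth_rewrite 1 [h1]
      simp [Algebra.smul_def]
      ring
    have h3 : s • f = (hR.idealPart s : R) • f + a • f := by
      nth_rewrite 1 [h1]
      rw [add_smul, algebraMap_smul]
    rw [h2, h3, map_add, LinearMap.add_apply, LinearMap.map_smul φ, LinearMap.smul_apply,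
      map_add (φ f), LinearMap.map_smul (φ f)]
    abel
  have h6 : φ x r = ∑ i, φ (x i • (Pi.single i 1 : Fin c → R)) r := by
    nth_rewrite 1 [hx]
    rw [map_sum, LinearMap.sum_apply]
  change _ = φ x r
  rw [h6, freeContraction_apply, freeContraction_apply, map_sum, LinearMap.sum_apply, map_sum,
    ← Finset.sum_add_distrib]
  refine Finset.sum_congr rfl fun i _ => ?_
  rw [e]
  exact congrArg (· + _) (hD _ _ _)

include hR in
-- By the homotopy identity a cycle is the boundary of its contraction; hence higher `Tor` of a free
-- module vanishes.
lemma tor_free_le (c n : ℕ) : cycles k I (Fin c → R) (n + 1) ≤ boundaries k I (Fin c → R) (n + 1) := by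
  intro x hx
  have hx' : d k I (Fin c → R) n x = 0 := hx
  have := d_contraction_add I (freeContraction hR c) (freeContraction_spec hR c) n x
  rw [hx', map_zero, add_zero] at this
  exact ⟨_, this⟩

end Contraction
end BarComplex

/-! ### Dimension shifting, graded Nakayama and minimal covers -/

namespace BarComplex

section Shift
variable {k : Type u} [Field k] {R : Type u} [CommRing R] [Algebra k R] (I : Ideal R)
  {L F N : Type u} [AddCommGroup L] [Module k L] [Module R L] [IsScalarTower k R L]
  [AddCommGroup F] [Module k F] [Module R F] [IsScalarTower k R F]
  [AddCommGroup N] [Module k N] [Module R N] [IsScalarTower k R N]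

omit [Module R L] [IsScalarTower k R L] [Module R F] [IsScalarTower k R F] in
lemma objMap_injective {f : L →ₗ[k] F} (hf : Function.Injective f) (n : ℕ) :
    Function.Injective (objMap I f n) := by
  induction n with
  | zero => exact hf
  | succ n ih => exact Module.Flat.rTensor_preserves_injective_linearMap _ ih

/-- Dimension shifting in a short exact sequence whose middle term has no homology. -/
lemma nonempty_tor_succ_equiv {ι : L →ₗ[R] F} {f : F →ₗ[R] N} (hι : Function.Injective ι)
    (hf : Function.Surjective f) (h : Function.Exact ι f) (n : ℕ)
    (hF : cycles k I F (n + 1) ≤ boundaries k I F (n + 1))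
    (hL : ∀ y ∈ cycles k I L n, objMap I (ι.restrictScalars k) n y ∈ boundaries k I F n) :
    Nonempty (Tor k I N (n + 1) ≃ₗ[k] Tor k I L n) := by
  have hinj := objMap_injective I (f := ι.restrictScalars k) hι
  have hsurj := objMap_surjective I (f := f.restrictScalars k) hf
  have hex := objMap_exact I (f := ι.restrictScalars k) (g := f.restrictScalars k) hf h
  -- The connecting homomorphism as a correspondence: pairs `(x, y)` of chains with `d x = ι y`.
  -- Sending such a pair to the class of `f x` and to the class of `y` gives two surjections with
  -- the same kernel.
  let C : Submodule k (obj k I F (n + 1) × obj k I L n) :=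
    LinearMap.eqLocus (d k I F n ∘ₗ LinearMap.fst k _ _)
      (objMap I (ι.restrictScalars k) n ∘ₗ LinearMap.snd k _ _)
  have hC (z : C) : d k I F n z.1.1 = objMap I (ι.restrictScalars k) n z.1.2 := z.2
  have hex0 (n : ℕ) (y : obj k I L n) :
      objMap I (f.restrictScalars k) n (objMap I (ι.restrictScalars k) n y) = 0 :=
    (hex n _).2 ⟨y, rfl⟩
  have h1 (z : C) : objMap I (f.restrictScalars k) (n + 1) z.1.1 ∈ cycles k I N (n + 1) := by
    change d k I N n _ = 0
    rw [d_objMap, hC, hex0]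
  have h2 (z : C) : z.1.2 ∈ cycles k I L n := by
    cases n with
    | zero => trivial
    | succ n =>
      refine hinj n ?_
      rw [map_zero, ← d_objMap, ← hC, d_d]
  let φ : C →ₗ[k] Tor k I N (n + 1) := Submodule.mkQ _ ∘ₗ
    LinearMap.codRestrict _ (objMap I (f.restrictScalars k) (n + 1) ∘ₗ
      LinearMap.fst k _ _ ∘ₗ C.subtype) h1
  let ψ : C →ₗ[k] Tor k I L n := Submodule.mkQ _ ∘ₗ
    LinearMap.codRestrict _ (LinearMap.snd k _ _ ∘ₗ C.subtype) h2
  have hφ0 (z : C) : φ z = 0 ↔ objMap I (f.restrictScalars k) (n + 1) z.1.1 ∈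
      boundaries k I N (n + 1) := Submodule.Quotient.mk_eq_zero _
  have hψ0 (z : C) : ψ z = 0 ↔ z.1.2 ∈ boundaries k I L n := Submodule.Quotient.mk_eq_zero _
  have hφ : Function.Surjective φ := by
    intro t
    obtain ⟨⟨x, hx⟩, rfl⟩ := Submodule.Quotient.mk_surjective _ t
    obtain ⟨x, rfl⟩ := hsurj (n + 1) x
    have hx' : d k I N n (objMap I (f.restrictScalars k) (n + 1) x) = 0 := hx
    rw [d_objMap] at hx'
    obtain ⟨y, hy⟩ := (hex n _).1 hx'
    exact ⟨⟨(x, y), hy.symm⟩, rfl⟩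
  -- Here the cycles of `L` have to become boundaries in `F`.
  have hψ : Function.Surjective ψ := by
    intro t
    obtain ⟨⟨y, hy⟩, rfl⟩ := Submodule.Quotient.mk_surjective _ t
    obtain ⟨x, hx⟩ := hL y hy
    exact ⟨⟨(x, y), hx⟩, rfl⟩
  refine ⟨LinearEquiv.ofKerEq φ ψ hφ hψ (Submodule.ext fun z => ?_)⟩
  rw [LinearMap.mem_ker, LinearMap.mem_ker, hφ0, hψ0]
  have hz := hC z
  generalize z.1.1 = x at hz ⊢
  generalize z.1.2 = y at hz ⊢
  constructor
  · rintro ⟨w, hw⟩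
    obtain ⟨w, rfl⟩ := hsurj (n + 2) w
    rw [d_objMap] at hw
    obtain ⟨v, hv⟩ := (hex (n + 1) (x - d k I F (n + 1) w)).1 (by rw [map_sub, hw, sub_self])
    refine ⟨v, hinj n ?_⟩
    rw [← d_objMap, hv, map_sub, d_d, sub_zero, hz]
  · rintro ⟨v, rfl⟩
    have hc : x - objMap I (ι.restrictScalars k) (n + 1) v ∈ cycles k I F (n + 1) := by
      change d k I F n _ = 0
      rw [map_sub, d_objMap, hz, sub_self]
    obtain ⟨w, hw⟩ := hF hc
    refine ⟨objMap I (f.restrictScalars k) (n + 2) w, ?_⟩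
    rw [d_objMap, hw, map_sub, hex0, sub_zero]

end Shift

section Cover
variable {k : Type u} [Field k] {R : Type u} [CommRing R] [Algebra k R] {I : Ideal R}
  {𝒜 : ℕ → Submodule k R} (hR : ConnectedGrading I 𝒜)
  {N : Type u} [AddCommGroup N] [Module k N] [Module R N] [IsScalarTower k R N]
  {𝒩 : ℕ → Submodule k N} (g : Grading 𝒩)

include hR in
-- Elements of `I` have no component of degree `0`, so the degree `j` part of `r m` with `r ∈ I`
-- involves only components of `m` of degree less than `j`. Both graded Nakayama and the filtration
-- of `K ⊗ U` rest on this.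
lemma proj_smul_mem_span (hs : IsGradedSMul 𝒜 𝒩) (j : ℕ) {x : N}
    (hx : x ∈ I • (⊤ : Submodule R N)) :
    g.proj j x ∈ Submodule.span R {y | ∃ l < j, y ∈ 𝒩 l} := by
  refine Submodule.smul_induction_on hx (fun r hr m hm => ?_) fun x y hx hy => ?_
  · clear hm
    induction m using Grading.induction g with
    | add x y hx hy => rw [smul_add, map_add]; exact add_mem hx hy
    | hom l y hy =>
      have h1 := hR.map_proj g ((LinearMap.toSpanSingleton R N y).restrictScalars k) l
        (fun i r hr => by
          rw [add_comm]
          exact hs hr hy)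
      by_cases hlj : l < j
      · obtain ⟨i, rfl⟩ := Nat.exists_eq_add_of_le' hlj.le
        have h2 : hR.proj i r • y = g.proj (i + l) (r • y) := h1 i r
        rw [← h2]
        exact Submodule.smul_mem _ _ (Submodule.subset_span ⟨l, hlj, hy⟩)
      · by_cases hl : l = j
        · have h2 : hR.proj 0 r • y = g.proj (0 + l) (r • y) := h1 0 r
          rw [(hR.mem_ideal r).1 hr, zero_smul, zero_add, hl] at h2
          rw [← h2]
          exact zero_mem _
        · have h2 : g.proj j (r • y) = 0 :=
            hR.proj_map_of_lt g ((LinearMap.toSpanSingleton R N y).restrictScalars k) l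
              (fun i r hr => by
                rw [add_comm]
                exact hs hr hy) (show j < l by omega) r
          rw [h2]
          exact zero_mem _
  · rw [map_add]
    exact add_mem hx hy

include hR g in
/-- The graded Nakayama lemma. -/
lemma span_eq_top_of_toTorZero (hs : IsGradedSMul 𝒜 𝒩) {ι : Type*} (n : ι → N) (a : ι → ℕ)
    (hn : ∀ i, n i ∈ 𝒩 (a i))
    (h : Submodule.span k (Set.range fun i => toTorZero k I N (n i)) = ⊤) :
    Submodule.span R (Set.range n) = ⊤ := by
  have key (j : ℕ) : ∀ x ∈ 𝒩 j, x ∈ Submodule.span R (Set.range n) := by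
    induction j using Nat.strong_induction_on with
    | _ j ih =>
      intro x hx
      have hmem : toTorZero k I N x ∈
          (Submodule.span k (Set.range n)).map (toTorZero k I N) := by
        rw [Submodule.map_span, ← Set.range_comp]
        change _ ∈ Submodule.span k (Set.range fun i => toTorZero k I N (n i))
        rw [h]
        trivial
      obtain ⟨y, hy, hxy⟩ := hmem
      have h1 : x - y ∈ I • (⊤ : Submodule R N) := by
        rw [← toTorZero_eq_zero_iff (k := k), map_sub, hxy, sub_self]
      -- As `x - y ∈ I N`, the first term is a combination of elements of lower degree, settled by
      -- induction; the second involves only generators of degree `j`.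
      have h2 : x = g.proj j (x - y) + g.proj j y := by
        rw [map_sub, sub_add_cancel, g.proj_same hx]
      rw [h2]
      refine add_mem ?_ ?_
      · refine Submodule.span_le.2 ?_ (proj_smul_mem_span hR g hs j h1)
        rintro z ⟨l, hl, hz⟩
        exact ih l hl z hz
      · refine Submodule.span_induction (R := k) (p := fun y _ => g.proj j y ∈ Submodule.span R (Set.range n))
          ?_ ?_ ?_ ?_ hy
        · rintro _ ⟨i, rfl⟩
          by_cases hij : a i = j
          · rw [g.proj_same (hij ▸ hn i)]
            exact Submodule.subset_span ⟨i, rfl⟩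
          · rw [g.proj_ne (hn i) hij]
            exact zero_mem _
        · rw [map_zero]; exact zero_mem _
        · intro y z _ _ hy hz
          rw [map_add]; exact add_mem hy hz
        · intro c y _ hy
          rw [(g.proj j).map_smul]; exact Submodule.smul_mem ((Submodule.span R (Set.range n)).restrictScalars k) c hy
  rw [eq_top_iff]
  rintro x -
  induction x using Grading.induction g with
  | hom j x hx => exact key j x hx
  | add x y hx hy => exact add_mem hx hy

include hR in
lemma toTorZero_smul (r : R) (c : k) (hc : algebraMap k R c = hR.proj 0 r) (x : N) :
    toTorZero k I N (r • x) = c • toTorZero k I N x := by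
  rw [← map_smul, ← sub_eq_zero, ← map_sub, toTorZero_eq_zero_iff, ← algebraMap_smul R c x,
    ← sub_smul, hc]
  refine Submodule.smul_mem_smul ?_ trivial
  rw [hR.mem_ideal, map_sub, hR.proj_same (hR.proj_mem 0 r), sub_self]

include hR in
lemma finite_tor_zero [Module.Finite R N] : Module.Finite k (Tor k I N 0) := by
  classical
  obtain ⟨s, hs⟩ := Module.Finite.fg_top (R := R) (M := N)
  refine ⟨⟨s.image (toTorZero k I N), ?_⟩⟩
  rw [eq_top_iff]
  rintro t -
  obtain ⟨x, rfl⟩ := toTorZero_surjective I t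
  have hx : x ∈ Submodule.span R (s : Set N) := hs ▸ trivial
  induction hx using Submodule.span_induction with
  | mem x hx => exact Submodule.subset_span (Finset.mem_image_of_mem _ hx)
  | zero => rw [map_zero]; exact zero_mem _
  | add x y _ _ hx hy => rw [map_add]; exact add_mem hx hy
  | smul r x _ hx =>
    obtain ⟨c, hc⟩ := hR.exists_algebraMap _ (hR.proj_mem 0 r)
    rw [toTorZero_smul hR r c hc]
    exact Submodule.smul_mem _ _ hx

include g in
-- The images of homogeneous elements span `Tor₀`, so a basis can be selected among them.
lemma exists_homogeneous_basis_tor_zero [Module.Finite k (Tor k I N 0)] :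
    ∃ (n : Fin (Module.finrank k (Tor k I N 0)) → N) (a : Fin (Module.finrank k (Tor k I N 0)) → ℕ),
      (∀ i, n i ∈ 𝒩 (a i)) ∧ LinearIndependent k (fun i => toTorZero k I N (n i)) ∧
      Submodule.span k (Set.range fun i => toTorZero k I N (n i)) = ⊤ := by
  let T : Set (Tor k I N 0) := {t | ∃ j, ∃ x ∈ 𝒩 j, toTorZero k I N x = t}
  have hT : Submodule.span k T = ⊤ := by
    rw [eq_top_iff]
    rintro t -
    obtain ⟨x, rfl⟩ := toTorZero_surjective I t
    induction x using Grading.induction g with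
    | hom j x hx => exact Submodule.subset_span ⟨j, x, hx, rfl⟩
    | add x y hx hy => rw [map_add]; exact add_mem hx hy
  obtain ⟨b, hbT, hb, hli⟩ := exists_linearIndependent k T
  let B := Module.Basis.mk hli (by rw [Subtype.range_coe, hb, hT])
  let e := B.indexEquiv (Module.finBasis k (Tor k I N 0))
  choose a n hn hn' using fun i => hbT (e.symm i).2
  refine ⟨n, a, hn, ?_, ?_⟩
  · simp only [hn']
    exact hli.comp e.symm e.symm.injective
  · simp only [hn']
    have : (fun i => (e.symm i : Tor k I N 0)) = Subtype.val ∘ e.symm := rfl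
    rw [this, e.symm.surjective.range_comp, Subtype.range_coe, hb, hT]

omit [IsScalarTower k R N] in
lemma linearCombination_mem (hs : IsGradedSMul 𝒜 𝒩) {ι : Type*} [Fintype ι] (n : ι → N)
    (a : ι → ℕ) (hn : ∀ i, n i ∈ 𝒩 (a i)) (j : ℕ) (x : ι → R)
    (hx : ∀ i, x i ∈ if a i ≤ j then 𝒜 (j - a i) else ⊥) :
    Fintype.linearCombination R n x ∈ 𝒩 j := by
  rw [Fintype.linearCombination_apply]
  refine Submodule.sum_mem _ fun i _ => ?_
  have hxi := hx i
  by_cases hij : a i ≤ j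
  · rw [if_pos hij] at hxi
    have := hs hxi (hn i)
    rwa [Nat.add_sub_cancel' hij] at this
  · rw [if_neg hij, Submodule.mem_bot] at hxi
    rw [hxi, zero_smul]
    exact zero_mem _

lemma linearCombination_proj (hs : IsGradedSMul 𝒜 𝒩) {ι : Type*} [Fintype ι] (n : ι → N)
    (a : ι → ℕ) (hn : ∀ i, n i ∈ 𝒩 (a i)) (j : ℕ) (x : ι → R) :
    Fintype.linearCombination R n ((Grading.pi fun i => hR.shift (a i)).proj j x) =
      g.proj j (Fintype.linearCombination R n x) :=
  (Grading.pi fun i => hR.shift (a i)).map_proj g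
    ((Fintype.linearCombination R n).restrictScalars k) 0
    (fun j x hx => linearCombination_mem hs n a hn j x fun i => hx i trivial) j x

include hR g in
/-- The minimal graded free cover of a graded module. -/
lemma exists_minimal_cover (hs : IsGradedSMul 𝒜 𝒩) [Module.Finite R N] :
    ∃ f : (Fin (Module.finrank k (Tor k I N 0)) → R) →ₗ[R] N, Function.Surjective f ∧
      (∃ 𝒪 : ℕ → Submodule k (LinearMap.ker f), Nonempty (Grading 𝒪) ∧ IsGradedSMul 𝒜 𝒪) ∧
      ∀ n, Nonempty (Tor k I N (n + 1) ≃ₗ[k] Tor k I (LinearMap.ker f) n) := by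
  have := finite_tor_zero hR (N := N)
  obtain ⟨n, a, hn, hli, hsp⟩ := exists_homogeneous_basis_tor_zero (I := I) g
  let c := Module.finrank k (Tor k I N 0)
  let f : (Fin c → R) →ₗ[R] N := Fintype.linearCombination R n
  have hf : Function.Surjective f := by
    rw [← LinearMap.range_eq_top, Fintype.range_linearCombination,
      span_eq_top_of_toTorZero hR g hs n a hn hsp]
  let gF := Grading.pi fun i : Fin c => hR.shift (a i)
  have hfdeg (j : ℕ) (x : Fin c → R) : f (gF.proj j x) = g.proj j (f x) :=
    linearCombination_proj hR g hs n a hn j x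
  refine ⟨f, hf, ⟨_, ⟨gF.comap ((LinearMap.ker f).subtype.restrictScalars k) Subtype.val_injective
    fun j x => ⟨⟨gF.proj j x, ?_⟩, rfl⟩⟩, ?_⟩, fun m => ?_⟩
  · rw [LinearMap.mem_ker, hfdeg, x.2, map_zero]
  · intro i j r x hr hx l _
    have hxl : (x : Fin c → R) l ∈ if a l ≤ j then 𝒜 (j - a l) else ⊥ := hx l trivial
    change r * (x : Fin c → R) l ∈ if a l ≤ j + i then 𝒜 (j + i - a l) else ⊥
    by_cases hl : a l ≤ j
    · rw [if_pos hl] at hxl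
      rw [if_pos (by omega), add_comm j i, Nat.add_sub_assoc hl]
      exact hR.mul_mem hr hxl
    · rw [if_neg hl, Submodule.mem_bot] at hxl
      rw [hxl, mul_zero]
      exact zero_mem _
  · refine nonempty_tor_succ_equiv I (ι := (LinearMap.ker f).subtype) Subtype.val_injective hf
      (fun x => by rw [Submodule.coe_subtype, Subtype.range_coe]; rfl) m (tor_free_le hR _ _)
      fun y hy => ?_
    cases m with
    | succ m => exact tor_free_le hR c m (objMap_mem_cycles I _ _ hy)
    | zero =>
      -- Minimality enters here: the kernel of the cover lies in `I F`, so that the shift is valid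
      -- from `Tor₁` to `Tor₀` too.
      suffices H : ∀ y ∈ LinearMap.ker f, y ∈ LinearMap.range (act k I (Fin c → R) 0) from
        H _ (show LinearMap.ker f from y).2
      intro y hy
      have hy0 : ∑ i, y i • n i = 0 := hy
      -- In `Tor₀` the relation becomes one between basis vectors, with the constant terms of the `y
      -- i` as coefficients; so these constant terms vanish.
      have hyI (i : Fin c) : y i ∈ I := by
        choose e he using fun i => hR.exists_algebraMap _ (hR.proj_mem 0 (y i))
        have h0 : ∑ i, e i • toTorZero k I N (n i) = 0 := by
          rw [← map_zero (toTorZero k I N), ← hy0, map_sum]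
          exact Finset.sum_congr rfl fun i _ => (toTorZero_smul hR _ _ (he i) _).symm
        rw [hR.mem_ideal, ← he, Fintype.linearIndependent_iff.1 hli e h0 i, map_zero]
      have hsum : y =
          ∑ i, act k I (Fin c → R) 0 (cons k I (Fin c → R) 0 (Pi.single i 1 : Fin c → R) ⟨_, hyI i⟩) := by
        change _ = ∑ i, y i • (Pi.single i 1 : Fin c → R)
        funext i
        simp [Finset.sum_apply, Pi.single_apply]
      rw [hsum]
      exact Submodule.sum_mem _ fun i _ => ⟨_, rfl⟩

end Cover
end BarComplex

/-! ### Syzygies, partial Euler characteristics and freeness -/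

namespace BarComplex

section Homology
variable {k : Type u} [Field k] {R : Type u} [CommRing R] [Algebra k R] {I : Ideal R}
  {𝒜 : ℕ → Submodule k R} (hR : ConnectedGrading I 𝒜)

lemma subsingleton_obj {k R M : Type u} [CommRing k] [CommRing R] [Algebra k R] (I : Ideal R)
    [AddCommGroup M] [Module k M] [Subsingleton M] (n : ℕ) : Subsingleton (obj k I M n) := by
  induction n with
  | zero => exact inferInstanceAs (Subsingleton M)
  | succ n ih => exact inferInstanceAs (Subsingleton (obj k I M n ⊗[k] I))

lemma subsingleton_tor {k R M : Type u} [CommRing k] [CommRing R] [Algebra k R] (I : Ideal R)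
    [AddCommGroup M] [Module k M] [Module R M] [IsScalarTower k R M] [Subsingleton M] (n : ℕ) :
    Subsingleton (Tor k I M n) := by
  have := subsingleton_obj (k := k) I (M := M) n
  exact (Submodule.mkQ_surjective _).subsingleton

variable {N : Type u} [AddCommGroup N] [Module k N] [Module R N] [IsScalarTower k R N]
  {𝒩 : ℕ → Submodule k N} (g : Grading 𝒩)

include hR g in
lemma subsingleton_of_tor_zero (hs : IsGradedSMul 𝒜 𝒩) [Subsingleton (Tor k I N 0)] :
    Subsingleton N := by
  have h := span_eq_top_of_toTorZero hR g hs (Fin.elim0 : Fin 0 → N) Fin.elim0 (fun i => i.elim0)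
    (Subsingleton.elim _ _)
  rw [Set.range_eq_empty, Submodule.span_empty] at h
  exact (Submodule.subsingleton_iff R).1 (subsingleton_of_bot_eq_top h)

include hR g in
lemma finite_tor [IsNoetherianRing R] [Module.Finite R N] (hs : IsGradedSMul 𝒜 𝒩) (n : ℕ) :
    Module.Finite k (Tor k I N n) := by
  induction n generalizing N with
  | zero => exact finite_tor_zero hR
  | succ n ih =>
    obtain ⟨f, -, ⟨𝒪, ⟨gO⟩, hO⟩, he⟩ := exists_minimal_cover hR g hs
    obtain ⟨e⟩ := he n
    have := ih gO hO
    exact Module.Finite.equiv e.symm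

include hR g in
-- `L` is the kernel of the minimal cover. The rank formula holds because the cover has rank `dim
-- Tor₀(N)`. If `Tor₁(N) ≅ Tor₀(L)` vanishes, then `L = 0` by graded Nakayama, and the cover is an
-- isomorphism.
lemma exists_syzygy [IsDomain R] [IsNoetherianRing R] [Module.Finite R N]
    (hs : IsGradedSMul 𝒜 𝒩) :
    ∃ (c : ℕ) (L : Submodule R (Fin c → R)),
      (∃ 𝒪 : ℕ → Submodule k L, Nonempty (Grading 𝒪) ∧ IsGradedSMul 𝒜 𝒪) ∧
      (∀ n, Nonempty (Tor k I N (n + 1) ≃ₗ[k] Tor k I L n)) ∧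
      Module.finrank k (Tor k I N 0) = Module.finrank R N + Module.finrank R L ∧
      (Subsingleton L ↔ ∀ i, 0 < i → Subsingleton (Tor k I N i)) ∧
      (Subsingleton L → Module.Free R N) := by
  obtain ⟨f, hf, ⟨𝒪, ⟨gO⟩, hO⟩, he⟩ := exists_minimal_cover hR g hs
  refine ⟨_, LinearMap.ker f, ⟨𝒪, ⟨gO⟩, hO⟩, he, ?_, ⟨fun h i hi => ?_, fun h => ?_⟩, fun h => ?_⟩
  · have h1 := Submodule.finrank_quotient_add_finrank (LinearMap.ker f)
    rw [(f.quotKerEquivOfSurjective hf).finrank_eq, Module.finrank_fin_fun] at h1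
    exact h1.symm
  · obtain ⟨i, rfl⟩ := Nat.exists_eq_succ_of_ne_zero hi.ne'
    obtain ⟨e⟩ := he i
    have := subsingleton_tor (k := k) I (M := LinearMap.ker f) i
    exact e.toEquiv.subsingleton
  · obtain ⟨e⟩ := he 0
    have := h 1 zero_lt_one
    have : Subsingleton (Tor k I (LinearMap.ker f) 0) := e.symm.toEquiv.subsingleton
    exact subsingleton_of_tor_zero hR gO hO
  · have hker : LinearMap.ker f = ⊥ := Submodule.eq_bot_of_subsingleton
    exact Module.Free.of_equiv (LinearEquiv.ofBijective f ⟨LinearMap.ker_eq_bot.1 hker, hf⟩)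

include hR g in
/-- The partial Euler characteristics of `Tor`. -/
lemma exists_sum_finrank_tor [IsDomain R] [IsNoetherianRing R] [Module.Finite R N]
    (hs : IsGradedSMul 𝒜 𝒩) (m : ℕ) :
    ∃ s : ℕ, ∑ i ∈ Finset.range (m + 1), (-1 : ℤ) ^ i * Module.finrank k (Tor k I N i) =
      Module.finrank R N + (-1) ^ m * s ∧ (s = 0 ↔ ∀ i, m < i → Subsingleton (Tor k I N i)) := by
  induction m generalizing N with
  | zero =>
    obtain ⟨c, L, -, -, h1, h2, -⟩ := exists_syzygy hR g hs
    -- A submodule of a free module over a domain is zero as soon as its rank is zero.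
    refine ⟨Module.finrank R L, ?_, ?_⟩
    · rw [zero_add, Finset.sum_range_one, h1]
      push_cast
      ring
    · rw [← h2, Module.finrank_zero_iff]
  | succ m ih =>
    obtain ⟨c, L, ⟨𝒪, ⟨gO⟩, hO⟩, he, h1, -, -⟩ := exists_syzygy hR g hs
    obtain ⟨s, hs1, hs2⟩ := ih gO hO
    have he' (i : ℕ) : Module.finrank k (Tor k I N (i + 1)) = Module.finrank k (Tor k I L i) :=
      (he i).some.finrank_eq
    -- The same `s` serves for `N` with `m + 1` as for its syzygy `L` with `m`; the sign flips
    -- because the sum for `L` is subtracted from `rank N + rank L`.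
    refine ⟨s, ?_, hs2.trans ⟨fun h i hi => ?_, fun h i hi => ?_⟩⟩
    · rw [Finset.sum_range_succ', h1]
      simp only [he', pow_succ _ (_ : ℕ), mul_neg_one, neg_mul, Finset.sum_neg_distrib, hs1]
      push_cast
      ring
    · obtain ⟨i, rfl⟩ := Nat.exists_eq_succ_of_ne_zero (show i ≠ 0 by omega)
      have := h i (by omega)
      exact (he i).some.toEquiv.subsingleton
    · have := h (i + 1) (by omega)
      exact (he i).some.symm.toEquiv.subsingleton

include hR g in
-- A free module is some `R^c`, where the contraction applies; the converse holds since the minimal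
-- cover is then injective.
lemma free_iff_subsingleton_tor [IsDomain R] [IsNoetherianRing R] [Module.Finite R N]
    (hs : IsGradedSMul 𝒜 𝒩) :
    Module.Free R N ↔ ∀ i, 0 < i → Subsingleton (Tor k I N i) := by
  constructor
  · intro h i hi
    obtain ⟨i, rfl⟩ := Nat.exists_eq_succ_of_ne_zero hi.ne'
    have e := torEquiv (k := k) I (Module.finBasis R N).equivFun (i + 1)
    have : Subsingleton (Tor k I (Fin (Module.finrank R N) → R) (i + 1)) :=
      Submodule.Quotient.subsingleton_iff.2
        (Submodule.submoduleOf_eq_top.2 (tor_free_le hR _ i))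
    exact e.toEquiv.subsingleton
  · intro h
    obtain ⟨c, L, -, -, -, h2, h3⟩ := exists_syzygy hR g hs
    exact h3 (h2.2 h)

end Homology
end BarComplex

/-! ### The Hilbert–Serre theorem -/

lemma Submodule.finrank_map_add_finrank_inf_ker {k N N' : Type*} [Field k] [AddCommGroup N]
    [Module k N] [AddCommGroup N'] [Module k N'] (f : N →ₗ[k] N') (W : Submodule k N)
    [Module.Finite k W] : Module.finrank k (W.map f) +
      Module.finrank k (W ⊓ LinearMap.ker f : Submodule k N) = Module.finrank k W := by
  rw [← LinearMap.finrank_range_add_finrank_ker (f.domRestrict W), LinearMap.range_domRestrict,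
    LinearMap.ker_domRestrict,
    (Submodule.equivMapOfInjective W.subtype Subtype.val_injective _).finrank_eq,
    Submodule.map_comap_subtype]

namespace Grading
variable {k R N : Type*} [CommRing k] [CommRing R] [Algebra k R] [AddCommGroup N] [Module k N]
  [Module R N] [IsScalarTower k R N] {𝒩 : ℕ → Submodule k N} (g : Grading 𝒩) (L : Submodule R N)
  (hL : ∀ j, ∀ x ∈ L, g.proj j x ∈ L)

/-- The grading of a homogeneous submodule. -/
noncomputable def sub : Grading (fun j => (𝒩 j).comap (L.subtype.restrictScalars k)) :=
  g.comap _ Subtype.val_injective fun j x => ⟨⟨_, hL j x x.2⟩, rfl⟩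

/-- The grading of the quotient by a homogeneous submodule. -/
noncomputable def quot : Grading (fun j => (𝒩 j).map (L.mkQ.restrictScalars k)) :=
  g.map _ L.mkQ_surjective fun j x hx => by
    change Submodule.Quotient.mk _ = 0 at hx
    change Submodule.Quotient.mk _ = 0
    rw [Submodule.Quotient.mk_eq_zero] at hx ⊢
    exact hL j x hx

end Grading

namespace BarComplex

section HilbertSerre
variable {k : Type u} [Field k] {R : Type u} [CommRing R] [Algebra k R] {I : Ideal R}
  {𝒜 : ℕ → Submodule k R}

lemma IsGradedSMul.sub {N : Type*} [AddCommGroup N] [Module k N] [Module R N]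
    [IsScalarTower k R N] {𝒩 : ℕ → Submodule k N} (hs : IsGradedSMul 𝒜 𝒩) (L : Submodule R N) :
    IsGradedSMul 𝒜 (fun j => (𝒩 j).comap (L.subtype.restrictScalars k)) :=
  fun hr hx => hs hr hx

lemma IsGradedSMul.quot {N : Type*} [AddCommGroup N] [Module k N] [Module R N]
    [IsScalarTower k R N] {𝒩 : ℕ → Submodule k N} (hs : IsGradedSMul 𝒜 𝒩) (L : Submodule R N) :
    IsGradedSMul 𝒜 (fun j => (𝒩 j).map (L.mkQ.restrictScalars k)) := by
  rintro i j r _ hr ⟨x, hx, rfl⟩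
  exact ⟨r • x, hs hr hx, rfl⟩

variable {N : Type*} [AddCommGroup N] [Module k N] [Module R N]
  [IsScalarTower k R N] {𝒩 : ℕ → Submodule k N} (g : Grading 𝒩)

instance finite_sub_degree [∀ j, Module.Finite k (𝒩 j)] (L : Submodule R N) (j : ℕ) :
    Module.Finite k ((𝒩 j).comap (L.subtype.restrictScalars k)) :=
  Module.Finite.of_injective
    ((L.subtype.restrictScalars k).restrict (q := 𝒩 j) fun _ h => h)
    fun _ _ h => Subtype.ext (Subtype.ext (congrArg (fun x : 𝒩 j => (x : N)) h))

lemma finrank_sub_degree (L : Submodule R N) (j : ℕ) :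
    Module.finrank k ((𝒩 j).comap (L.subtype.restrictScalars k)) =
      Module.finrank k (𝒩 j ⊓ L.restrictScalars k : Submodule k N) := by
  rw [(Submodule.equivMapOfInjective (L.subtype.restrictScalars k) Subtype.val_injective
    ((𝒩 j).comap (L.subtype.restrictScalars k))).finrank_eq]
  have : ((𝒩 j).comap (L.subtype.restrictScalars k)).map (L.subtype.restrictScalars k) =
      𝒩 j ⊓ L.restrictScalars k := by
    ext x
    constructor
    · rintro ⟨y, hy, rfl⟩
      exact ⟨hy, y.2⟩
    · rintro ⟨hx, hx'⟩
      exact ⟨⟨x, hx'⟩, hx, rfl⟩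
  rw [this]

lemma finrank_quot_degree [∀ j, Module.Finite k (𝒩 j)] (L : Submodule R N) (j : ℕ) :
    Module.finrank k ((𝒩 j).map (L.mkQ.restrictScalars k)) +
      Module.finrank k (𝒩 j ⊓ L.restrictScalars k : Submodule k N) = Module.finrank k (𝒩 j) := by
  rw [← Submodule.finrank_map_add_finrank_inf_ker (L.mkQ.restrictScalars k) (𝒩 j)]
  have : LinearMap.ker (L.mkQ.restrictScalars k) = L.restrictScalars k := by
    rw [LinearMap.ker_restrictScalars, Submodule.ker_mkQ]
  rw [this]

include g in
/-- The additivity of Hilbert series in `0 → ker r → N → N → N / r N → 0`. -/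
lemma hilbertSeries_mul_one_sub [∀ j, Module.Finite k (𝒩 j)] (r : R) (d : ℕ)
    (hr : ∀ j, ∀ x ∈ 𝒩 j, r • x ∈ 𝒩 (j + d)) :
    hilbertSeries 𝒩 * (1 - PowerSeries.X ^ d) =
      hilbertSeries (fun j => (𝒩 j).map
        ((LinearMap.range (LinearMap.lsmul R N r)).mkQ.restrictScalars k)) -
      hilbertSeries (fun j => (𝒩 j).comap
        ((LinearMap.ker (LinearMap.lsmul R N r)).subtype.restrictScalars k)) *
        PowerSeries.X ^ d := by
  -- Since multiplication by `r` is homogeneous of degree `d`, a homogeneous multiple of `r` is `r`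
  -- times a homogeneous element; in degrees below `d` it is zero.
  have h1 (j : ℕ) : 𝒩 (j + d) ⊓ (LinearMap.range (LinearMap.lsmul R N r)).restrictScalars k =
      (𝒩 j).map ((LinearMap.lsmul R N r).restrictScalars k) := by
    ext x
    constructor
    · rintro ⟨hx, ⟨y, rfl⟩⟩
      refine ⟨g.proj j y, g.proj_mem _ _, ?_⟩
      rw [g.map_proj g ((LinearMap.lsmul R N r).restrictScalars k) d hr j y]
      exact g.proj_same hx
    · rintro ⟨y, hy, rfl⟩
      exact ⟨hr j y hy, y, rfl⟩
  have h2 (j : ℕ) (hj : j < d) :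
      𝒩 j ⊓ (LinearMap.range (LinearMap.lsmul R N r)).restrictScalars k = ⊥ := by
    rw [eq_bot_iff]
    rintro x ⟨hx, ⟨y, rfl⟩⟩
    have := g.proj_map_of_lt g ((LinearMap.lsmul R N r).restrictScalars k) d hr hj y
    rw [LinearMap.restrictScalars_apply, g.proj_same hx] at this
    exact this
  have h3 : (LinearMap.ker (LinearMap.lsmul R N r)).restrictScalars k =
    LinearMap.ker ((LinearMap.lsmul R N r).restrictScalars k) := rfl
  ext j
  rw [mul_sub, mul_one, map_sub, map_sub, PowerSeries.coeff_mul_X_pow', PowerSeries.coeff_mul_X_pow',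
    coeff_hilbertSeries, coeff_hilbertSeries, ← finrank_quot_degree
      (LinearMap.range (LinearMap.lsmul R N r)) j]
  by_cases hj : d ≤ j
  · obtain ⟨j, rfl⟩ := Nat.exists_eq_add_of_le' hj
    rw [if_pos hj, if_pos hj, Nat.add_sub_cancel, coeff_hilbertSeries, coeff_hilbertSeries,
      finrank_sub_degree, h3, h1, ← Submodule.finrank_map_add_finrank_inf_ker
        ((LinearMap.lsmul R N r).restrictScalars k) (𝒩 j)]
    push_cast
    ring
  · rw [if_neg hj, if_neg hj, h2 j (by omega), finrank_bot]
    simp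

variable (hR : ConnectedGrading I 𝒜)

include g in
lemma exists_polynomial_of_finite [Module.Finite k N] :
    ∃ p : Polynomial ℤ, hilbertSeries 𝒩 = p := by
  obtain ⟨s, hs⟩ := g.finite_ne_bot.exists_finset_coe
  obtain ⟨n, hn⟩ := s.exists_nat_subset_range
  refine ⟨PowerSeries.trunc n (hilbertSeries 𝒩), ?_⟩
  ext j
  rw [Polynomial.coeff_coe, PowerSeries.coeff_trunc]
  by_cases hj : j < n
  · rw [if_pos hj]
  · have : 𝒩 j = ⊥ := by
      by_contra h
      have : j ∈ (s : Set ℕ) := hs ▸ h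
      exact hj (Finset.mem_range.1 (hn this))
    rw [if_neg hj, coeff_hilbertSeries, this, finrank_bot, Nat.cast_zero]

end HilbertSerre

section HilbertSerre
variable {k : Type u} [Field k] {R : Type u} [CommRing R] [Algebra k R] {I : Ideal R}
  {𝒜 : ℕ → Submodule k R} (hR : ConnectedGrading I 𝒜)

include hR in
/-- The Hilbert–Serre theorem, for generators of the irrelevant ideal modulo the annihilator. -/
lemma hilbert_serre_aux [IsNoetherianRing R] (l : List (R × ℕ)) (hl : ∀ p ∈ l, p.1 ∈ 𝒜 p.2)
    {N : Type u} [AddCommGroup N] [Module k N] [Module R N] [IsScalarTower k R N]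
    {𝒩 : ℕ → Submodule k N} (g : Grading 𝒩) [∀ j, Module.Finite k (𝒩 j)]
    (hs : IsGradedSMul 𝒜 𝒩) [Module.Finite R N]
    (hI : I ≤ Ideal.span {r | ∃ p ∈ l, p.1 = r} ⊔ Module.annihilator R N) :
    ∃ p : Polynomial ℤ,
      hilbertSeries 𝒩 * (l.map fun p => 1 - (PowerSeries.X : PowerSeries ℤ) ^ p.2).prod = p := by
  induction l generalizing N with
  | nil =>
    -- Without generators `I` kills `N`, so that `N = Tor₀` is finite-dimensional and its series is
    -- a polynomial.
    have h0 : I ≤ Module.annihilator R N := by simpa using hI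
    have hker : LinearMap.ker (toTorZero k I N) = ⊥ := by
      rw [eq_bot_iff]
      intro x hx
      rw [LinearMap.mem_ker, toTorZero_eq_zero_iff] at hx
      refine Submodule.smul_induction_on (p := fun x => x ∈ (⊥ : Submodule k N)) hx
        (fun r hr n _ => ?_) fun x y hx hy => add_mem hx hy
      exact Module.mem_annihilator.1 (h0 hr) n
    have := finite_tor_zero hR (N := N)
    have : Module.Finite k N := Module.Finite.of_injective _ (LinearMap.ker_eq_bot.1 hker)
    simpa using exists_polynomial_of_finite g
  | cons p l ih =>
    have hp : ∀ j, ∀ x ∈ 𝒩 j, p.1 • x ∈ 𝒩 (j + p.2) :=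
      fun j x hx => hs (hl p List.mem_cons_self) hx
    let φ := LinearMap.lsmul R N p.1
    have hφ : ∀ j x, φ (g.proj j x) = g.proj (j + p.2) (φ x) :=
      g.map_proj g (φ.restrictScalars k) p.2 hp
    have hK : ∀ j, ∀ x ∈ LinearMap.ker φ, g.proj j x ∈ LinearMap.ker φ := by
      intro j x hx
      rw [LinearMap.mem_ker] at hx ⊢
      rw [hφ, hx, map_zero]
    have hC : ∀ j, ∀ x ∈ LinearMap.range φ, g.proj j x ∈ LinearMap.range φ := by
      rintro j _ ⟨y, rfl⟩
      by_cases hj : p.2 ≤ j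
      · obtain ⟨j, rfl⟩ := Nat.exists_eq_add_of_le' hj
        exact ⟨_, hφ j y⟩
      · have := g.proj_map_of_lt g (φ.restrictScalars k) p.2 hp (not_le.1 hj) y
        rw [LinearMap.restrictScalars_apply] at this
        rw [this]
        exact zero_mem _
    -- The kernel and cokernel of multiplication by the first generator are killed by it. Working
    -- modulo annihilators, the shorter list suffices for both, and the ring need not be changed.
    have hI' : I ≤ Ideal.span {r | ∃ p ∈ l, p.1 = r} ⊔ (Ideal.span {p.1} ⊔ Module.annihilator R N) := by
      refine hI.trans ?_
      rw [← sup_assoc, ← Ideal.span_union]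
      refine sup_le_sup_right (Ideal.span_mono ?_) _
      rintro r ⟨q, hq, rfl⟩
      rcases List.mem_cons.1 hq with rfl | hq
      · exact Or.inr rfl
      · exact Or.inl ⟨q, hq, rfl⟩
    have : ∀ j, Module.Finite k ((𝒩 j).map ((LinearMap.range φ).mkQ.restrictScalars k)) :=
      fun j => Module.Finite.map _ _
    obtain ⟨P, hP⟩ := ih (fun q hq => hl q (List.mem_cons_of_mem _ hq)) (g.sub _ hK) (hs.sub _) (by
      refine hI'.trans (sup_le_sup_left (sup_le ?_ ?_) _)
      · rw [Ideal.span_singleton_le_iff_mem, Module.mem_annihilator]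
        exact fun x => Subtype.ext x.2
      · intro r hr
        rw [Module.mem_annihilator] at hr ⊢
        exact fun x => Subtype.ext (hr x))
    obtain ⟨Q, hQ⟩ := ih (fun q hq => hl q (List.mem_cons_of_mem _ hq)) (g.quot _ hC) (hs.quot _) (by
      refine hI'.trans (sup_le_sup_left (sup_le ?_ ?_) _)
      · rw [Ideal.span_singleton_le_iff_mem, Module.mem_annihilator]
        intro x
        obtain ⟨x, rfl⟩ := Submodule.Quotient.mk_surjective _ x
        rw [← Submodule.Quotient.mk_smul, Submodule.Quotient.mk_eq_zero]
        exact ⟨x, rfl⟩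
      · intro r hr
        rw [Module.mem_annihilator] at hr ⊢
        intro x
        obtain ⟨x, rfl⟩ := Submodule.Quotient.mk_surjective _ x
        rw [← Submodule.Quotient.mk_smul, hr, Submodule.Quotient.mk_zero])
    refine ⟨Q - P * Polynomial.X ^ p.2, ?_⟩
    rw [List.map_cons, List.prod_cons, ← mul_assoc, hilbertSeries_mul_one_sub g p.1 p.2 hp, sub_mul,
      Polynomial.coe_sub, Polynomial.coe_mul, Polynomial.coe_pow, Polynomial.coe_X, ← hP, ← hQ]
    ring

include hR in
lemma exists_homogeneous_generators [IsNoetherianRing R] :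
    ∃ l : List (R × ℕ), (∀ p ∈ l, p.1 ∈ 𝒜 p.2 ∧ 0 < p.2) ∧
      I ≤ Ideal.span {r | ∃ p ∈ l, p.1 = r} := by
  classical
  let T : Set R := {r | ∃ j, 0 < j ∧ r ∈ 𝒜 j}
  have hT : I ≤ Ideal.span T := by
    intro r hr
    obtain ⟨n, -, hn⟩ := hR.exists_sum_proj r
    rw [← hn]
    refine Submodule.sum_mem _ fun j _ => ?_
    by_cases hj : j = 0
    · rw [hj, (hR.mem_ideal r).1 hr]; exact zero_mem _
    · exact Submodule.subset_span ⟨j, Nat.pos_of_ne_zero hj, hR.proj_mem j r⟩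
  obtain ⟨s, hs, hs'⟩ := (Submodule.fg_span_iff_fg_span_finset_subset T).1
    (IsNoetherian.noetherian (Ideal.span T))
  have hd (r : R) : ∃ j, r ∈ s → 0 < j ∧ r ∈ 𝒜 j := by
    by_cases hr : r ∈ s
    · obtain ⟨j, hj⟩ := hs hr
      exact ⟨j, fun _ => hj⟩
    · exact ⟨0, fun h => absurd h hr⟩
  choose d hd using hd
  refine ⟨s.toList.map fun r => (r, d r), ?_, ?_⟩
  · simp only [List.mem_map, Finset.mem_toList]
    rintro _ ⟨r, hr, rfl⟩
    exact (hd r hr).symm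
  · refine hT.trans (le_of_eq_of_le hs' (Submodule.span_mono fun r hr => ?_))
    simp only [List.mem_map, Finset.mem_toList]
    exact ⟨_, ⟨r, hr, rfl⟩, rfl⟩

include hR in
/-- The Hilbert–Serre theorem. -/
theorem hilbert_serre [IsNoetherianRing R] : ∃ l : List ℕ, (∀ d ∈ l, 0 < d) ∧
    ∀ {N : Type u} [AddCommGroup N] [Module k N] [Module R N] [IsScalarTower k R N]
      {𝒩 : ℕ → Submodule k N} (_ : Grading 𝒩) [∀ j, Module.Finite k (𝒩 j)]
      (_ : IsGradedSMul 𝒜 𝒩) [Module.Finite R N], ∃ p : Polynomial ℤ,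
      hilbertSeries 𝒩 * (l.map fun d => 1 - (PowerSeries.X : PowerSeries ℤ) ^ d).prod = p := by
  obtain ⟨l, hl, hI⟩ := exists_homogeneous_generators hR
  refine ⟨l.map Prod.snd, ?_, fun {N} _ _ _ _ 𝒩 g _ hs _ => ?_⟩
  · simp only [List.mem_map]
    rintro _ ⟨p, hp, rfl⟩
    exact (hl p hp).2
  · rw [List.map_map]
    exact hilbert_serre_aux hR l (fun p hp => (hl p hp).1) g hs (hI.trans le_sup_left)

end HilbertSerre
end BarComplex

/-! ### Real values of power series, and the value of a rational function at 1 -/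

namespace PowerSeries

/-- The value at the real number `t` of a power series with integral coefficients. -/
noncomputable def realEval (t : ℝ) (a : PowerSeries ℤ) : ℝ := ∑' j, ((coeff j a : ℤ) : ℝ) * t ^ j

/-- Absolute convergence at the real number `t`. -/
def AbsConv (t : ℝ) (a : PowerSeries ℤ) : Prop := Summable fun j => ‖((coeff j a : ℤ) : ℝ) * t ^ j‖

lemma coeff_mul_realEval (t : ℝ) (a b : PowerSeries ℤ) (n : ℕ) :
    ∑ p ∈ Finset.HasAntidiagonal.antidiagonal n,
      (((coeff p.1 a : ℤ) : ℝ) * t ^ p.1) * (((coeff p.2 b : ℤ) : ℝ) * t ^ p.2) =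
      ((coeff n (a * b) : ℤ) : ℝ) * t ^ n := by
  rw [coeff_mul, Int.cast_sum, Finset.sum_mul]
  refine Finset.sum_congr rfl fun p hp => ?_
  rw [← Finset.HasAntidiagonal.mem_antidiagonal.1 hp, pow_add, Int.cast_mul]
  ring

lemma AbsConv.mul {t : ℝ} {a b : PowerSeries ℤ} (ha : AbsConv t a) (hb : AbsConv t b) :
    AbsConv t (a * b) := by
  have := summable_norm_sum_mul_antidiagonal_of_summable_norm ha hb
  simp only [coeff_mul_realEval] at this
  exact this

lemma realEval_mul {t : ℝ} {a b : PowerSeries ℤ} (ha : AbsConv t a) (hb : AbsConv t b) :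
    realEval t (a * b) = realEval t a * realEval t b := by
  have := tsum_mul_tsum_eq_tsum_sum_antidiagonal_of_summable_norm ha hb
  simp only [coeff_mul_realEval] at this
  exact this.symm

lemma absConv_coe (t : ℝ) (p : Polynomial ℤ) : AbsConv t p := by
  refine summable_of_ne_finset_zero (s := Finset.range (p.natDegree + 1)) fun j hj => ?_
  rw [Polynomial.coeff_coe, Polynomial.coeff_eq_zero_of_natDegree_lt
    (by simpa [Nat.lt_succ_iff] using hj)]
  simp

lemma realEval_coe (t : ℝ) (p : Polynomial ℤ) :
    realEval t p = p.eval₂ (Int.castRingHom ℝ) t := by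
  rw [Polynomial.eval₂_eq_sum_range, realEval,
    tsum_eq_sum (s := Finset.range (p.natDegree + 1)) fun j hj => ?_]
  · simp [Polynomial.coeff_coe]
  · rw [Polynomial.coeff_coe, Polynomial.coeff_eq_zero_of_natDegree_lt
      (by simpa [Nat.lt_succ_iff] using hj)]
    simp

/-- The inverse of `1 - X ^ d` is a geometric series, absolutely convergent at `t`, and products of
absolutely convergent series converge absolutely. -/
lemma AbsConv.of_one_sub_mul {t : ℝ} (ht : 0 < t) (ht' : t < 1) {d : ℕ} (hd : 0 < d)
    {a : PowerSeries ℤ} (h : AbsConv t (a * (1 - X ^ d))) : AbsConv t a := by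
  let b : PowerSeries ℤ := mk fun j => if d ∣ j then 1 else 0
  have hb : (1 - X ^ d) * b = 1 := by
    ext j
    rw [sub_mul, one_mul, map_sub, coeff_X_pow_mul', coeff_mk, coeff_one]
    by_cases hj : d ≤ j
    · obtain ⟨j, rfl⟩ := Nat.exists_eq_add_of_le' hj
      have h0 : ¬ j + d = 0 := by omega
      rw [if_pos hj, coeff_mk, Nat.add_sub_cancel, if_neg h0]
      simp
    · rw [if_neg hj]
      by_cases h0 : j = 0
      · simp [h0]
      · have : ¬ d ∣ j := fun hdj => hj (Nat.le_of_dvd (Nat.pos_of_ne_zero h0) hdj)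
        simp [h0, this]
  have hb' : AbsConv t b := by
    refine Summable.of_nonneg_of_le (fun _ => norm_nonneg _) (fun j => ?_)
      (summable_geometric_of_lt_one ht.le ht')
    rw [coeff_mk, norm_mul, Real.norm_of_nonneg (pow_nonneg ht.le j)]
    refine mul_le_of_le_one_left (pow_nonneg ht.le j) ?_
    split_ifs <;> simp
  have := h.mul hb'
  rwa [mul_assoc, hb, mul_one] at this

lemma AbsConv.of_prod_mul {t : ℝ} (ht : 0 < t) (ht' : t < 1) (l : List ℕ) (hl : ∀ d ∈ l, 0 < d)
    {a : PowerSeries ℤ} (h : AbsConv t (a * (l.map fun d => 1 - (X : PowerSeries ℤ) ^ d).prod)) :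
    AbsConv t a := by
  induction l generalizing a with
  | nil => simpa using h
  | cons d l ih =>
    rw [List.map_cons, List.prod_cons, ← mul_assoc] at h
    exact (ih (fun e he => hl e (List.mem_cons_of_mem _ he)) h).of_one_sub_mul ht ht'
      (hl d List.mem_cons_self)

lemma exists_polynomial_prod (l : List ℕ) (hl : ∀ d ∈ l, 0 < d) :
    ∃ D : Polynomial ℤ, (D : PowerSeries ℤ) = (l.map fun d => 1 - (X : PowerSeries ℤ) ^ d).prod ∧
      ∀ t : ℝ, 0 < t → t < 1 → 0 < D.eval₂ (Int.castRingHom ℝ) t := by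
  induction l with
  | nil => exact ⟨1, by simp⟩
  | cons d l ih =>
    obtain ⟨D, h1, h2⟩ := ih fun e he => hl e (List.mem_cons_of_mem _ he)
    refine ⟨(1 - Polynomial.X ^ d) * D, ?_, fun t ht ht' => ?_⟩
    · rw [List.map_cons, List.prod_cons, ← h1]
      simp
    · rw [Polynomial.eval₂_mul]
      refine mul_pos ?_ (h2 t ht ht')
      simpa using pow_lt_one₀ ht.le ht' (hl d List.mem_cons_self).ne'

lemma realEval_mono {t : ℝ} (ht : 0 ≤ t) {a b : PowerSeries ℤ} (ha : AbsConv t a) (hb : AbsConv t b)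
    (h : ∀ j, coeff j a ≤ coeff j b) : realEval t a ≤ realEval t b :=
  Summable.tsum_le_tsum (fun j => mul_le_mul_of_nonneg_right (Int.cast_le.2 (h j))
    (pow_nonneg ht j)) ha.of_norm hb.of_norm

open Filter Topology RatFunc in
/-- A quotient of two power series of Hilbert type is rational, and its value at `1` can be read off
from coefficientwise estimates. -/
theorem exists_ratFunc_of_le {μ A B : PowerSeries ℤ} {c : ℕ} (hc : 0 < c)
    (h : (c : PowerSeries ℤ) * μ * A = B) {l : List ℕ} (hl : ∀ d ∈ l, 0 < d)
    {pA pB : Polynomial ℤ} (hA : A * (l.map fun d => 1 - (X : PowerSeries ℤ) ^ d).prod = pA)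
    (hB : B * (l.map fun d => 1 - (X : PowerSeries ℤ) ^ d).prod = pB)
    (hA0 : ∀ j, 0 ≤ coeff j A) (hA1 : 0 < coeff 0 A) {ι : Type*} [Fintype ι] (a : ι → ℕ) (d : ℕ)
    (h1 : ∀ j, coeff j ((∑ i, X ^ a i) * A) ≤ coeff j B)
    (h2 : ∀ j, coeff j (X ^ d * B) ≤ coeff j ((∑ i, X ^ a i) * A)) :
    ∃ f : RatFunc ℚ, ((mk fun j => ((coeff j μ : ℤ) : ℚ) : PowerSeries ℚ) : LaurentSeries ℚ) =
        (f : LaurentSeries ℚ) ∧ f.denom.eval 1 ≠ 0 ∧ f.eval (RingHom.id ℚ) 1 = Fintype.card ι / c := by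
  obtain ⟨D, hD, hDpos⟩ := exists_polynomial_prod l hl
  set r := Fintype.card ι with hr
  rw [← hD] at hA hB
  let S : Polynomial ℤ := ∑ i, Polynomial.X ^ a i
  have hS : (∑ i, X ^ a i : PowerSeries ℤ) = S := by
    change _ = Polynomial.coeToPowerSeries.ringHom S
    simp [S, map_sum]
  have hXd : (X ^ d : PowerSeries ℤ) = (Polynomial.X ^ d : Polynomial ℤ) := by simp
  -- `α` and `β` are the values of `A` and `B` at `t`. Coefficientwise estimates persist because `t`
  -- is positive.
  have key (t : ℝ) (ht : 0 < t) (ht' : t < 1) : ∃ α β : ℝ, 0 < α ∧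
      α * D.eval₂ (Int.castRingHom ℝ) t = pA.eval₂ (Int.castRingHom ℝ) t ∧
      β * D.eval₂ (Int.castRingHom ℝ) t = pB.eval₂ (Int.castRingHom ℝ) t ∧
      S.eval₂ (Int.castRingHom ℝ) t * α ≤ β ∧ t ^ d * β ≤ S.eval₂ (Int.castRingHom ℝ) t * α := by
    have cA : AbsConv t A := AbsConv.of_prod_mul ht ht' l hl (by rw [← hD, hA]; exact absConv_coe t _)
    have cB : AbsConv t B := AbsConv.of_prod_mul ht ht' l hl (by rw [← hD, hB]; exact absConv_coe t _)
    refine ⟨realEval t A, realEval t B, ?_, ?_, ?_, ?_, ?_⟩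
    · refine cA.of_norm.tsum_pos (fun j => mul_nonneg (Int.cast_nonneg (hA0 j)) (pow_nonneg ht.le j)) 0 ?_
      simpa using hA1
    · rw [← realEval_coe, ← realEval_mul cA (absConv_coe t D), hA, realEval_coe]
    · rw [← realEval_coe, ← realEval_mul cB (absConv_coe t D), hB, realEval_coe]
    · rw [← realEval_coe, ← realEval_mul (absConv_coe t S) cA]
      exact realEval_mono ht.le ((absConv_coe t S).mul cA) cB (by rwa [hS] at h1)
    · have : t ^ d = (Polynomial.X ^ d : Polynomial ℤ).eval₂ (Int.castRingHom ℝ) t := by simp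
      rw [this, ← realEval_coe, ← realEval_coe, ← realEval_mul (absConv_coe t S) cA,
        ← realEval_mul (absConv_coe t _) cB]
      exact realEval_mono ht.le ((absConv_coe t _).mul cB) ((absConv_coe t S).mul cA)
        (by rwa [hS, hXd] at h2)
  have hpA : pA ≠ 0 := by
    rintro rfl
    obtain ⟨α, β, hα, h1, -⟩ := key (1 / 2) (by norm_num) (by norm_num)
    rw [Polynomial.eval₂_zero] at h1
    exact (mul_pos hα (hDpos _ (by norm_num) (by norm_num))).ne' h1
  let P : Polynomial ℚ := pB.map (Int.castRingHom ℚ)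
  -- `A` and `B` have the common denominator `D`, so `μ = B / (c A) = pB / (c pA)`.
  let q : Polynomial ℚ := Polynomial.C (c : ℚ) * pA.map (Int.castRingHom ℚ)
  have hc' : (c : ℚ) ≠ 0 := by exact_mod_cast hc.ne'
  have hq : q ≠ 0 := mul_ne_zero (Polynomial.C_ne_zero.2 hc')
    ((Polynomial.map_ne_zero_iff (RingHom.injective_int (Int.castRingHom ℚ))).2 hpA)
  let f : RatFunc ℚ := algebraMap _ _ P / algebraMap _ _ q
  have hmul : (mk fun j => ((coeff j μ : ℤ) : ℚ) : PowerSeries ℚ) * (q : PowerSeries ℚ) = P := by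
    have e1 : (mk fun j => ((coeff j μ : ℤ) : ℚ) : PowerSeries ℚ) = map (Int.castRingHom ℚ) μ := by
      ext j; simp
    have e2 (p : Polynomial ℤ) : ((p.map (Int.castRingHom ℚ) : Polynomial ℚ) : PowerSeries ℚ) =
        map (Int.castRingHom ℚ) p := by
      ext j; simp
    have e3 : ((q : Polynomial ℚ) : PowerSeries ℚ) =
        map (Int.castRingHom ℚ) ((c : PowerSeries ℤ) * pA) := by
      rw [map_mul, ← e2, Polynomial.coe_mul, Polynomial.coe_C]
      simp
    rw [e1, e2, e3, ← map_mul, ← hA, ← hB, ← h]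
    congr 1
    ring
  have hcop := f.isCoprime_num_denom
  have hnd : f.num * q = P * f.denom := (RatFunc.num_mul_eq_mul_denom_iff hq).2 rfl
  have hev (p : Polynomial ℚ) : Continuous fun t : ℝ => p.eval₂ (algebraMap ℚ ℝ) t := by
    simp only [Polynomial.eval₂_eq_eval_map]
    exact Polynomial.continuous _
  -- For `t` tending to `1` from below, `β / (c α)` is squeezed between `S(t) / c` and `S(t) / (t^d
  -- c)`, where `S(1) = r`. The identity is written without dividing by the denominator at `1`,
  -- which is not yet known to be nonzero.
  have hlim : f.num.eval₂ (algebraMap ℚ ℝ) 1 = f.denom.eval₂ (algebraMap ℚ ℝ) 1 * (r / c) := by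
    have hcR : (0 : ℝ) < c := by exact_mod_cast hc
    choose! α β hα e1 e2 e3 e4 using key
    have hmem : ∀ᶠ t : ℝ in 𝓝[<] 1, 0 < t ∧ t < 1 :=
      (Ioo_mem_nhdsLT (zero_lt_one' ℝ))
    have hρ : Tendsto (fun t => β t / (c * α t)) (𝓝[<] 1) (𝓝 (r / c)) := by
      have hS1 : Tendsto (fun t : ℝ => S.eval₂ (Int.castRingHom ℝ) t) (𝓝[<] 1) (𝓝 r) := by
        have : Continuous fun t : ℝ => S.eval₂ (Int.castRingHom ℝ) t := by
          simp only [Polynomial.eval₂_eq_eval_map]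
          exact Polynomial.continuous _
        have h := (this.tendsto 1).mono_left (nhdsWithin_le_nhds (s := Set.Iio 1))
        have h1 : S.eval₂ (Int.castRingHom ℝ) 1 = r := by
          simp [S, Polynomial.eval₂_finsetSum, hr]
        rwa [h1] at h
      have hd1 : Tendsto (fun t : ℝ => t ^ d) (𝓝[<] 1) (𝓝 1) := by
        have h := ((continuous_pow d).tendsto (1 : ℝ)).mono_left (nhdsWithin_le_nhds (s := Set.Iio 1))
        rwa [one_pow] at h
      refine tendsto_of_tendsto_of_tendsto_of_le_of_le' (hS1.div_const (c : ℝ))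
        (h := fun t => S.eval₂ (Int.castRingHom ℝ) t / t ^ d / c) ?_ ?_ ?_
      · have := (hS1.div hd1 one_ne_zero).div_const (c : ℝ)
        rwa [div_one] at this
      · filter_upwards [hmem] with t ht
        have := hα t ht.1 ht.2
        rw [div_le_div_iff₀ hcR (mul_pos hcR this)]
        nlinarith [e3 t ht.1 ht.2]
      · filter_upwards [hmem] with t ht
        have := hα t ht.1 ht.2
        have h3 := pow_pos ht.1 d
        rw [div_div, div_le_div_iff₀ (mul_pos hcR this) (mul_pos h3 hcR)]
        nlinarith [e4 t ht.1 ht.2]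
    have hnum : Tendsto (fun t : ℝ => f.num.eval₂ (algebraMap ℚ ℝ) t) (𝓝[<] 1)
        (𝓝 (f.num.eval₂ (algebraMap ℚ ℝ) 1)) :=
      ((hev f.num).tendsto 1).mono_left nhdsWithin_le_nhds
    have hden : Tendsto (fun t : ℝ => f.denom.eval₂ (algebraMap ℚ ℝ) t) (𝓝[<] 1)
        (𝓝 (f.denom.eval₂ (algebraMap ℚ ℝ) 1)) :=
      ((hev f.denom).tendsto 1).mono_left nhdsWithin_le_nhds
    refine tendsto_nhds_unique hnum ((hden.mul hρ).congr' ?_)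
    filter_upwards [hmem] with t ht
    have h3 := congrArg (Polynomial.eval₂ (algebraMap ℚ ℝ) t) hnd
    have e5 (p : Polynomial ℤ) : (p.map (Int.castRingHom ℚ)).eval₂ (algebraMap ℚ ℝ) t =
        p.eval₂ (Int.castRingHom ℝ) t := by
      rw [Polynomial.eval₂_map]
      congr 1
    rw [Polynomial.eval₂_mul, Polynomial.eval₂_mul, Polynomial.eval₂_mul, Polynomial.eval₂_C, e5, e5,
      ← e1 t ht.1 ht.2, ← e2 t ht.1 ht.2] at h3
    have h4 := hα t ht.1 ht.2
    have h5 := hDpos t ht.1 ht.2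
    have h6 : algebraMap ℚ ℝ c = c := by simp
    rw [h6] at h3
    rw [mul_div_assoc', div_eq_iff (mul_pos hcR h4).ne']
    refine mul_right_cancel₀ h5.ne' ?_
    linarith
  have hlim' : f.num.eval 1 = f.denom.eval 1 * (r / c) := by
    have e (p : Polynomial ℚ) : p.eval₂ (algebraMap ℚ ℝ) 1 = ((p.eval 1 : ℚ) : ℝ) := by
      rw [← map_one (algebraMap ℚ ℝ), Polynomial.eval₂_at_apply]
      rfl
    rw [e, e] at hlim
    apply Rat.cast_injective (α := ℝ)
    rw [hlim]
    push_cast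
    rfl
  -- If the reduced denominator vanished at `1`, so would the numerator, against coprimality.
  have hden : f.denom.eval 1 ≠ 0 := by
    intro h0
    obtain ⟨u, v, huv⟩ := hcop
    have := congrArg (Polynomial.eval 1) huv
    rw [Polynomial.eval_add, Polynomial.eval_mul, Polynomial.eval_mul, hlim', h0] at this
    simp at this
  refine ⟨f, ?_, hden, ?_⟩
  · have hq' : algebraMap (RatFunc ℚ) (LaurentSeries ℚ) (algebraMap _ _ q) ≠ 0 := by
      rw [Ne, _root_.map_eq_zero, map_eq_zero_iff _ (RatFunc.algebraMap_injective ℚ)]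
      exact hq
    have h7 := congrArg (HahnSeries.ofPowerSeries ℤ ℚ) hmul
    rw [map_mul] at h7
    have e8 (p : Polynomial ℚ) : HahnSeries.ofPowerSeries ℤ ℚ (p : PowerSeries ℚ) =
      algebraMap (RatFunc ℚ) (LaurentSeries ℚ) (algebraMap _ _ p) := RatFunc.coe_coe p
    rw [e8, e8] at h7
    rw [map_div₀]
    exact (eq_div_iff hq').2 h7
  · rw [RatFunc.eval, Polynomial.eval₂_id, Polynomial.eval₂_id, hlim', mul_div_cancel_left₀ _ hden]

end PowerSeries

/-! ### Comparing a torsion-free graded module with free modules of the same rank -/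

namespace BarComplex

section Sandwich
variable {k : Type u} [Field k] {R : Type u} [CommRing R] [Algebra k R] {I : Ideal R}
  {𝒜 : ℕ → Submodule k R} (hR : ConnectedGrading I 𝒜)
  {N : Type u} [AddCommGroup N] [Module k N] [Module R N] [IsScalarTower k R N]
  {𝒩 : ℕ → Submodule k N} (g : Grading 𝒩)

include hR g in
lemma exists_homogeneous_generators_module (hs : IsGradedSMul 𝒜 𝒩) [Module.Finite R N] :
    ∃ (q : ℕ) (m : Fin q → N) (a : Fin q → ℕ), (∀ i, m i ∈ 𝒩 (a i)) ∧
      Submodule.span R (Set.range m) = ⊤ := by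
  have := finite_tor_zero hR (N := N)
  obtain ⟨n, a, hn, -, hsp⟩ := exists_homogeneous_basis_tor_zero (I := I) g
  exact ⟨_, n, a, hn, span_eq_top_of_toTorZero hR g hs n a hn hsp⟩

/-- The linear combinations of degree `j` of homogeneous elements `n i` of degrees `a i`. -/
noncomputable def degreeCombination (𝒜 : ℕ → Submodule k R) {ι : Type*} [Fintype ι] (n : ι → N)
    (a : ι → ℕ) (j : ℕ) :
    ((i : ι) → (if a i ≤ j then 𝒜 (j - a i) else ⊥ : Submodule k R)) →ₗ[k] N :=
  (Fintype.linearCombination R n).restrictScalars k ∘ₗ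
    LinearMap.pi fun i => Submodule.subtype _ ∘ₗ LinearMap.proj i

lemma finite_shift_degree [∀ j, Module.Finite k (𝒜 j)] (a j : ℕ) :
    Module.Finite k (if a ≤ j then 𝒜 (j - a) else ⊥ : Submodule k R) := by
  by_cases h : a ≤ j
  · rw [if_pos h]; infer_instance
  · rw [if_neg h]; infer_instance

lemma finrank_degreeCombination [∀ j, Module.Finite k (𝒜 j)] {ι : Type*} [Fintype ι] {n : ι → N}
    (hn : LinearIndependent R n) (a : ι → ℕ) (j : ℕ) :
    (Module.finrank k (LinearMap.range (degreeCombination 𝒜 n a j)) : ℤ) =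
      PowerSeries.coeff j ((∑ i, PowerSeries.X ^ a i) * hilbertSeries 𝒜) := by
  have hinj : Function.Injective (degreeCombination 𝒜 n a j) := by
    have h1 : Function.Injective (Fintype.linearCombination R n) :=
      hn.fintypeLinearCombination_injective
    intro x y hxy
    have := h1 hxy
    funext i
    exact Subtype.ext (congrFun this i)
  have := fun i => finite_shift_degree (𝒜 := 𝒜) (a i) j
  rw [LinearMap.finrank_range_of_inj hinj, Module.finrank_pi_fintype, Finset.sum_mul, map_sum,
    Nat.cast_sum]
  refine Finset.sum_congr rfl fun i _ => ?_
  rw [PowerSeries.coeff_X_pow_mul']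
  by_cases h : a i ≤ j
  · rw [if_pos h, if_pos h, coeff_hilbertSeries]
  · rw [if_neg h, if_neg h, finrank_bot, Nat.cast_zero]

include hR g in
/-- A torsion-free graded module lies between two graded free modules of the same rank. -/
theorem exists_hilbertSeries_le [IsDomain R] [∀ j, Module.Finite k (𝒜 j)]
    [∀ j, Module.Finite k (𝒩 j)] (hs : IsGradedSMul 𝒜 𝒩) [Module.Finite R N]
    [Module.IsTorsionFree R N] :
    ∃ (ι : Type) (_ : Fintype ι) (a : ι → ℕ) (d : ℕ), Fintype.card ι = Module.finrank R N ∧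
      (∀ j, PowerSeries.coeff j ((∑ i, PowerSeries.X ^ a i) * hilbertSeries 𝒜) ≤
        PowerSeries.coeff j (hilbertSeries 𝒩)) ∧
      ∀ j, PowerSeries.coeff j (PowerSeries.X ^ d * hilbertSeries 𝒩) ≤
        PowerSeries.coeff j ((∑ i, PowerSeries.X ^ a i) * hilbertSeries 𝒜) := by
  classical
  obtain ⟨q, m, a, hm, hsp⟩ := exists_homogeneous_generators_module hR g hs
  -- A maximal independent set of homogeneous generators spans the free submodule from which both
  -- estimates come.
  obtain ⟨s, hs1, hs2⟩ := exists_maximal_linearIndepOn R m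
  have hli : LinearIndependent R fun i : s => m i := hs1
  have hspan : Submodule.span R (Set.range fun i : s => m i) =
      LinearMap.range (Fintype.linearCombination R fun i : s => m i) :=
    (Fintype.range_linearCombination R _).symm
  have hb (i : Fin q) : ∃ b : R, ∃ e : ℕ, b ≠ 0 ∧ b ∈ 𝒜 e ∧
      b • m i ∈ Submodule.span R (Set.range fun i : s => m i) := by
    by_cases hi : i ∈ s
    · exact ⟨1, 0, one_ne_zero, hR.one_mem, by
        rw [one_smul]; exact Submodule.subset_span ⟨⟨i, hi⟩, rfl⟩⟩
    · obtain ⟨b, hb, hb'⟩ := hs2 i hi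
      -- The multiplier can be made homogeneous: take a nonzero component of `b` and the matching
      -- component of the linear combination.
      obtain ⟨e, he⟩ : ∃ e, hR.proj e b ≠ 0 := by
        by_contra! h
        exact hb (hR.ext fun j => by rw [h, map_zero])
      refine ⟨hR.proj e b, e, he, hR.proj_mem e b, ?_⟩
      rw [Set.image_eq_range] at hb'
      rw [hspan] at hb' ⊢
      obtain ⟨y, hy⟩ := hb'
      refine ⟨(Grading.pi fun i : s => hR.shift (a i)).proj (e + a i) y, ?_⟩
      rw [linearCombination_proj hR g hs (fun i : s => m i) (fun i : s => a i) (fun i => hm i), hy]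
      exact (hR.map_proj g ((LinearMap.toSpanSingleton R N (m i)).restrictScalars k) (a i)
        (fun j r hr => by rw [add_comm]; exact hs hr (hm i)) e b).symm
  choose b e hb0 hbe hbm using hb
  -- One homogeneous element carries all generators, hence all of `N`, into the free submodule; its
  -- degree is the shift `d`.
  let β := ∏ i, b i
  have hβ0 : β ≠ 0 := Finset.prod_ne_zero_iff.2 fun i _ => hb0 i
  have hβ : β ∈ 𝒜 (∑ i, e i) := by
    have (t : Finset (Fin q)) : ∏ i ∈ t, b i ∈ 𝒜 (∑ i ∈ t, e i) := by
      induction t using Finset.induction_on with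
      | empty => simpa using hR.one_mem
      | insert i t hi ih =>
        rw [Finset.prod_insert hi, Finset.sum_insert hi]
        exact hR.mul_mem (hbe i) ih
    exact this Finset.univ
  have hβm (x : N) : β • x ∈ Submodule.span R (Set.range fun i : s => m i) := by
    have hx : x ∈ Submodule.span R (Set.range m) := hsp ▸ trivial
    induction hx using Submodule.span_induction with
    | mem x hx =>
      obtain ⟨i, rfl⟩ := hx
      rw [show β = (∏ j ∈ Finset.univ.erase i, b j) * b i from
        (Finset.prod_erase_mul _ _ (Finset.mem_univ i)).symm, mul_smul]
      exact Submodule.smul_mem _ _ (hbm i)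
    | zero => rw [smul_zero]; exact zero_mem _
    | add x y _ _ hx hy => rw [smul_add]; exact add_mem hx hy
    | smul r x _ hx => rw [smul_comm]; exact Submodule.smul_mem _ _ hx
  refine ⟨s, inferInstance, fun i => a i, ∑ i, e i, ?_, fun j => ?_, fun j => ?_⟩
  · rw [← Submodule.finrank_quotient_add_finrank
      (Submodule.span R (Set.range fun i : s => m i)), finrank_span_eq_card hli,
      Module.finrank_eq_zero_iff.2, zero_add]
    intro x
    obtain ⟨x, rfl⟩ := Submodule.Quotient.mk_surjective _ x
    exact ⟨β, hβ0, by rw [← Submodule.Quotient.mk_smul, Submodule.Quotient.mk_eq_zero]; exact hβm x⟩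
  · rw [← finrank_degreeCombination hli, coeff_hilbertSeries, Nat.cast_le]
    refine Submodule.finrank_mono ?_
    rintro _ ⟨x, rfl⟩
    exact linearCombination_mem hs _ _ (fun i : s => hm i) j _ fun i => (x i).2
  · rw [PowerSeries.coeff_X_pow_mul']
    split_ifs with hj
    · obtain ⟨j, rfl⟩ := Nat.exists_eq_add_of_le' hj
      rw [← finrank_degreeCombination hli, Nat.add_sub_cancel, coeff_hilbertSeries, Nat.cast_le]
      let φ : N →ₗ[k] N := (LinearMap.lsmul R N β).restrictScalars k
      -- Torsion-freeness makes multiplication by `β` an embedding of the component of degree `j`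
      -- into the free submodule, in degree `j + ∑ e i`.
      have hφ : Function.Injective φ := smul_right_injective N hβ0
      rw [(Submodule.equivMapOfInjective φ hφ (𝒩 j)).finrank_eq]
      have := fun i : s => finite_shift_degree (𝒜 := 𝒜) (a i) (j + ∑ i, e i)
      refine Submodule.finrank_mono ?_
      rintro _ ⟨x, hx, rfl⟩
      have h1 := hβm x
      rw [hspan] at h1
      obtain ⟨y, hy⟩ := h1
      have h2 : φ x ∈ 𝒩 (j + ∑ i, e i) := hs hβ hx
      let z := (Grading.pi fun i : s => hR.shift (a i)).proj (j + ∑ i, e i) y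
      have hz := (Grading.pi fun i : s => hR.shift (a i)).proj_mem (j + ∑ i, e i) y
      refine ⟨fun i => ⟨z i, hz i trivial⟩, ?_⟩
      have h3 := linearCombination_proj hR g hs (fun i : s => m i) (fun i : s => a i) (fun i => hm i)
        (j + ∑ i, e i) y
      rw [hy] at h3
      exact h3.trans (g.proj_same h2)
    · rw [← finrank_degreeCombination hli]
      exact Nat.cast_nonneg _

include hR g in
/-- The Euler characteristic series of `Tor` is a rational function whose value at `1` is the rank. -/
theorem exists_ratFunc_tor [IsDomain R] [IsNoetherianRing R] [∀ j, Module.Finite k (𝒜 j)]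
    [∀ j, Module.Finite k (𝒩 j)] (hs : IsGradedSMul 𝒜 𝒩) [Module.Finite R N]
    [Module.IsTorsionFree R N] {c : ℕ} (hc : 0 < c) (μ : ℕ → ℤ)
    (hμ : ∀ j, c * μ j = ∑ᶠ i, (-1 : ℤ) ^ i * Module.finrank k (torDegree I 𝒜 𝒩 i j)) :
    ∃ f : RatFunc ℚ, ((PowerSeries.mk fun j => (μ j : ℚ) : PowerSeries ℚ) : LaurentSeries ℚ) =
      (f : LaurentSeries ℚ) ∧ f.denom.eval 1 ≠ 0 ∧
      f.eval (RingHom.id ℚ) 1 = Module.finrank R N / c := by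
  obtain ⟨l, hl, H⟩ := hilbert_serre hR
  obtain ⟨pA, hA⟩ := H (N := R) hR.toGrading (fun ha hx => by rw [add_comm]; exact hR.mul_mem ha hx)
  obtain ⟨pB, hB⟩ := H g hs
  obtain ⟨ι, _, a, d, hcard, h1, h2⟩ := exists_hilbertSeries_le hR g hs
  have hmul : (c : PowerSeries ℤ) * PowerSeries.mk μ * hilbertSeries 𝒜 = hilbertSeries 𝒩 := by
    rw [← hilbertSeries_tor_mul hR g hs]
    congr 1
    ext j
    rw [PowerSeries.coeff_mk, ← hμ, ← nsmul_eq_mul, map_nsmul, PowerSeries.coeff_mk, nsmul_eq_mul]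
  have hA1 : 0 < PowerSeries.coeff 0 (hilbertSeries 𝒜) := by
    rw [coeff_hilbertSeries, Nat.cast_pos, Module.finrank_pos_iff]
    exact ⟨⟨1, hR.one_mem⟩, 0, fun h => one_ne_zero (congrArg Subtype.val h)⟩
  have := PowerSeries.exists_ratFunc_of_le hc hmul hl hA hB
    (fun j => by rw [coeff_hilbertSeries]; exact Nat.cast_nonneg _) hA1 a d h1 h2
  rw [hcard] at this
  simpa only [PowerSeries.coeff_mk] using this

end Sandwich
end BarComplex

/-! ### The polynomial algebra and its invariants -/

namespace RelativeInvariants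

section Poly
variable {k V : Type u} [Field k] [AddCommGroup V] [Module k V]

instance : IsDomain (Poly k V) :=
  inferInstanceAs (IsDomain (SymmetricAlgebra k (Module.Dual k V)))

instance [FiniteDimensional k V] : Algebra.FiniteType k (Poly k V) :=
  Algebra.FiniteType.equiv (inferInstanceAs (Algebra.FiniteType k (MvPolynomial _ k)))
    (SymmetricAlgebra.equivMvPolynomial (Module.finBasis k (Module.Dual k V))).symm

lemma poly_induction {p : Poly k V → Prop} (h1 : ∀ c, p (algebraMap k _ c))
    (h2 : ∀ f, p (linearForm k V f)) (h3 : ∀ x y, p x → p y → p (x * y))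
    (h4 : ∀ x y, p x → p y → p (x + y)) (x : Poly k V) : p x :=
  SymmetricAlgebra.induction (R := k) (M := Module.Dual k V) (motive := p) h1 h2 h3 h4 x

/-- The algebra map to the trivial square-zero extension of `k` by the dual space recovers a linear
form. -/
lemma linearForm_injective : Function.Injective (linearForm k V) := by
  let F : Poly k V →ₐ[k] TrivSqZeroExt k (Module.Dual k V) :=
    SymmetricAlgebra.lift (TrivSqZeroExt.inrHom k (Module.Dual k V))
  have hF (f : Module.Dual k V) : F (linearForm k V f) = TrivSqZeroExt.inr f :=
    SymmetricAlgebra.lift_ι_apply (TrivSqZeroExt.inrHom k (Module.Dual k V)) f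
  intro f f' h
  exact TrivSqZeroExt.inr_injective (by rw [← hF, h, hF])

/-- The algebra map `k[V] → k[V][X]` that multiplies linear forms by `X`. -/
noncomputable def coaction (k V : Type u) [Field k] [AddCommGroup V] [Module k V] :
    Poly k V →ₐ[k] Polynomial (Poly k V) :=
  SymmetricAlgebra.lift ((LinearMap.mulRight k (Polynomial.X : Polynomial (Poly k V))) ∘ₗ
    (Polynomial.CAlgHom (R := k)).toLinearMap ∘ₗ linearForm k V)

lemma coaction_linearForm (f : Module.Dual k V) :
    coaction k V (linearForm k V f) = Polynomial.monomial 1 (linearForm k V f) := by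
  refine (SymmetricAlgebra.lift_ι_apply _ f).trans ?_
  rw [← Polynomial.C_mul_X_eq_monomial]
  rfl

/-- The coaction records the degree as the exponent of `X`, so its coefficients serve as the
projections of the grading. -/
lemma coaction_of_mem {d : ℕ} {p : Poly k V} (hp : p ∈ polyDegree k V d) :
    coaction k V p = Polynomial.monomial d p := by
  refine Submodule.pow_induction_on_left' (M := LinearMap.range (linearForm k V))
    (C := fun d p _ => coaction k V p = Polynomial.monomial d p) ?_ ?_ ?_ hp
  · intro c
    rw [AlgHom.commutes]
    rfl
  · intro x y i _ _ hx hy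
    rw [map_add, map_add, hx, hy]
  · rintro _ ⟨f, rfl⟩ i x _ hx
    rw [map_mul, coaction_linearForm, hx, Polynomial.monomial_mul_monomial, add_comm]

lemma one_mem_polyDegree : (1 : Poly k V) ∈ polyDegree k V 0 := by
  rw [polyDegree, pow_zero]
  exact Submodule.one_le.1 le_rfl

lemma mul_mem_polyDegree {i j : ℕ} {p q : Poly k V} (hp : p ∈ polyDegree k V i)
    (hq : q ∈ polyDegree k V j) : p * q ∈ polyDegree k V (i + j) := by
  rw [polyDegree, pow_add]
  exact Submodule.mul_mem_mul hp hq

lemma exists_algebraMap_of_mem_polyDegree_zero {p : Poly k V} (hp : p ∈ polyDegree k V 0) :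
    ∃ c, algebraMap k _ c = p := by
  rw [polyDegree, pow_zero] at hp
  exact Submodule.mem_one.1 hp

lemma iSup_polyDegree : ⨆ d, polyDegree k V d = ⊤ := by
  rw [eq_top_iff]
  rintro p -
  induction p using poly_induction with
  | h1 c =>
    rw [Algebra.algebraMap_eq_smul_one]
    exact Submodule.smul_mem _ _ (Submodule.mem_iSup_of_mem 0 one_mem_polyDegree)
  | h2 f =>
    refine Submodule.mem_iSup_of_mem 1 ?_
    rw [polyDegree, pow_one]
    exact ⟨f, rfl⟩
  | h3 x y hx hy =>
    suffices h : (⨆ d, polyDegree k V d) * (⨆ d, polyDegree k V d) ≤ ⨆ d, polyDegree k V d from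
      h (Submodule.mul_mem_mul hx hy)
    rw [Submodule.iSup_mul]
    refine iSup_le fun i => ?_
    rw [Submodule.mul_iSup]
    refine iSup_le fun j => le_iSup_of_le (i + j) ?_
    rw [polyDegree, polyDegree, ← pow_add]
    exact le_rfl
  | h4 x y hx hy => exact Submodule.add_mem _ hx hy

variable (k V) in
/-- The grading of `k[V]`. -/
noncomputable def polyGrading : Grading (polyDegree k V) where
  proj j := (Polynomial.lcoeff (Poly k V) j).restrictScalars k ∘ₗ (coaction k V).toLinearMap
  proj_mem j x := by
    have hx : x ∈ ⨆ d, polyDegree k V d := by rw [iSup_polyDegree]; trivial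
    induction hx using Submodule.iSup_induction' with
    | mem d x hx =>
      change (coaction k V x).coeff j ∈ _
      rw [coaction_of_mem hx, Polynomial.coeff_monomial]
      split_ifs with h
      · exact h ▸ hx
      · exact zero_mem _
    | zero => rw [map_zero]; exact zero_mem _
    | add x y _ _ hx hy => rw [map_add]; exact add_mem hx hy
  proj_same {j x} hx := by
    change (coaction k V x).coeff j = x
    rw [coaction_of_mem hx, Polynomial.coeff_monomial, if_pos rfl]
  proj_ne {i j x} hx hij := by
    change (coaction k V x).coeff j = 0
    rw [coaction_of_mem hx, Polynomial.coeff_monomial, if_neg hij]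
  iSup_eq := iSup_polyDegree

instance finite_polyDegree [FiniteDimensional k V] (d : ℕ) : Module.Finite k (polyDegree k V d) := by
  have : (LinearMap.range (linearForm k V)).FG := by
    rw [LinearMap.range_eq_map]
    exact Submodule.FG.map _ Module.Finite.fg_top
  exact Module.Finite.iff_fg.2 (this.pow d)

lemma polyRep_mem_polyDegree (g : LinearMap.GeneralLinearGroup k V) (d : ℕ) :
    ∀ p ∈ polyDegree k V d, polyRep g p ∈ polyDegree k V d := by
  intro p hp
  have : p ∈ (polyDegree k V d).comap (polyRep g) := by
    refine Submodule.pow_induction_on_left' (M := LinearMap.range (linearForm k V))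
      (C := fun d p _ => p ∈ (polyDegree k V d).comap (polyRep g)) ?_ ?_ ?_ hp
    · intro c
      rw [Submodule.mem_comap, Algebra.algebraMap_eq_smul_one, map_smul, polyRep_one]
      exact Submodule.smul_mem _ _ one_mem_polyDegree
    · intro x y i _ _ hx hy
      exact add_mem hx hy
    · rintro _ ⟨f, rfl⟩ i x _ hx
      rw [Submodule.mem_comap, polyRep_mul, Nat.succ_eq_add_one, add_comm]
      refine mul_mem_polyDegree ?_ hx
      rw [polyDegree, pow_one]
      exact ⟨_, (polyMap_linearForm _ f).symm⟩
  exact this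

lemma polyRep_proj (g : LinearMap.GeneralLinearGroup k V) (j : ℕ) (p : Poly k V) :
    polyRep g ((polyGrading k V).proj j p) = (polyGrading k V).proj j (polyRep g p) :=
  (polyGrading k V).map_proj (polyGrading k V) (polyRep g) 0
    (fun d p hp => polyRep_mem_polyDegree g d p hp) j p

/-- An element of `GL(V)` is determined by its effect on linear forms, as these separate the points
of `V`. Faithfulness is what Dedekind's theorem and the normal basis theorem need. -/
lemma polyRep_injective : Function.Injective (polyRep (k := k) (V := V)) := by
  intro g h hgh
  have h1 : g⁻¹ = h⁻¹ := by
    refine Units.ext (LinearMap.ext fun v => ?_)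
    refine (Module.forall_dual_apply_eq_zero_iff k _).1 (fun f => ?_) |> sub_eq_zero.1
    have := LinearMap.congr_fun hgh (linearForm k V f)
    have e (a : LinearMap.GeneralLinearGroup k V) : polyRep a (linearForm k V f) =
      linearForm k V (f ∘ₗ ((a⁻¹ : LinearMap.GeneralLinearGroup k V) : V →ₗ[k] V)) :=
      polyMap_linearForm _ f
    rw [e, e] at this
    have := LinearMap.congr_fun (linearForm_injective this) v
    rw [map_sub]
    exact sub_eq_zero.2 this
  exact inv_injective h1

variable (G : Subgroup (LinearMap.GeneralLinearGroup k V))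

/-- The grading of the algebra of invariants. -/
noncomputable def invariantsGrading : Grading (invariantsDegree G) :=
  (polyGrading k V).comap (invariants G).val.toLinearMap Subtype.val_injective fun j x =>
    ⟨⟨(polyGrading k V).proj j x, fun g hg => by rw [polyRep_proj, x.2 g hg]⟩, rfl⟩

/-- The algebra of invariants is a connected graded algebra. -/
noncomputable def invariantsConnectedGrading :
    BarComplex.ConnectedGrading (invariantsPlus G) (invariantsDegree G) where
  toGrading := invariantsGrading G
  one_mem := one_mem_polyDegree
  mul_mem := mul_mem_polyDegree
  exists_algebraMap r hr := by
    obtain ⟨c, hc⟩ := exists_algebraMap_of_mem_polyDegree_zero hr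
    exact ⟨c, Subtype.ext hc⟩
  mem_ideal r := by
    constructor
    · intro hr
      induction hr using Submodule.span_induction with
      | mem x hx =>
        obtain ⟨d, hd, hx⟩ := hx
        exact (invariantsGrading G).proj_ne (i := d) hx hd.ne'
      | zero => exact map_zero _
      | add x y _ _ hx hy => rw [map_add, hx, hy, add_zero]
      | smul a x _ hx =>
        induction a using Grading.induction (invariantsGrading G) with
        | hom i a ha =>
          have h1 := (invariantsGrading G).map_proj (invariantsGrading G)
            (LinearMap.mulLeft k a) i (fun j y hy => by
              rw [add_comm]
              exact mul_mem_polyDegree ha hy)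
          by_cases hi : i = 0
          · subst hi
            have h2 : a * (invariantsGrading G).proj 0 x = (invariantsGrading G).proj 0 (a * x) :=
              h1 0 x
            rw [smul_eq_mul, ← h2, hx, mul_zero]
          · exact (invariantsGrading G).proj_map_of_lt (invariantsGrading G)
              (LinearMap.mulLeft k a) i (fun j y hy => by
                rw [add_comm]
                exact mul_mem_polyDegree ha hy) (Nat.pos_of_ne_zero hi) x
        | add a b ha hb => rw [add_smul, map_add, ha, hb, add_zero]
    · intro hr
      obtain ⟨n, -, hn⟩ := (invariantsGrading G).exists_sum_proj r
      rw [← hn]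
      refine Submodule.sum_mem _ fun j _ => ?_
      by_cases hj : j = 0
      · rw [hj, hr]; exact zero_mem _
      · exact Submodule.subset_span ⟨j, Nat.pos_of_ne_zero hj, (invariantsGrading G).proj_mem j r⟩

instance finite_invariantsDegree [FiniteDimensional k V] (d : ℕ) :
    Module.Finite k (invariantsDegree G d) :=
  Module.Finite.of_injective
    ((invariants G).val.toLinearMap.restrict (p := invariantsDegree G d) (q := polyDegree k V d)
      fun _ h => h)
    fun _ _ h => Subtype.ext (Subtype.ext (congrArg (fun x : polyDegree k V d => (x : Poly k V)) h))

/-- The action of `G` on `k[V]` by algebra automorphisms. -/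
noncomputable abbrev polyAction : MulSemiringAction G (Poly k V) where
  smul g p := polyRep (g : LinearMap.GeneralLinearGroup k V) p
  one_smul p := by
    change polyRep ((1 : G) : LinearMap.GeneralLinearGroup k V) p = p
    rw [OneMemClass.coe_one, map_one]; rfl
  mul_smul g h p := by
    change polyRep ((g * h : G) : LinearMap.GeneralLinearGroup k V) p = _
    rw [Subgroup.coe_mul, map_mul]; rfl
  smul_zero g := map_zero (polyRep (g : LinearMap.GeneralLinearGroup k V))
  smul_add g := map_add (polyRep (g : LinearMap.GeneralLinearGroup k V))
  smul_one g := polyRep_one _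
  smul_mul g := polyRep_mul _

/-- `k[V]` is integral over the invariants of a finite group, and of finite type. -/
instance finite_poly [FiniteDimensional k V] [Finite G] : Module.Finite (invariants G) (Poly k V) := by
  let := polyAction G
  have : SMulCommClass G (invariants G) (Poly k V) := ⟨fun g r p => by
    change polyRep (g : LinearMap.GeneralLinearGroup k V) ((r : Poly k V) * p) =
      (r : Poly k V) * polyRep (g : LinearMap.GeneralLinearGroup k V) p
    rw [polyRep_mul, r.2 g g.2]⟩
  have : Algebra.IsInvariant (invariants G) (Poly k V) G :=
    ⟨fun b hb => ⟨⟨b, fun g hg => hb ⟨g, hg⟩⟩, rfl⟩⟩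
  have := Algebra.IsInvariant.isIntegral (invariants G) (Poly k V) G
  have : Algebra.FiniteType (invariants G) (Poly k V) :=
    Algebra.FiniteType.of_restrictScalars_finiteType k _ _
  exact Algebra.IsIntegral.finite

/-- The algebra of invariants of a finite group is Noetherian. -/
instance [FiniteDimensional k V] [Finite G] : IsNoetherianRing (invariants G) := by
  -- The Artin–Tate lemma.
  have : Algebra.FiniteType k (invariants G) :=
    ⟨fg_of_fg_of_fg k (invariants G) (Poly k V) Algebra.FiniteType.out Module.Finite.fg_top
      Subtype.val_injective⟩
  exact Algebra.FiniteType.isNoetherianRing k (invariants G)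

end Poly

end RelativeInvariants

/-! ### The module of relative invariants, its grading and its rank -/

lemma Module.exists_linearIndependent_finrank (R M : Type*) [CommRing R] [IsDomain R]
    [AddCommGroup M] [Module R M] [Module.Finite R M] :
    ∃ m : Fin (Module.finrank R M) → M, LinearIndependent R m ∧
      ∀ x, ∃ b : R, b ≠ 0 ∧ b • x ∈ Submodule.span R (Set.range m) := by
  obtain ⟨m, hm⟩ := exists_linearIndependent_of_le_finrank (le_refl (Module.finrank R M))
  refine ⟨m, hm, fun x => ?_⟩
  have h := Submodule.finrank_quotient_add_finrank (Submodule.span R (Set.range m))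
  rw [finrank_span_eq_card hm, Fintype.card_fin, Nat.add_eq_right] at h
  obtain ⟨b, hb, hb'⟩ := Module.finrank_eq_zero_iff.1 h (Submodule.Quotient.mk x)
  rw [← Submodule.Quotient.mk_smul, Submodule.Quotient.mk_eq_zero] at hb'
  exact ⟨b, hb, hb'⟩

lemma Submodule.finite_comap_of_injective {k N N' : Type*} [Field k] [AddCommGroup N] [Module k N]
    [AddCommGroup N'] [Module k N'] (f : N →ₗ[k] N') (hf : Function.Injective f)
    (W : Submodule k N') [Module.Finite k W] : Module.Finite k (W.comap f) :=
  Module.Finite.of_injective (f.restrict (p := W.comap f) (q := W) fun _ h => h)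
    fun _ _ h => Subtype.ext (hf (congrArg Subtype.val h))

namespace RelativeInvariants

section Module
variable {k V U : Type u} [Field k] [AddCommGroup V] [Module k V] [AddCommGroup U] [Module k U]
  (G : Subgroup (LinearMap.GeneralLinearGroup k V)) (σ : Representation k (G)ᵐᵒᵖ U)

lemma relInvVal_injective : Function.Injective (relInvVal G σ) := Subtype.val_injective

lemma diagonal_relInvVal (g : G) (x : RelInv G σ) :
    diagonal G σ g (relInvVal G σ x) = relInvVal G σ x := x.2 g

instance [FiniteDimensional k U] [FiniteDimensional k V] [Finite G] :
    Module.Finite (invariants G) (Poly k V ⊗[k] U) :=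
  Module.Finite.trans (Poly k V) _

instance [FiniteDimensional k U] [FiniteDimensional k V] [Finite G] :
    Module.Finite (invariants G) (RelInv G σ) :=
  Module.Finite.of_injective (relInvVal G σ) (relInvVal_injective G σ)

instance : Module.IsTorsionFree (invariants G) (RelInv G σ) := by
  have : Module.IsTorsionFree (invariants G) (Poly k V ⊗[k] U) :=
    Module.IsTorsionFree.trans_faithfulSMul (invariants G) (Poly k V) _
  exact (relInvVal_injective G σ).moduleIsTorsionFree _ fun _ _ => rfl

lemma diagonal_poly_smul (g : G) (p : Poly k V) (x : Poly k V ⊗[k] U) :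
    diagonal G σ g (p • x) =
      polyRep (g : LinearMap.GeneralLinearGroup k V) p • diagonal G σ g x := by
  induction x using TensorProduct.induction_on with
  | zero => simp
  | add y z hy hz => rw [smul_add, map_add, map_add, smul_add, hy, hz]
  | tmul q u =>
    rw [TensorProduct.smul_tmul', diagonal_tmul, diagonal_tmul, TensorProduct.smul_tmul',
      smul_eq_mul, smul_eq_mul, polyRep_mul]

lemma diagonal_mul (g h : G) (x : Poly k V ⊗[k] U) :
    diagonal G σ (g * h) x = diagonal G σ g (diagonal G σ h x) := by
  induction x using TensorProduct.induction_on with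
  | zero => simp
  | add y z hy hz => rw [map_add, map_add, map_add, hy, hz]
  | tmul q u =>
    rw [diagonal_tmul, diagonal_tmul, diagonal_tmul, Subgroup.coe_mul, map_mul, mul_inv_rev,
      MulOpposite.op_mul, map_mul]
    rfl

section Grading

/-- The grading of `U ⊗ k[V]`. -/
noncomputable def tensorGrading : Grading fun d =>
    LinearMap.range ((polyDegree k V d).subtype.rTensor U) where
  proj j := ((polyGrading k V).proj j).rTensor U
  proj_mem j x := by
    have h : (polyGrading k V).proj j = (polyDegree k V j).subtype ∘ₗ
      ((polyGrading k V).proj j).codRestrict _ ((polyGrading k V).proj_mem j) := rfl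
    rw [h, LinearMap.rTensor_comp]
    exact ⟨_, rfl⟩
  proj_same {j x} hx := by
    obtain ⟨x, rfl⟩ := hx
    have h : (polyGrading k V).proj j ∘ₗ (polyDegree k V j).subtype = (polyDegree k V j).subtype :=
      LinearMap.ext fun x => (polyGrading k V).proj_same x.2
    rw [← LinearMap.comp_apply, ← LinearMap.rTensor_comp, h]
  proj_ne {i j x} hx hij := by
    obtain ⟨x, rfl⟩ := hx
    have h : (polyGrading k V).proj j ∘ₗ (polyDegree k V i).subtype = 0 :=
      LinearMap.ext fun x => (polyGrading k V).proj_ne x.2 hij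
    rw [← LinearMap.comp_apply, ← LinearMap.rTensor_comp, h, LinearMap.rTensor_zero,
      LinearMap.zero_apply]
  iSup_eq := by
    rw [eq_top_iff]
    rintro x -
    induction x using TensorProduct.induction_on with
    | zero => exact zero_mem _
    | add x y hx hy => exact add_mem hx hy
    | tmul p u =>
      induction p using Grading.induction (polyGrading k V) with
      | hom j p hp => exact Submodule.mem_iSup_of_mem j ⟨⟨p, hp⟩ ⊗ₜ u, rfl⟩
      | add p q hp hq => rw [TensorProduct.add_tmul]; exact add_mem hp hq

lemma diagonal_proj (g : G) (j : ℕ) (x : Poly k V ⊗[k] U) :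
    diagonal G σ g ((tensorGrading (k := k) (V := V) (U := U)).proj j x) =
      tensorGrading.proj j (diagonal G σ g x) := by
  induction x using TensorProduct.induction_on with
  | zero => simp
  | add y z hy hz => simp only [map_add, hy, hz]
  | tmul q u =>
    change polyRep (g : LinearMap.GeneralLinearGroup k V) ((polyGrading k V).proj j q) ⊗ₜ[k]
      σ (MulOpposite.op g⁻¹) u = (polyGrading k V).proj j (polyRep _ q) ⊗ₜ[k] _
    rw [polyRep_proj]
    rfl

/-- The grading of the module of relative invariants. -/
noncomputable def relInvGrading : Grading (relInvDegree G σ) :=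
  tensorGrading.comap ((relInvVal G σ).restrictScalars k) (relInvVal_injective G σ) fun j x =>
    ⟨(⟨tensorGrading.proj j (relInvVal G σ x), fun g => by
      rw [diagonal_proj, diagonal_relInvVal]⟩ : relInvSubmodule G σ), rfl⟩

lemma isGradedSMul_relInvDegree : BarComplex.IsGradedSMul (invariantsDegree G) (relInvDegree G σ) := by
  rintro i j r x hr ⟨y, hy⟩
  change r • relInvVal G σ x ∈ LinearMap.range ((polyDegree k V (j + i)).subtype.rTensor U)
  have hy' : (polyDegree k V j).subtype.rTensor U y = relInvVal G σ x := hy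
  rw [← hy']
  clear hy hy'
  induction y using TensorProduct.induction_on with
  | zero => rw [map_zero, smul_zero]; exact zero_mem _
  | add y z hy hz => rw [map_add, smul_add]; exact add_mem hy hz
  | tmul p u =>
    refine ⟨⟨(r : Poly k V) * p, ?_⟩ ⊗ₜ u, rfl⟩
    rw [add_comm]
    exact mul_mem_polyDegree hr p.2

instance finite_relInvDegree [FiniteDimensional k V] [FiniteDimensional k U] (d : ℕ) :
    Module.Finite k (relInvDegree G σ d) := by
  have : Module.Finite k (LinearMap.range ((polyDegree k V d).subtype.rTensor U)) :=
    Module.Finite.range _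
  exact Submodule.finite_comap_of_injective ((relInvVal G σ).restrictScalars k)
    (relInvVal_injective G σ) _

end Grading

section Rank
variable [Finite G]

/-- The cofactor is the product of the other conjugates of `p`, which makes the product the norm of
`p`. -/
lemma exists_mul_mem_invariants {p : Poly k V} (hp : p ≠ 0) :
    ∃ c : Poly k V, c ≠ 0 ∧ p * c ∈ invariants G := by
  classical
  have := Fintype.ofFinite G
  have h0 (g : G) : polyRep (g : LinearMap.GeneralLinearGroup k V) p ≠ 0 := by
    intro h
    apply hp
    rw [← LinearMap.id_apply (R := k) p, ← Module.End.one_eq_id, ← map_one polyRep,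
      ← inv_mul_cancel (g : LinearMap.GeneralLinearGroup k V), map_mul, Module.End.mul_apply, h,
      map_zero]
  refine ⟨∏ g ∈ Finset.univ.erase (1 : G), polyRep (g : LinearMap.GeneralLinearGroup k V) p,
    Finset.prod_ne_zero_iff.2 fun g _ => h0 g, ?_⟩
  have h1 : p * ∏ g ∈ Finset.univ.erase (1 : G), polyRep (g : LinearMap.GeneralLinearGroup k V) p =
      ∏ g : G, polyRep (g : LinearMap.GeneralLinearGroup k V) p := by
    rw [← Finset.mul_prod_erase _ _ (Finset.mem_univ (1 : G)), OneMemClass.coe_one, map_one,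
      Module.End.one_apply]
  rw [h1]
  intro h hh
  have h2 : polyRep h (∏ g : G, polyRep (g : LinearMap.GeneralLinearGroup k V) p) =
      ∏ g : G, polyRep h (polyRep (g : LinearMap.GeneralLinearGroup k V) p) :=
    map_prod (polyMap ((h⁻¹ : LinearMap.GeneralLinearGroup k V) : V →ₗ[k] V)) _ _
  rw [h2]
  refine Fintype.prod_equiv (Equiv.mulLeft (⟨h, hh⟩ : G)) _ _ fun g => ?_
  rw [Equiv.coe_mulLeft, Subgroup.coe_mul, map_mul]
  rfl

/-- Relative invariants that are linearly independent over the invariants are linearly independent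
over the polynomial algebra. -/
lemma linearIndependent_relInvVal {ι : Type*} [Fintype ι] {m : ι → RelInv G σ}
    (hm : LinearIndependent (invariants G) m) :
    LinearIndependent (Poly k V) fun i => relInvVal G σ (m i) := by
  classical
  rw [Fintype.linearIndependent_iff]
  -- Descent on the number of nonzero coefficients. Scale a relation so that one coefficient is
  -- invariant, apply `g` and subtract: the result is shorter, hence trivial. So all the scaled
  -- coefficients are invariant, and the relation holds over the invariants.
  suffices H : ∀ (n : ℕ) (p : ι → Poly k V), (Finset.univ.filter fun i => p i ≠ 0).card = n →
      ∑ i, p i • relInvVal G σ (m i) = 0 → p = 0 from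
    fun p hp i => congrFun (H _ p rfl hp) i
  intro n
  induction n using Nat.strong_induction_on with
  | _ n ih =>
    intro p hn hp
    by_contra hne
    obtain ⟨i₀, hi₀⟩ := Function.ne_iff.1 hne
    obtain ⟨c, hc, hcp⟩ := exists_mul_mem_invariants G hi₀
    have hq : ∑ i, (p i * c) • relInvVal G σ (m i) = 0 := by
      rw [← smul_zero c, ← hp, Finset.smul_sum]
      exact Finset.sum_congr rfl fun i _ => by rw [smul_smul, mul_comm]
    have hinv (i : ι) : p i * c ∈ invariants G := by
      intro g hg
      have h1 : (fun i => polyRep g (p i * c) - p i * c) = 0 := by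
        refine ih _ ?_ _ rfl ?_
        · rw [← hn]
          refine Finset.card_lt_card (Finset.ssubset_iff_subset_ne.2 ⟨?_, ?_⟩)
          · intro i hi
            rw [Finset.mem_filter] at hi ⊢
            refine ⟨hi.1, fun h0 => hi.2 ?_⟩
            rw [h0, zero_mul, map_zero, sub_zero]
          · intro h
            have : i₀ ∈ Finset.univ.filter fun i => p i ≠ 0 :=
              Finset.mem_filter.2 ⟨Finset.mem_univ _, hi₀⟩
            rw [← h, Finset.mem_filter] at this
            exact this.2 (by rw [hcp g hg, sub_self])
        · have h2 := congrArg (diagonal G σ ⟨g, hg⟩) hq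
          rw [map_sum, map_zero] at h2
          rw [Finset.sum_congr rfl fun i _ => (diagonal_poly_smul G σ ⟨g, hg⟩ _ _).trans
            (congrArg _ (diagonal_relInvVal G σ ⟨g, hg⟩ (m i)))] at h2
          have h3 (i : ι) : (polyRep g (p i * c) - p i * c) • relInvVal G σ (m i) =
              polyRep g (p i * c) • relInvVal G σ (m i) - (p i * c) • relInvVal G σ (m i) :=
            eq_sub_of_add_eq ((add_smul _ _ _).symm.trans (by rw [sub_add_cancel]))
          refine (Finset.sum_congr rfl fun i _ => h3 i).trans ?_
          rw [Finset.sum_sub_distrib, hq, h2, sub_zero]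
      exact sub_eq_zero.1 (congrFun h1 i)
    have h3 : ∑ i, (⟨p i * c, hinv i⟩ : invariants G) • m i = 0 := by
      apply relInvVal_injective G σ
      rw [map_sum, map_zero, ← hq]
      rfl
    have h4 := congrArg Subtype.val (Fintype.linearIndependent_iff.1 hm _ h3 i₀)
    exact mul_ne_zero hi₀ hc h4

/-- A linear functional that vanishes on the relative invariants is zero. -/
lemma eq_zero_of_relInvVal (l : Poly k V ⊗[k] U →ₗ[Poly k V] Poly k V)
    (hl : ∀ x, l (relInvVal G σ x) = 0) : l = 0 := by
  classical
  have := Fintype.ofFinite G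
  let φ (g : G) : Poly k V →* Poly k V :=
    (polyMap (((g : LinearMap.GeneralLinearGroup k V)⁻¹ : LinearMap.GeneralLinearGroup k V) :
      V →ₗ[k] V)).toMonoidHom
  have hφ : Function.Injective φ := fun g h hgh =>
    Subtype.ext (polyRep_injective (LinearMap.ext fun x => DFunLike.congr_fun hgh x))
  have hli := (linearIndependent_monoidHom (Poly k V) (Poly k V)).comp φ hφ
  refine TensorProduct.AlgebraTensorModule.curry_injective (LinearMap.ext_ring
    (LinearMap.ext fun u => ?_))
  -- Evaluating `l` on the relative invariant `∑ g (u ⊗ p)`, with `u` fixed and `p` arbitrary, gives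
  -- a linear relation between the distinct characters `φ g` of the monoid `k[V]`. By Dedekind its
  -- coefficient at `g = 1`, which is `l (1 ⊗ u)`, vanishes.
  have h1 : ∑ g : G, l (1 ⊗ₜ σ (MulOpposite.op g⁻¹) u) • (φ g : Poly k V → Poly k V) = 0 := by
    funext p
    rw [Finset.sum_apply]
    have h2 : ∑ g : G, diagonal G σ g (p ⊗ₜ u) ∈ relInvSubmodule G σ := by
      intro h
      rw [map_sum]
      refine Fintype.sum_equiv (Equiv.mulLeft h) _ _ fun g => ?_
      rw [Equiv.coe_mulLeft, diagonal_mul]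
    have h3 : l (∑ g : G, diagonal G σ g (p ⊗ₜ u)) = 0 := hl (⟨_, h2⟩ : relInvSubmodule G σ)
    rw [Pi.zero_apply, ← h3, map_sum]
    refine Finset.sum_congr rfl fun g _ => ?_
    rw [diagonal_tmul, Pi.smul_apply, smul_eq_mul, mul_comm]
    have h4 : polyRep (g : LinearMap.GeneralLinearGroup k V) p ⊗ₜ[k] σ (MulOpposite.op g⁻¹) u =
      polyRep (g : LinearMap.GeneralLinearGroup k V) p • (1 ⊗ₜ[k] σ (MulOpposite.op g⁻¹) u) := by
      rw [TensorProduct.smul_tmul', smul_eq_mul, mul_one]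
    rw [h4, map_smul]
    rfl
  have h5 := Fintype.linearIndependent_iff.1 hli _ h1 1
  rw [inv_one, MulOpposite.op_one, map_one] at h5
  exact h5

/-- The rank of the module of relative invariants. -/
lemma finrank_relInv [FiniteDimensional k V] [FiniteDimensional k U] :
    Module.finrank (invariants G) (RelInv G σ) = Module.finrank k U := by
  obtain ⟨m, hm, hm'⟩ := Module.exists_linearIndependent_finrank (invariants G) (RelInv G σ)
  apply le_antisymm
  · have := (linearIndependent_relInvVal G σ hm).fintype_card_le_finrank
    rwa [Fintype.card_fin, Module.finrank_baseChange] at this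
  -- A functional that kills a maximal independent family kills all relative invariants, up to
  -- torsion, and is zero. So evaluation at the family embeds a free module of rank `dim U` in one
  -- of rank equal to that of the relative invariants.
  · let Λ : (Poly k V ⊗[k] U →ₗ[Poly k V] Poly k V) →ₗ[Poly k V]
        (Fin (Module.finrank (invariants G) (RelInv G σ)) → Poly k V) :=
      LinearMap.pi fun i => LinearMap.applyₗ (relInvVal G σ (m i))
    have hΛ : Function.Injective Λ := by
      rw [← LinearMap.ker_eq_bot, eq_bot_iff]
      intro l hl
      refine eq_zero_of_relInvVal G σ l fun x => ?_
      obtain ⟨b, hb, hbx⟩ := hm' x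
      have h1 : ∀ y ∈ Submodule.span (invariants G) (Set.range m), l (relInvVal G σ y) = 0 := by
        intro y hy
        induction hy using Submodule.span_induction with
        | mem y hy =>
          obtain ⟨i, rfl⟩ := hy
          exact congrFun hl i
        | zero => rw [map_zero, map_zero]
        | add y z _ _ hy hz => rw [map_add, map_add, hy, hz, add_zero]
        | smul r y _ hy =>
          have : l (relInvVal G σ (r • y)) = (r : Poly k V) • l (relInvVal G σ y) :=
            map_smul l (r : Poly k V) _
          rw [this, hy, smul_zero]
      have h2 : (b : Poly k V) • l (relInvVal G σ x) = 0 :=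
        (map_smul l (b : Poly k V) (relInvVal G σ x)).symm.trans (h1 _ hbx)
      exact (smul_eq_zero.1 h2).resolve_left fun h => hb (Subtype.ext h)
    have := LinearMap.finrank_le_finrank_of_injective hΛ
    rwa [Module.finrank_fin_fun, Module.finrank_linearMap_self, Module.finrank_baseChange] at this

end Rank
end Module
end RelativeInvariants

/-! ### Passing to the part cut out by an idempotent -/

namespace BarComplex

section Degree
variable {k : Type u} [Field k] {R : Type u} [CommRing R] [Algebra k R] (I : Ideal R)
  {N L : Type u} [AddCommGroup N] [Module k N] [AddCommGroup L] [Module k L]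

lemma objMap_mem_degree (f : L →ₗ[k] N) (𝒜 : ℕ → Submodule k R) {ℒ : ℕ → Submodule k L}
    {𝒩 : ℕ → Submodule k N} (hf : ∀ j, ∀ x ∈ ℒ j, f x ∈ 𝒩 j) (n j : ℕ) :
    degree I 𝒜 ℒ n j ≤ (degree I 𝒜 𝒩 n j).comap (objMap I f n) := by
  induction n generalizing j with
  | zero => exact hf j
  | succ n ih =>
    refine iSup_le fun q => Submodule.map₂_le.mpr fun x hx r hr => ?_
    exact Submodule.mem_iSup_of_mem q (Submodule.apply_mem_map₂ (cons k I N n) (ih _ hx) hr)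

end Degree

section Idempotent
variable {k : Type u} [Field k] {R : Type u} [CommRing R] [Algebra k R] (I : Ideal R)
  {N L : Type u} [AddCommGroup N] [Module k N] [Module R N] [IsScalarTower k R N]
  [AddCommGroup L] [Module k L] [Module R L] [IsScalarTower k R L]
  {Γ : Type v} [Group Γ] (ρ : Representation R Γ N) (e : MonoidAlgebra k Γ)

lemma objMap_eq_asAlgebraHom (f : N →ₗ[R] N)
    (h : ∀ x, f x = (restrictRep k ρ).asAlgebraHom e x) (n : ℕ) (x : obj k I N n) :
    objMap I (f.restrictScalars k) n x = (objRep I ρ n).asAlgebraHom e x := by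
  induction n with
  | zero => exact h x
  | succ n ih =>
    suffices h : objMap I (f.restrictScalars k) (n + 1) = (objRep I ρ (n + 1)).asAlgebraHom e from
      LinearMap.congr_fun h x
    refine ext_cons k I N fun y r => ?_
    rw [objMap_cons, ih]
    exact Representation.asAlgebraHom_comm ((cons k I N n).flip r) (fun γ x => rfl) e y

lemma torMap_eq_asAlgebraHom (f : N →ₗ[R] N)
    (h : ∀ x, f x = (restrictRep k ρ).asAlgebraHom e x) (n : ℕ) (x : Tor k I N n) :
    torMap I f n x = (torRep I ρ n).asAlgebraHom e x := by
  obtain ⟨x, rfl⟩ := Submodule.Quotient.mk_surjective _ x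
  have h1 := Representation.asAlgebraHom_comm
    (ρ := (objRep I ρ n).subrepresentation (cycles k I N n) (cycles_invariant I ρ n))
    (σ := torRep I ρ n) (Submodule.mkQ _) (fun γ x => rfl) e x
  have h2 := Representation.asAlgebraHom_comm
    (ρ := (objRep I ρ n).subrepresentation (cycles k I N n) (cycles_invariant I ρ n))
    (σ := objRep I ρ n) (cycles k I N n).subtype (fun γ x => rfl) e x
  rw [torMap_mk]
  refine Eq.trans ?_ h1
  refine congrArg (Submodule.mkQ _) (Subtype.ext ?_)
  exact (objMap_eq_asAlgebraHom I ρ e f h n x).trans h2.symm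

variable {ρ e} {f : L →ₗ[R] N} {p : N →ₗ[R] L} (hpf : p ∘ₗ f = LinearMap.id)
  (hfp : ∀ x, f (p x) = (restrictRep k ρ).asAlgebraHom e x)

include hpf hfp in
-- `L` is a retract of `N` whose projector is the action of `e`. By functoriality `Tor(L)` is a
-- retract of `Tor(N)`, again with projector `e`.
lemma idemRank_torRep (n : ℕ) : idemRank e (torRep I ρ n) = Module.finrank k (Tor k I L n) := by
  have hl : Function.LeftInverse (torMap (k := k) I p n) (torMap I f n) := fun x => by
    rw [← torMap_comp, hpf, torMap_id]
  rw [← LinearMap.finrank_range_of_inj hl.injective, idemRank]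
  refine LinearEquiv.finrank_eq (LinearEquiv.ofEq _ _ ?_)
  ext x
  constructor
  · rintro ⟨y, rfl⟩
    exact ⟨torMap I p n y, by
      rw [← torMap_comp]; exact torMap_eq_asAlgebraHom I ρ e (f ∘ₗ p) hfp n y⟩
  · rintro ⟨y, rfl⟩
    refine ⟨torMap I f n y, ?_⟩
    rw [← torMap_eq_asAlgebraHom I ρ e (f ∘ₗ p) hfp n, torMap_comp, hl]

lemma torMap_mem_torDegree (f : L →ₗ[R] N) (𝒜 : ℕ → Submodule k R) {ℒ : ℕ → Submodule k L}
    {𝒩 : ℕ → Submodule k N} (hf : ∀ j, ∀ x ∈ ℒ j, f x ∈ 𝒩 j) (n j : ℕ) {x : Tor k I L n}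
    (hx : x ∈ torDegree I 𝒜 ℒ n j) : torMap I f n x ∈ torDegree I 𝒜 𝒩 n j := by
  obtain ⟨y, hy, rfl⟩ := hx
  exact ⟨⟨_, objMap_mem_cycles I f n y.2⟩,
    objMap_mem_degree I (f.restrictScalars k) 𝒜 hf n j hy, rfl⟩

include hpf hfp in
lemma idemRank_torDegreeRep (𝒜 : ℕ → Submodule k R) {ℒ : ℕ → Submodule k L}
    {𝒩 : ℕ → Submodule k N} (hf : ∀ j, ∀ x ∈ ℒ j, f x ∈ 𝒩 j) (hp : ∀ j, ∀ x ∈ 𝒩 j, p x ∈ ℒ j)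
    (h𝒩 : ∀ γ j, 𝒩 j ≤ (𝒩 j).comap (restrictRep k ρ γ)) (n j : ℕ) :
    idemRank e (torDegreeRep I ρ 𝒜 𝒩 h𝒩 n j) = Module.finrank k (torDegree I 𝒜 ℒ n j) := by
  have hl : Function.LeftInverse (torMap (k := k) I p n) (torMap I f n) := fun x => by
    rw [← torMap_comp, hpf, torMap_id]
  let F : torDegree I 𝒜 ℒ n j →ₗ[k] torDegree I 𝒜 𝒩 n j :=
    (torMap I f n).restrict fun x => torMap_mem_torDegree I f 𝒜 hf n j
  have hF : Function.Injective F := fun x y h => Subtype.ext (hl.injective (congrArg Subtype.val h))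
  have he (x : torDegree I 𝒜 𝒩 n j) :
      ((torDegreeRep I ρ 𝒜 𝒩 h𝒩 n j).asAlgebraHom e x : Tor k I N n) =
        torMap I f n (torMap I p n x) := by
    rw [← torMap_comp, torMap_eq_asAlgebraHom I ρ e (f ∘ₗ p) hfp n]
    exact Representation.asAlgebraHom_comm (ρ := torDegreeRep I ρ 𝒜 𝒩 h𝒩 n j)
      (torDegree I 𝒜 𝒩 n j).subtype (fun γ x => rfl) e x
  rw [← LinearMap.finrank_range_of_inj hF, idemRank]
  refine LinearEquiv.finrank_eq (LinearEquiv.ofEq _ _ ?_)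
  ext x
  constructor
  · rintro ⟨y, rfl⟩
    exact ⟨⟨torMap I p n y, torMap_mem_torDegree I p 𝒜 hp n j y.2⟩, Subtype.ext (he y).symm⟩
  · rintro ⟨y, rfl⟩
    refine ⟨F y, Subtype.ext ?_⟩
    rw [he]
    exact congrArg (torMap I f n) (hl y)

end Idempotent
end BarComplex

namespace RelativeInvariants

section Idempotent
variable {k V U : Type u} [Field k] [AddCommGroup V] [Module k V] [AddCommGroup U] [Module k U]
  (G : Subgroup (LinearMap.GeneralLinearGroup k V)) {U' : Type u} [AddCommGroup U'] [Module k U']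
  {σ : Representation k (G)ᵐᵒᵖ U} {σ' : Representation k (G)ᵐᵒᵖ U'}

lemma lTensor_mem_relInvSubmodule (φ : U →ₗ[k] U') (hφ : ∀ g u, φ (σ g u) = σ' g (φ u))
    {x : Poly k V ⊗[k] U} (hx : x ∈ relInvSubmodule G σ) :
    φ.lTensor (Poly k V) x ∈ relInvSubmodule G σ' := by
  intro g
  have h : diagonal G σ' g ∘ₗ φ.lTensor (Poly k V) = φ.lTensor (Poly k V) ∘ₗ diagonal G σ g :=
    TensorProduct.ext' fun p u =>
      congrArg (polyRep (g : LinearMap.GeneralLinearGroup k V) p ⊗ₜ[k] ·) (hφ _ u).symm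
  exact (LinearMap.congr_fun h x).trans (congrArg _ (hx g))

/-- The map of relative invariants induced by an equivariant map. -/
noncomputable def relInvMap (φ : U →ₗ[k] U') (hφ : ∀ g u, φ (σ g u) = σ' g (φ u)) :
    RelInv G σ →ₗ[invariants G] RelInv G σ' :=
  ((TensorProduct.AlgebraTensorModule.lTensor (invariants G) (Poly k V) φ).restrict
    fun _ hx => lTensor_mem_relInvSubmodule G φ hφ hx :
      relInvSubmodule G σ →ₗ[invariants G] relInvSubmodule G σ')

lemma relInvVal_relInvMap (φ : U →ₗ[k] U') (hφ : ∀ g u, φ (σ g u) = σ' g (φ u)) (x : RelInv G σ) :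
    relInvVal G σ' (relInvMap G φ hφ x) = φ.lTensor (Poly k V) (relInvVal G σ x) := rfl

lemma relInvMap_mem_relInvDegree (φ : U →ₗ[k] U') (hφ : ∀ g u, φ (σ g u) = σ' g (φ u)) (j : ℕ)
    {x : RelInv G σ} (hx : x ∈ relInvDegree G σ j) : relInvMap G φ hφ x ∈ relInvDegree G σ' j := by
  obtain ⟨y, hy⟩ := hx
  refine ⟨φ.lTensor _ y, ?_⟩
  change _ = φ.lTensor (Poly k V) (relInvVal G σ x)
  change _ = relInvVal G σ x at hy
  rw [← hy, ← LinearMap.comp_apply, ← LinearMap.comp_apply, LinearMap.rTensor_comp_lTensor,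
    LinearMap.lTensor_comp_rTensor]

variable {Γ : Type v} [Group Γ] {ρ : Representation k Γ U}

/-- The right action of `G` on `e U`, for an element `e` of `k Γ`. -/
noncomputable def idemAction (σ : Representation k (G)ᵐᵒᵖ U)
    (hcomm : ∀ (γ : Γ) (g : G), Commute (ρ γ) (σ (MulOpposite.op g))) (e : MonoidAlgebra k Γ) :
    Representation k (G)ᵐᵒᵖ (LinearMap.range (ρ.asAlgebraHom e)) :=
  σ.subrepresentation _ (by
    rintro g _ ⟨u, rfl⟩
    exact ⟨σ g u, (Representation.asAlgebraHom_comm (ρ := ρ) (σ := ρ) (σ g)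
      (fun γ x => (LinearMap.congr_fun (hcomm γ g.unop).eq x).symm) e u).symm⟩)

variable (hcomm : ∀ (γ : Γ) (g : G), Commute (ρ γ) (σ (MulOpposite.op g)))
  (e : MonoidAlgebra k Γ)

lemma idemAction_apply (g : (G)ᵐᵒᵖ) (u : LinearMap.range (ρ.asAlgebraHom e)) :
    (LinearMap.range (ρ.asAlgebraHom e)).subtype (idemAction G σ hcomm e g u) =
      σ g ((LinearMap.range (ρ.asAlgebraHom e)).subtype u) := rfl

/-- The inclusion of the relative invariants of `e U`. -/
noncomputable def relInvIdemIncl : RelInv G (idemAction G σ hcomm e) →ₗ[invariants G] RelInv G σ :=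
  relInvMap G (Submodule.subtype _) (idemAction_apply G hcomm e)

lemma relInvVal_relInvIdemIncl (x : RelInv G (idemAction G σ hcomm e)) :
    relInvVal G σ (relInvIdemIncl G hcomm e x) =
      (LinearMap.range (ρ.asAlgebraHom e)).subtype.lTensor (Poly k V) (relInvVal G _ x) := rfl

/-- The projection to the relative invariants of `e U`. -/
noncomputable def relInvIdemProj : RelInv G σ →ₗ[invariants G] RelInv G (idemAction G σ hcomm e) :=
  relInvMap G (LinearMap.rangeRestrict _) fun g u => Subtype.ext
    (Representation.asAlgebraHom_comm (ρ := ρ) (σ := ρ) (σ g)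
      (fun γ x => (LinearMap.congr_fun (hcomm γ g.unop).eq x).symm) e u).symm

lemma relInvIdemProj_comp_incl {e : MonoidAlgebra k Γ} (he : IsIdempotentElem e) :
    relInvIdemProj G hcomm e ∘ₗ relInvIdemIncl G hcomm e = LinearMap.id := by
  refine LinearMap.ext fun x => relInvVal_injective G _ ?_
  rw [LinearMap.comp_apply, relInvIdemProj, relInvVal_relInvMap, relInvVal_relInvIdemIncl,
    ← LinearMap.comp_apply, ← LinearMap.lTensor_comp]
  have h : (ρ.asAlgebraHom e).rangeRestrict ∘ₗ (LinearMap.range (ρ.asAlgebraHom e)).subtype =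
      LinearMap.id := by
    refine LinearMap.ext fun x => Subtype.ext ?_
    obtain ⟨_, y, rfl⟩ := x
    change ρ.asAlgebraHom e (ρ.asAlgebraHom e y) = ρ.asAlgebraHom e y
    rw [← Module.End.mul_apply, ← map_mul, he.eq]
  rw [h, LinearMap.lTensor_id]
  rfl

/-- `Γ` acts on the relative invariants through `U` alone, so the projector to those of `eU` is the
action of `e`. -/
lemma relInvIdemIncl_proj (x : RelInv G σ) :
    relInvIdemIncl G hcomm e (relInvIdemProj G hcomm e x) =
      (restrictRep k (relInvRep G σ ρ hcomm)).asAlgebraHom e x := by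
  refine relInvVal_injective G σ ?_
  let τ : Representation k Γ (Poly k V ⊗[k] U) := (Representation.trivial k Γ (Poly k V)).tprod ρ
  have h1 := Representation.asAlgebraHom_comm (ρ := restrictRep k (relInvRep G σ ρ hcomm)) (σ := τ)
    ((relInvVal G σ).restrictScalars k) (fun γ x => rfl) e x
  refine Eq.trans ?_ h1.symm
  rw [relInvVal_relInvIdemIncl, relInvIdemProj, relInvVal_relInvMap,
    ← LinearMap.comp_apply, ← LinearMap.lTensor_comp]
  refine LinearMap.congr_fun (f := LinearMap.lTensor (Poly k V) _) (g := τ.asAlgebraHom e)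
    (TensorProduct.ext' fun p u => ?_) _
  exact Representation.asAlgebraHom_comm (ρ := ρ) (σ := τ) (TensorProduct.mk k _ _ p)
    (fun γ x => rfl) e u

variable {e} in
lemma idemRank_relTorDegreeRep (he : IsIdempotentElem e) (i j : ℕ) :
    idemRank e (relTorDegreeRep G σ ρ hcomm i j) =
      Module.finrank k (relTorDegree G (idemAction G σ hcomm e) i j) :=
  BarComplex.idemRank_torDegreeRep _ (relInvIdemProj_comp_incl G hcomm he)
    (relInvIdemIncl_proj G hcomm e) _ (fun j _ => relInvMap_mem_relInvDegree G _ _ j)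
    (fun j _ => relInvMap_mem_relInvDegree G _ _ j) _ i j

variable {e} in
lemma idemRank_relTorRep (he : IsIdempotentElem e) (i : ℕ) :
    idemRank e (BarComplex.torRep (k := k) (invariantsPlus G) (relInvRep G σ ρ hcomm) i) =
      Module.finrank k (RelTor G (idemAction G σ hcomm e) i) :=
  BarComplex.idemRank_torRep _ (relInvIdemProj_comp_incl G hcomm he)
    (relInvIdemIncl_proj G hcomm e) i

end Idempotent
end RelativeInvariants

/-! ### Identification of `Tor₀` with the fibre -/

namespace BarComplex

section Fiber
variable (k : Type u) [Field k] {R : Type u} [CommRing R] [Algebra k R] (I : Ideal R)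
  (N : Type u) [AddCommGroup N] [Module k N] [Module R N] [IsScalarTower k R N]

/-- The map `N → N ⊗ R / I`. -/
noncomputable def toFiber : N →ₗ[k] N ⊗[R] (R ⧸ I) :=
  ((TensorProduct.mk R N (R ⧸ I)).flip 1).restrictScalars k

lemma toFiber_surjective : Function.Surjective (toFiber k I N) := by
  intro x
  obtain ⟨y, hy⟩ := Submodule.mkQ_surjective _ (TensorProduct.tensorQuotEquivQuotSMul N I x)
  refine ⟨y, (TensorProduct.tensorQuotEquivQuotSMul N I).injective (Eq.trans ?_ hy)⟩
  exact LinearMap.congr_fun (TensorProduct.tensorQuotEquivQuotSMul_comp_mk I) y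

lemma toFiber_eq_zero_iff (x : N) : toFiber k I N x = 0 ↔ x ∈ I • (⊤ : Submodule R N) := by
  rw [← Submodule.Quotient.mk_eq_zero,
    ← (TensorProduct.tensorQuotEquivQuotSMul N I).map_eq_zero_iff]
  exact iff_of_eq (congrArg (· = 0)
    (LinearMap.congr_fun (TensorProduct.tensorQuotEquivQuotSMul_comp_mk I) x))

/-- The identification of `Tor₀` with `N ⊗ R / I`. -/
noncomputable def torZeroEquivFiber : Tor k I N 0 ≃ₗ[k] N ⊗[R] (R ⧸ I) :=
  LinearEquiv.ofKerEq (toTorZero k I N) (toFiber k I N) (toTorZero_surjective I)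
    (toFiber_surjective k I N) (by
      ext x
      rw [LinearMap.mem_ker, LinearMap.mem_ker, toTorZero_eq_zero_iff, toFiber_eq_zero_iff])

lemma torZeroEquivFiber_toTorZero (x : N) :
    torZeroEquivFiber k I N (toTorZero k I N x) = toFiber k I N x :=
  LinearEquiv.ofKerEq_apply ..

lemma torZeroEquivFiber_torRep {Γ : Type v} [Group Γ] (ρ : Representation R Γ N) (γ : Γ)
    (x : Tor k I N 0) :
    torZeroEquivFiber k I N (torRep I ρ 0 γ x) = fiberRep k I ρ γ (torZeroEquivFiber k I N x) := by
  obtain ⟨x, rfl⟩ := toTorZero_surjective (k := k) I x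
  have h : torRep I ρ 0 γ (toTorZero k I N x) = toTorZero k I N (ρ γ x) := rfl
  rw [h, torZeroEquivFiber_toTorZero, torZeroEquivFiber_toTorZero]
  rfl

variable {k I N}

lemma torDegree_map_torZeroEquivFiber (𝒜 : ℕ → Submodule k R) (𝒩 : ℕ → Submodule k N) (j : ℕ) :
    (torDegree I 𝒜 𝒩 0 j).map (torZeroEquivFiber k I N).toLinearMap = fiberDegree I 𝒩 j := by
  ext x
  constructor
  · rintro ⟨_, ⟨y, hy, rfl⟩, rfl⟩
    exact ⟨y.1, hy, (torZeroEquivFiber_toTorZero k I N y.1).symm⟩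
  · rintro ⟨y, hy, rfl⟩
    exact ⟨_, ⟨⟨y, trivial⟩, hy, rfl⟩, torZeroEquivFiber_toTorZero k I N y⟩

lemma finrank_fiberDegree (𝒜 : ℕ → Submodule k R) (𝒩 : ℕ → Submodule k N) (j : ℕ) :
    Module.finrank k (fiberDegree I 𝒩 j) = Module.finrank k (torDegree I 𝒜 𝒩 0 j) := by
  rw [← torDegree_map_torZeroEquivFiber 𝒜]
  exact ((torZeroEquivFiber k I N).finrank_map_eq _)

end Fiber
end BarComplex

/-! ### Classes of `Tor` in the Grothendieck group -/

namespace RelativeInvariants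

lemma finite_relTorDegree_ne_bot {k V U : Type u} [Field k] [AddCommGroup V] [Module k V]
    [AddCommGroup U] [Module k U] (G : Subgroup (LinearMap.GeneralLinearGroup k V))
    (σ : Representation k (G)ᵐᵒᵖ U) (j : ℕ) : {i | relTorDegree G σ i j ≠ ⊥}.Finite :=
  (Set.finite_le_nat j).subset fun i hi => by
    by_contra h
    exact hi (BarComplex.torDegree_eq_bot (invariantsConnectedGrading G) (not_le.1 h))

section Classes
variable {k V U : Type u} {Γ : Type v} [Field k]
    [AddCommGroup V] [Module k V] [FiniteDimensional k V]
    [AddCommGroup U] [Module k U] [FiniteDimensional k U]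
    (G : Subgroup (LinearMap.GeneralLinearGroup k V)) [Finite G] [Group Γ]
    {ρ : Representation k Γ U} (σ : Representation k (G)ᵐᵒᵖ U)

instance finite_relTor (i : ℕ) : Module.Finite k (RelTor G σ i) :=
  BarComplex.finite_tor (invariantsConnectedGrading G) (relInvGrading G σ)
    (isGradedSMul_relInvDegree G σ) i

instance finite_fiber : Module.Finite k (Fiber G σ) :=
  Module.Finite.equiv (BarComplex.torZeroEquivFiber k (invariantsPlus G) (RelInv G σ))

/-- The grading of `Tor`. -/
noncomputable def relTorGrading (i : ℕ) : Grading (relTorDegree G σ i) :=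
  BarComplex.torGrading (invariantsConnectedGrading G) (relInvGrading G σ)
    (isGradedSMul_relInvDegree G σ) i

variable (hcomm : ∀ (γ : Γ) (g : G), Commute (ρ γ) (σ (MulOpposite.op g)))

variable {G σ} in
lemma cls_relTorDegreeRep_of_eq_bot {i j : ℕ} (h : relTorDegree G σ i j = ⊥) :
    Groth.cls (relTorDegreeRep G σ ρ hcomm i j) = 0 := by
  have : Subsingleton (relTorDegree G σ i j) := by rw [h]; infer_instance
  exact Groth.cls_of_subsingleton _

variable {e : MonoidAlgebra k Γ} (he : IsIdempotentElem e)

/-- The `e`-part in each internal degree is that of `Tor` for `eU`, and these finitely many nonzero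
components add up to the whole. -/
lemma idemDim_finsum_relTorDegreeRep (i : ℕ) :
    Groth.idemDim he (∑ᶠ j, Groth.cls (relTorDegreeRep G σ ρ hcomm i j)) =
      Module.finrank k (RelTor G (idemAction G σ hcomm e) i) := by
  rw [AddMonoidHom.map_finsum _ ((relTorGrading G σ i).finite_ne_bot.subset fun j hj h =>
    hj (cls_relTorDegreeRep_of_eq_bot hcomm h))]
  rw [← (relTorGrading G (idemAction G σ hcomm e) i).finsum_finrank]
  rw [← Nat.coe_castAddMonoidHom, AddMonoidHom.map_finsum]
  · exact finsum_congr fun j => by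
      rw [Groth.idemDim_cls, idemRank_relTorDegreeRep G hcomm he]; rfl
  · refine (relTorGrading G (idemAction G σ hcomm e) i).finite_ne_bot.subset fun j hj h => hj ?_
    change Module.finrank k (relTorDegree G (idemAction G σ hcomm e) i j) = 0
    rw [h, finrank_bot]

lemma idemDim_finsum_relTorDegreeRep_internal (j : ℕ) :
    Groth.idemDim he (∑ᶠ i, (-1 : ℤ) ^ i • Groth.cls (relTorDegreeRep G σ ρ hcomm i j)) =
      ∑ᶠ i, (-1 : ℤ) ^ i *
        Module.finrank k (relTorDegree G (idemAction G σ hcomm e) i j) := by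
  rw [AddMonoidHom.map_finsum _ ((finite_relTorDegree_ne_bot G σ j).subset fun i hi h =>
    hi (by simp only [cls_relTorDegreeRep_of_eq_bot hcomm h, smul_zero]))]
  exact finsum_congr fun i => by
    rw [map_zsmul, Groth.idemDim_cls, idemRank_relTorDegreeRep G hcomm he, smul_eq_mul]

/-- Tested on idempotents: the `e`-parts of both sides have the dimension of `Tor₀` for `eU`. -/
lemma cls_relFiberRep [Finite Γ] : Groth.cls (relFiberRep G σ ρ hcomm) =
    ∑ᶠ j, Groth.cls (relTorDegreeRep G σ ρ hcomm 0 j) := by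
  refine Groth.eq_of_idemDim_eq fun e he => ?_
  rw [idemDim_finsum_relTorDegreeRep, Groth.idemDim_cls, ← idemRank_relTorRep G hcomm he]
  exact congrArg Nat.cast (idemRank_congr e
    (BarComplex.torZeroEquivFiber k (invariantsPlus G) (RelInv G σ))
    (BarComplex.torZeroEquivFiber_torRep k _ _ (relInvRep G σ ρ hcomm))).symm

lemma idemDim_cls_eq_finrank_relInv : Groth.idemDim he (Groth.cls ρ) =
    Module.finrank (invariants G) (RelInv G (idemAction G σ hcomm e)) := by
  rw [finrank_relInv, Groth.idemDim_cls]
  rfl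

end Classes
end RelativeInvariants

/-! ### Filtration by degree of a generic fibre -/

section Filtration
variable {K Γ W : Type*} [CommRing K] [Group Γ] [AddCommGroup W] [Module K W]

/-- The `K Γ`-submodule given by an invariant `K`-submodule. -/
noncomputable def Representation.asModuleSubmodule (τ : Representation K Γ W) (F : Submodule K W)
    (hF : ∀ γ, F ≤ F.comap (τ γ)) : Submodule (MonoidAlgebra K Γ) τ.asModule where
  carrier := {x | (show W from x) ∈ F}
  add_mem' hx hy := F.add_mem hx hy
  zero_mem' := F.zero_mem
  smul_mem' a x hx := by
    have h := Representation.asAlgebraHom_comm (ρ := τ.subrepresentation F hF) (σ := τ) F.subtype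
      (fun _ _ => rfl) a ⟨x, hx⟩
    change τ.asAlgebraHom a x ∈ F
    change _ = τ.asAlgebraHom a x at h
    rw [← h]
    exact Subtype.property _

/-- Since `C j` identifies `N j` with the layer `F (j + 1) / F j` inside `W / F j`, inverting it
gives an equivariant surjection `F (j + 1) → N j` with kernel `F j`. -/
lemma hasFiltration_of_maps (τ : Representation K Γ W) {N : ℕ → Type*} [∀ j, AddCommGroup (N j)]
    [∀ j, Module K (N j)] (ν : ∀ j, Representation K Γ (N j)) (F : ℕ → Submodule K W)
    (hF : ∀ j γ, F j ≤ (F j).comap (τ γ)) (h0 : F 0 = ⊥) (hmono : Monotone F)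
    (htop : ∃ d, F d = ⊤) (C : ∀ j, N j →ₗ[K] W ⧸ F j)
    (hC : ∀ j γ x, C j (ν j γ x) = τ.quotient (F j) (hF j) γ (C j x))
    (hinj : ∀ j, Function.Injective (C j))
    (hrange : ∀ j, LinearMap.range (C j) = (F (j + 1)).map (F j).mkQ) : HasFiltration τ ν := by
  refine ⟨fun j => τ.asModuleSubmodule (F j) (hF j), ?_, fun i j hij x hx => hmono hij hx, ?_,
    fun j => ?_⟩
  · rw [eq_bot_iff]
    intro x hx
    have hx' : (show W from x) ∈ F 0 := hx
    rw [h0] at hx'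
    exact (Submodule.mem_bot K).1 hx'
  · obtain ⟨d, hd⟩ := htop
    refine ⟨d, eq_top_iff.2 fun x _ => ?_⟩
    change (show W from x) ∈ F d
    rw [hd]
    trivial
  · let E₁ := (τ.subrepresentation (F (j + 1)) (hF (j + 1))).asModuleSubEquiv τ (F (j + 1)).subtype
      (fun _ _ => rfl) Subtype.val_injective (τ.asModuleSubmodule (F (j + 1)) (hF (j + 1)))
      (fun x => by rw [Submodule.range_subtype]; rfl)
    let E₂ := LinearEquiv.ofInjective (C j) (hinj j)
    let h : F (j + 1) →ₗ[K] N j := E₂.symm.toLinearMap ∘ₗ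
      ((F j).mkQ ∘ₗ (F (j + 1)).subtype).codRestrict (LinearMap.range (C j)) fun x => by
        rw [hrange]
        exact ⟨x, x.2, rfl⟩
    have hh (x : F (j + 1)) : C j (h x) = (F j).mkQ x :=
      congrArg Subtype.val (E₂.apply_symm_apply _)
    have heq (γ : Γ) (x : F (j + 1)) :
        h (τ.subrepresentation (F (j + 1)) (hF (j + 1)) γ x) = ν j γ (h x) := by
      apply hinj j
      rw [hC, hh, hh]
      rfl
    have hs : Function.Surjective h := by
      intro y
      have hy : C j y ∈ (F (j + 1)).map (F j).mkQ := hrange j ▸ LinearMap.mem_range_self _ _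
      obtain ⟨x, hx, hxy⟩ := hy
      exact ⟨⟨x, hx⟩, hinj j ((hh _).trans hxy)⟩
    let H : (τ.subrepresentation (F (j + 1)) (hF (j + 1))).asModule →ₗ[MonoidAlgebra K Γ]
        (ν j).asModule :=
      { toFun := h
        map_add' := h.map_add
        map_smul' := fun a x => Representation.asAlgebraHom_comm h heq a x }
    have hker : (τ.asModuleSubmodule (F j) (hF j)).submoduleOf
        (τ.asModuleSubmodule (F (j + 1)) (hF (j + 1))) =
        LinearMap.ker (H ∘ₗ E₁.symm.toLinearMap) := by
      ext x
      obtain ⟨y, rfl⟩ := E₁.surjective x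
      rw [LinearMap.mem_ker, LinearMap.comp_apply, LinearEquiv.coe_coe, LinearEquiv.symm_apply_apply]
      have h1 (z : F (j + 1)) : (z : W) ∈ F j ↔ h z = 0 := by
        rw [← (hinj j).eq_iff, map_zero, hh, Submodule.mkQ_apply, Submodule.Quotient.mk_eq_zero]
      exact h1 y
    exact ⟨Submodule.quotEquivOfEq _ _ hker ≪≫ₗ (H ∘ₗ E₁.symm.toLinearMap).quotKerEquivOfSurjective
      ((show Function.Surjective H from hs).comp E₁.symm.surjective)⟩

end Filtration

namespace BarComplex

section DegreeFiltration
variable {k R N K W : Type*} [Field k] [CommRing R] [AddCommGroup N] [Module k N] [Module R N]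
  {𝒩 : ℕ → Submodule k N} [Field K] [AddCommGroup W] [Module R W] [Module K W] (θ : N →ₗ[R] W)

/-- The `K`-subspace spanned by the images of the components of degree less than `j`. -/
def degreeFiltration (𝒩 : ℕ → Submodule k N) (θ : N →ₗ[R] W) (K : Type*) [Field K] [Module K W]
    (j : ℕ) : Submodule K W :=
  Submodule.span K {w | ∃ i < j, ∃ x ∈ 𝒩 i, θ x = w}

lemma degreeFiltration_mono : Monotone (degreeFiltration 𝒩 θ K) := fun _ _ hij =>
  Submodule.span_mono fun _ ⟨i, hi, h⟩ => ⟨i, hi.trans_le hij, h⟩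

lemma apply_mem_degreeFiltration {i j : ℕ} (hij : i < j) {x : N} (hx : x ∈ 𝒩 i) :
    θ x ∈ degreeFiltration 𝒩 θ K j :=
  Submodule.subset_span ⟨i, hij, x, hx, rfl⟩

lemma degreeFiltration_eq_top (g : Grading 𝒩) [FiniteDimensional K W]
    (hθ : Submodule.span K (Set.range θ) = ⊤) : ∃ d, degreeFiltration 𝒩 θ K d = ⊤ := by
  obtain ⟨n, hn⟩ := monotone_stabilizes_iff_noetherian.2 (inferInstance : IsNoetherian K W)
    ⟨degreeFiltration 𝒩 θ K, degreeFiltration_mono θ⟩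
  refine ⟨n, ?_⟩
  rw [eq_top_iff, ← hθ, Submodule.span_le]
  rintro _ ⟨x, rfl⟩
  induction x using Grading.induction g with
  | hom j x hx =>
    have h : degreeFiltration 𝒩 θ K n = degreeFiltration 𝒩 θ K (max n (j + 1)) :=
      hn _ (le_max_left _ _)
    rw [h]
    exact apply_mem_degreeFiltration θ (by omega) hx
  | add x y hx hy => rw [map_add]; exact add_mem hx hy

end DegreeFiltration

section GenericFiltration
variable {k : Type u} [Field k] {R : Type u} [CommRing R] [Algebra k R] {I : Ideal R}
  {𝒜 : ℕ → Submodule k R} (hR : ConnectedGrading I 𝒜)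
  {N : Type u} [AddCommGroup N] [Module k N] [Module R N] [IsScalarTower k R N]
  {𝒩 : ℕ → Submodule k N} (g : Grading 𝒩)
  {K W : Type*} [Field K] [Algebra R K] [AddCommGroup W] [Module R W] [Module K W]
  [IsScalarTower R K W] (θ : N →ₗ[R] W)

include hR in
lemma apply_proj_mem_degreeFiltration (hs : IsGradedSMul 𝒜 𝒩) (j : ℕ) {x : N}
    (hx : x ∈ I • (⊤ : Submodule R N)) : θ (g.proj j x) ∈ degreeFiltration 𝒩 θ K j := by
  suffices h : Submodule.span R {y | ∃ l < j, y ∈ 𝒩 l} ≤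
      ((degreeFiltration 𝒩 θ K j).restrictScalars R).comap θ from
    h (proj_smul_mem_span hR g hs j hx)
  rw [Submodule.span_le]
  rintro y ⟨l, hl, hy⟩
  exact apply_mem_degreeFiltration θ hl hy

variable [Algebra k K] [Module k W] [IsScalarTower k R W] [IsScalarTower k K W]

include hR in
-- The degree `j` part of `I N` is a combination of elements of lower degree, whose images lie in
-- the `j`-th step; so `x ↦ θ (x_j)` factors through the fibre.
lemma exists_fiber_map (hs : IsGradedSMul 𝒜 𝒩) (j : ℕ) :
    ∃ c : N ⊗[R] (R ⧸ I) →ₗ[k] W ⧸ degreeFiltration 𝒩 θ K j,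
      ∀ x, c (toFiber k I N x) = Submodule.Quotient.mk (θ (g.proj j x)) := by
  let f : N →ₗ[k] W ⧸ degreeFiltration 𝒩 θ K j :=
    (degreeFiltration 𝒩 θ K j).mkQ.restrictScalars k ∘ₗ θ.restrictScalars k ∘ₗ g.proj j
  refine ⟨(LinearMap.ker (toFiber k I N)).liftQ f (fun x hx => ?_) ∘ₗ
    ((toFiber k I N).quotKerEquivOfSurjective (toFiber_surjective k I N)).symm.toLinearMap,
    fun x => ?_⟩
  · rw [LinearMap.mem_ker, toFiber_eq_zero_iff] at hx
    exact (Submodule.Quotient.mk_eq_zero _).2 (apply_proj_mem_degreeFiltration hR g θ hs j hx)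
  · rw [LinearMap.comp_apply, LinearEquiv.coe_coe, LinearMap.quotKerEquivOfSurjective_symm_apply]
    rfl

include hR g in
lemma exists_fiberDegree_map (hs : IsGradedSMul 𝒜 𝒩) (j : ℕ) :
    ∃ C : K ⊗[k] fiberDegree I 𝒩 j →ₗ[K] W ⧸ degreeFiltration 𝒩 θ K j,
      (∀ (a : K) (x : N) (hx : x ∈ 𝒩 j),
        C (a ⊗ₜ ⟨toFiber k I N x, x, hx, rfl⟩) = Submodule.Quotient.mk (a • θ x)) ∧
      LinearMap.range C =
        (degreeFiltration 𝒩 θ K (j + 1)).map (degreeFiltration 𝒩 θ K j).mkQ := by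
  obtain ⟨c, hc⟩ := exists_fiber_map (K := K) hR g θ hs j
  have hC (a : K) (x : N) (hx : x ∈ 𝒩 j) :
      (c.domRestrict (fiberDegree I 𝒩 j)).liftBaseChange K (a ⊗ₜ ⟨toFiber k I N x, x, hx, rfl⟩) =
        Submodule.Quotient.mk (a • θ x) := by
    rw [LinearMap.liftBaseChange_tmul, LinearMap.domRestrict_apply, hc, g.proj_same hx]
    rfl
  refine ⟨(c.domRestrict (fiberDegree I 𝒩 j)).liftBaseChange K, hC, le_antisymm ?_ ?_⟩
  · rintro _ ⟨y, rfl⟩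
    induction y using TensorProduct.induction_on with
    | zero => rw [map_zero]; exact zero_mem _
    | add y z hy hz => rw [map_add]; exact add_mem hy hz
    | tmul a y =>
      obtain ⟨_, x, hx, rfl⟩ := y
      refine ⟨a • θ x, Submodule.smul_mem _ _ (apply_mem_degreeFiltration θ j.lt_succ_self hx), ?_⟩
      exact (hC a x hx).symm
  · rw [Submodule.map_le_iff_le_comap, degreeFiltration, Submodule.span_le]
    rintro _ ⟨i, hi, x, hx, rfl⟩
    rcases (Nat.lt_succ_iff.1 hi).lt_or_eq with hij | rfl
    · have h : (degreeFiltration 𝒩 θ K j).mkQ (θ x) = 0 :=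
        (Submodule.Quotient.mk_eq_zero _).2 (apply_mem_degreeFiltration θ hij hx)
      rw [SetLike.mem_coe, Submodule.mem_comap, h]
      exact zero_mem _
    · refine ⟨(1 : K) ⊗ₜ ⟨toFiber k I N x, x, hx, rfl⟩, ?_⟩
      exact (hC 1 x hx).trans (by rw [one_smul]; rfl)

include hR g in
lemma sum_finrank_fiberDegree_le (hs : IsGradedSMul 𝒜 𝒩) [Module.Finite k (N ⊗[R] (R ⧸ I))]
    (d : ℕ) : ∑ j ∈ Finset.range d, Module.finrank k (fiberDegree I 𝒩 j) ≤
      Module.finrank k (N ⊗[R] (R ⧸ I)) := by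
  have : Module.Finite k (Tor k I N 0) := Module.Finite.equiv (torZeroEquivFiber k I N).symm
  have h := torGrading hR g hs 0
  rw [Finset.sum_congr rfl fun j _ => finrank_fiberDegree 𝒜 𝒩 j,
    ← Submodule.finrank_biSup_of_proj _ h.proj h.proj_same h.proj_ne,
    ← (torZeroEquivFiber k I N).finrank_eq]
  exact Submodule.finrank_le _

include hR g in
/-- The filtration of a representation over an extension field `K` that is spanned by the image of a
graded module `N` of which it has the generic rank. -/
theorem hasFiltration_of_span_eq_top (hs : IsGradedSMul 𝒜 𝒩)
    [Module.Finite k (N ⊗[R] (R ⧸ I))] [FiniteDimensional K W] {Γ : Type*} [Group Γ]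
    (ρ : Representation R Γ N) (h𝒩 : ∀ γ j, 𝒩 j ≤ (𝒩 j).comap (restrictRep k ρ γ))
    (τ : Representation K Γ W) (hτ : ∀ γ x, θ (ρ γ x) = τ γ (θ x))
    (hθ : Submodule.span K (Set.range θ) = ⊤)
    (hrank : Module.finrank K W = Module.finrank k (N ⊗[R] (R ⧸ I))) :
    HasFiltration τ fun j => baseChangeRep K (fiberDegreeRep I ρ 𝒩 h𝒩 j) := by
  have hinv (j : ℕ) (γ : Γ) :
      degreeFiltration 𝒩 θ K j ≤ (degreeFiltration 𝒩 θ K j).comap (τ γ) := by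
    rw [degreeFiltration, Submodule.span_le]
    rintro _ ⟨i, hi, x, hx, rfl⟩
    refine Submodule.subset_span ⟨i, hi, ρ γ x, h𝒩 γ i hx, hτ γ x⟩
  have h0 : degreeFiltration 𝒩 θ K 0 = ⊥ := by
    rw [degreeFiltration, Submodule.span_eq_bot]
    rintro _ ⟨i, hi, -⟩
    exact absurd hi (Nat.not_lt_zero i)
  obtain ⟨d, hd⟩ := degreeFiltration_eq_top θ g hθ
  have hC (j : ℕ) := exists_fiberDegree_map (K := K) hR g θ hs j
  choose C hC hrange using hC
  have hstep (j : ℕ) : Module.finrank K (LinearMap.range (C j)) +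
      Module.finrank K (degreeFiltration 𝒩 θ K j) =
        Module.finrank K (degreeFiltration 𝒩 θ K (j + 1)) := by
    have h := Submodule.finrank_map_add_finrank_inf_ker (degreeFiltration 𝒩 θ K j).mkQ
      (degreeFiltration 𝒩 θ K (j + 1))
    rw [Submodule.ker_mkQ, inf_eq_right.2 (degreeFiltration_mono θ j.le_succ)] at h
    rw [hrange]
    exact h
  have hsum (n : ℕ) : ∑ j ∈ Finset.range n, Module.finrank K (LinearMap.range (C j)) =
      Module.finrank K (degreeFiltration 𝒩 θ K n) := by
    induction n with
    | zero => rw [h0, finrank_bot, Finset.sum_range_zero]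
    | succ n ih => rw [Finset.sum_range_succ, ih, add_comm, hstep, add_comm]
  have hle (j : ℕ) : Module.finrank K (LinearMap.range (C j)) ≤
      Module.finrank k (fiberDegree I 𝒩 j) := by
    rw [← Module.finrank_baseChange (R := K) (S := k) (M' := fiberDegree I 𝒩 j)]
    exact LinearMap.finrank_range_le _
  -- The ranks add up to `dim W`, which equals the dimension of the fibre and so bounds the sum of
  -- the dimensions of its components. Termwise inequality then forces equality. The cut-off `max d
  -- (j + 1)` makes the filtration exhaustive and includes the index `j`.
  have heq (j : ℕ) : Module.finrank K (LinearMap.range (C j)) =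
      Module.finrank k (fiberDegree I 𝒩 j) := by
    have h1 : degreeFiltration 𝒩 θ K (max d (j + 1)) = ⊤ :=
      eq_top_iff.2 (hd ▸ degreeFiltration_mono θ (le_max_left _ _))
    have h2 := hsum (max d (j + 1))
    rw [h1, finrank_top, hrank] at h2
    have h3 := (sum_finrank_fiberDegree_le hR g hs (max d (j + 1))).trans h2.ge
    exact (Finset.sum_eq_sum_iff_of_le fun j _ => hle j).1
      (le_antisymm (Finset.sum_le_sum fun j _ => hle j) h3) j (Finset.mem_range.2 (by omega))
  refine hasFiltration_of_maps τ _ (degreeFiltration 𝒩 θ K) hinv h0 (degreeFiltration_mono θ)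
    ⟨d, hd⟩ C (fun j γ x => ?_) (fun j => ?_) hrange
  · induction x using TensorProduct.induction_on with
    | zero => simp only [map_zero]
    | add x y hx hy => simp only [map_add, hx, hy]
    | tmul a x =>
      obtain ⟨_, x, hx, rfl⟩ := x
      refine (hC j a (ρ γ x) (h𝒩 γ j hx)).trans ?_
      refine Eq.trans ?_ (congrArg _ (hC j a x hx)).symm
      rw [hτ, ← map_smul]
      rfl
  · rw [← LinearMap.ker_eq_bot, ← Submodule.finrank_eq_zero (R := K)]
    have h := LinearMap.finrank_range_add_finrank_ker (C j)
    rw [heq, Module.finrank_baseChange] at h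
    omega

end GenericFiltration
end BarComplex

/-! ### Normal bases and the generic fibre -/

/-- In a domain on which a finite group acts faithfully, some orbit is linearly independent over the
invariants. -/
lemma exists_linearIndependent_smul_of_isFractionRing (R B L G : Type*) [CommRing R] [CommRing B]
    [IsDomain B] [Algebra R B] [Group G] [Finite G] [MulSemiringAction G B] [Field L] [Algebra B L]
    [IsFractionRing B L] [MulSemiringAction G L] [FaithfulSMul G L]
    (hsmul : ∀ (g : G) (p : B), g • algebraMap B L p = algebraMap B L (g • p))
    (hfix : ∀ (g : G) (r : R), g • algebraMap R B r = algebraMap R B r)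
    (hinj : Function.Injective (algebraMap R B))
    (hnorm : ∀ b : B, b ≠ 0 → ∃ c, c ≠ 0 ∧ ∃ r : R, algebraMap R B r = b * c) :
    ∃ p : B, LinearIndependent R fun g : G => g • p := by
  have := Fintype.ofFinite G
  have hinjL := IsFractionRing.injective B L
  -- The normal basis theorem for the extension of `L` over its fixed field.
  obtain ⟨x, hx⟩ := exists_linearIndependent_algEquiv_apply (FixedPoints.subfield G L) L
  have hx' : LinearIndependent (FixedPoints.subfield G L) fun g : G => g • x :=
    hx.comp _ (FixedPoints.toAlgAutMulEquiv G L).injective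
  obtain ⟨a, b, hb, hab⟩ := IsFractionRing.div_surjective B x
  have hb0 := nonZeroDivisors.ne_zero hb
  obtain ⟨c, hc, s, hs⟩ := hnorm b hb0
  -- With `x = a / b` and `b c = s` invariant, `a c = s x` lies in `B` and is a nonzero invariant
  -- multiple of `x`.
  refine ⟨a * c, Fintype.linearIndependent_iff.2 fun r hr g => ?_⟩
  have hfixL (r : R) (g : G) :
      g • algebraMap B L (algebraMap R B r) = algebraMap B L (algebraMap R B r) := by
    rw [hsmul, hfix]
  have hne : algebraMap B L (algebraMap R B s) ≠ 0 := by
    rw [hs]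
    exact (map_ne_zero_iff _ hinjL).2 (mul_ne_zero hb0 hc)
  have hac (g : G) : algebraMap B L (g • (a * c)) =
      g • x * algebraMap B L (algebraMap R B s) := by
    rw [← hfixL s g, ← hsmul, ← smul_mul', hs]
    congr 1
    rw [← hab, map_mul, map_mul, div_mul_eq_mul_div,
      eq_div_iff ((map_ne_zero_iff _ hinjL).2 hb0)]
    ring
  have h0 : ∑ g : G, algebraMap B L (algebraMap R B (r g)) * g • x = 0 := by
    refine (mul_eq_zero.1 ?_).resolve_right hne
    rw [Finset.sum_mul, ← map_zero (algebraMap B L), ← hr, map_sum]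
    refine Finset.sum_congr rfl fun g _ => ?_
    rw [Algebra.smul_def, map_mul, hac, ← mul_assoc]
  have h2 := congrArg Subtype.val (Fintype.linearIndependent_iff.1 hx'
    (fun g => ⟨algebraMap B L (algebraMap R B (r g)), hfixL (r g)⟩) h0 g)
  have h3 : algebraMap B L (algebraMap R B (r g)) = 0 := h2
  rwa [map_eq_zero_iff _ hinjL, map_eq_zero_iff _ hinj] at h3

lemma exists_linearIndependent_smul (R B G : Type*) [CommRing R] [CommRing B] [IsDomain B]
    [Algebra R B] [Group G] [Finite G] [MulSemiringAction G B] [FaithfulSMul G B]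
    (hfix : ∀ (g : G) (r : R), g • algebraMap R B r = algebraMap R B r)
    (hinj : Function.Injective (algebraMap R B))
    (hnorm : ∀ b : B, b ≠ 0 → ∃ c, c ≠ 0 ∧ ∃ r : R, algebraMap R B r = b * c) :
    ∃ p : B, LinearIndependent R fun g : G => g • p := by
  let := IsFractionRing.mulSemiringAction G B (FractionRing B)
  have : FaithfulSMul G (FractionRing B) := IsFractionRing.faithfulSMul G B (FractionRing B)
  exact exists_linearIndependent_smul_of_isFractionRing R B (FractionRing B) G
    (fun g p => (algebraMap.smul' g p (FractionRing B)).symm) hfix hinj hnorm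

/-- A `k`-linear map from `U` to an `R`-module `M` that sends a basis to a maximal linearly
independent set becomes an isomorphism over the field of fractions. -/
lemma exists_baseChange_equiv {k R M U ι : Type*} (K : Type*) [Field k] [CommRing R] [IsDomain R]
    [Algebra k R] [Field K] [Algebra R K] [IsFractionRing R K] [Algebra k K] [IsScalarTower k R K]
    [AddCommGroup M] [Module k M] [Module R M] [IsScalarTower k R M] [AddCommGroup U] [Module k U]
    [Fintype ι] [Module.Finite R M] (b : Module.Basis ι k U) (t : U →ₗ[k] M)
    (ht : LinearIndependent R fun i => t (b i)) (hrank : Module.finrank R M = Module.finrank k U) :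
    ∃ T : K ⊗[k] U ≃ₗ[K] K ⊗[R] M, ∀ (a : K) (u : U), T (a ⊗ₜ u) = a ⊗ₜ t u := by
  have := Module.Finite.of_basis b
  let T : K ⊗[k] U →ₗ[K] K ⊗[R] M :=
    ((TensorProduct.mk R K M 1).restrictScalars k ∘ₗ t).liftBaseChange K
  have hT (a : K) (u : U) : T (a ⊗ₜ u) = a ⊗ₜ t u := by
    change a • ((1 : K) ⊗ₜ[R] t u) = _
    rw [TensorProduct.smul_tmul', smul_eq_mul, mul_one]
  have hrank' : Module.finrank K (K ⊗[k] U) = Module.finrank K (K ⊗[R] M) := by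
    rw [Module.finrank_baseChange, ← hrank, IsFractionRing.finrank_right_eq R K]
    exact (IsLocalizedModule.finrank_eq (nonZeroDivisors R) (TensorProduct.mk R K M 1) le_rfl).symm
  have hli := ht.of_isLocalizedModule K (nonZeroDivisors R) (TensorProduct.mk R K M 1)
  have hinj : Function.Injective T := by
    have h : T = Finsupp.linearCombination K (TensorProduct.mk R K M 1 ∘ fun i => t (b i)) ∘ₗ
        (b.baseChange K).repr.toLinearMap := (b.baseChange K).ext fun i => by
      rw [LinearMap.comp_apply, LinearEquiv.coe_coe, Module.Basis.repr_self,
        Finsupp.linearCombination_single, one_smul, Module.Basis.baseChange_apply, hT]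
      rfl
    rw [h, LinearMap.coe_comp]
    refine Function.Injective.comp ?_ (b.baseChange K).repr.injective
    exact hli
  exact ⟨LinearEquiv.ofInjectiveOfFinrankEq T hinj hrank', hT⟩

namespace RelativeInvariants

section NormalBasis
variable {k V : Type u} [Field k] [AddCommGroup V] [Module k V]
  (G : Subgroup (LinearMap.GeneralLinearGroup k V)) [Finite G]

/-- There is a polynomial whose `G`-orbit is linearly independent over the invariants. -/
lemma exists_linearIndependent_polyRep : ∃ p : Poly k V, LinearIndependent (invariants G)
    fun g : G => polyRep (g : LinearMap.GeneralLinearGroup k V) p := by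
  let := polyAction G
  have : FaithfulSMul G (Poly k V) := ⟨fun {g h} hgh =>
    Subtype.ext (polyRep_injective (LinearMap.ext hgh))⟩
  refine exists_linearIndependent_smul (invariants G) (Poly k V) G (fun g r => r.2 g g.2)
    Subtype.val_injective fun b hb => ?_
  obtain ⟨c, hc, hcb⟩ := exists_mul_mem_invariants G hb
  exact ⟨c, hc, ⟨_, hcb⟩, rfl⟩

end NormalBasis

section Trace
variable {k V U : Type u} [Field k] [AddCommGroup V] [Module k V] [AddCommGroup U] [Module k U]
  (G : Subgroup (LinearMap.GeneralLinearGroup k V)) [Fintype G] (σ : Representation k (G)ᵐᵒᵖ U)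

/-- The map `u ↦ ∑ g, g (u ⊗ p)` to the relative invariants. -/
noncomputable def relTrace (p : Poly k V) : U →ₗ[k] RelInv G σ :=
  LinearMap.codRestrict ((relInvSubmodule G σ).restrictScalars k)
    (∑ g : G, diagonal G σ g ∘ₗ TensorProduct.mk k (Poly k V) U p) fun u h => by
      rw [LinearMap.sum_apply, map_sum]
      refine Fintype.sum_equiv (Equiv.mulLeft h) _ _ fun g => ?_
      rw [Equiv.coe_mulLeft, LinearMap.comp_apply, LinearMap.comp_apply, diagonal_mul]

lemma relInvVal_relTrace (p : Poly k V) (u : U) : relInvVal G σ (relTrace G σ p u) =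
    ∑ g : G, polyRep (g : LinearMap.GeneralLinearGroup k V) p ⊗ₜ σ (MulOpposite.op g⁻¹) u :=
  LinearMap.sum_apply _ _ _

lemma relTrace_equivariant {Γ : Type v} [Group Γ] (ρ : Representation k Γ U)
    (hcomm : ∀ (γ : Γ) (g : G), Commute (ρ γ) (σ (MulOpposite.op g))) (p : Poly k V) (γ : Γ)
    (u : U) : relTrace G σ p (ρ γ u) = relInvRep G σ ρ hcomm γ (relTrace G σ p u) := by
  refine relInvVal_injective G σ ?_
  change _ = leftAct G ρ γ (relInvVal G σ (relTrace G σ p u))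
  rw [relInvVal_relTrace, relInvVal_relTrace, map_sum]
  refine Finset.sum_congr rfl fun g _ => ?_
  rw [leftAct_tmul]
  exact congrArg _ (LinearMap.congr_fun (hcomm γ g⁻¹).eq u).symm

/-- Applying the `i`-th coordinate of `U` to a relation yields one between the conjugates of `p`;
its coefficient at `g = 1` is the `i`-th coefficient of the given relation. -/
lemma linearIndependent_relTrace {p : Poly k V} (hp : LinearIndependent (invariants G)
    fun g : G => polyRep (g : LinearMap.GeneralLinearGroup k V) p) {ι : Type*} [Fintype ι]
    (b : Module.Basis ι k U) :
    LinearIndependent (invariants G) fun i => relTrace G σ p (b i) := by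
  classical
  rw [Fintype.linearIndependent_iff]
  intro r hr i
  let ξ : Poly k V ⊗[k] U →ₗ[invariants G] Poly k V :=
    (TensorProduct.AlgebraTensorModule.rid k (Poly k V) (Poly k V)).toLinearMap.restrictScalars _ ∘ₗ
      TensorProduct.AlgebraTensorModule.lTensor (invariants G) (Poly k V) (b.coord i)
  have hξ (q : Poly k V) (u : U) : ξ (q ⊗ₜ u) = b.coord i u • q := rfl
  have h := congrArg (fun x => ξ (relInvVal G σ x)) hr
  simp only [map_sum, map_smul, relInvVal_relTrace, hξ, map_zero] at h
  have h1 : ∑ g : G, (∑ l, b.coord i (σ (MulOpposite.op g⁻¹) (b l)) • r l) •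
      polyRep (g : LinearMap.GeneralLinearGroup k V) p = 0 := by
    rw [← h]
    simp only [Finset.smul_sum, Finset.sum_smul]
    rw [Finset.sum_comm]
    refine Finset.sum_congr rfl fun l _ => Finset.sum_congr rfl fun g _ => ?_
    rw [smul_assoc, smul_comm]
  have h2 := Fintype.linearIndependent_iff.1 hp _ h1 1
  simp only [inv_one, MulOpposite.op_one, map_one, Module.End.one_apply, Module.Basis.coord_apply,
    Module.Basis.repr_self, Finsupp.single_apply, ite_smul, one_smul, zero_smul,
    Finset.sum_ite_eq', Finset.mem_univ, if_true] at h2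
  exact h2

end Trace

section Generic
variable {k V U : Type u} [Field k] [AddCommGroup V] [Module k V] [FiniteDimensional k V]
  [AddCommGroup U] [Module k U] [FiniteDimensional k U]
  (G : Subgroup (LinearMap.GeneralLinearGroup k V)) [Finite G] (σ : Representation k (G)ᵐᵒᵖ U)
  {Γ : Type v} [Group Γ] (ρ : Representation k Γ U)
  (hcomm : ∀ (γ : Γ) (g : G), Commute (ρ γ) (σ (MulOpposite.op g)))

/-- The generic fibre of the module of relative invariants is `K ⊗ U`. -/
lemma exists_generic_equiv :
    ∃ (t : U →ₗ[k] RelInv G σ) (T : FractionRing (invariants G) ⊗[k] U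
      ≃ₗ[FractionRing (invariants G)] FractionRing (invariants G) ⊗[invariants G] RelInv G σ),
      (∀ γ u, t (ρ γ u) = relInvRep G σ ρ hcomm γ (t u)) ∧ ∀ a u, T (a ⊗ₜ u) = a ⊗ₜ t u := by
  have := Fintype.ofFinite G
  obtain ⟨p, hp⟩ := exists_linearIndependent_polyRep G
  obtain ⟨T, hT⟩ := exists_baseChange_equiv (FractionRing (invariants G)) (Module.finBasis k U)
    (relTrace G σ p) (linearIndependent_relTrace G σ hp _) (finrank_relInv G σ)
  exact ⟨relTrace G σ p, T, relTrace_equivariant G σ ρ hcomm p, hT⟩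

end Generic
end RelativeInvariants

/-- The map `M → W` induced by an isomorphism `W ≅ K ⊗ M` spans `W`. -/
lemma span_range_symm_mk_eq_top {R K M W : Type*} [CommRing R] [Field K] [Algebra R K]
    [AddCommGroup M] [Module R M] [AddCommGroup W] [Module K W] (T : W ≃ₗ[K] K ⊗[R] M) :
    Submodule.span K (Set.range fun x : M => T.symm (1 ⊗ₜ x)) = ⊤ := by
  rw [eq_top_iff]
  rintro w -
  obtain ⟨z, rfl⟩ := T.symm.surjective w
  induction z using TensorProduct.induction_on with
  | zero => rw [map_zero]; exact zero_mem _
  | add x y hx hy => rw [map_add]; exact add_mem hx hy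
  | tmul a x =>
    have h : a ⊗ₜ[R] x = a • ((1 : K) ⊗ₜ[R] x) := by
      rw [TensorProduct.smul_tmul', smul_eq_mul, mul_one]
    rw [h, map_smul]
    exact Submodule.smul_mem _ _ (Submodule.subset_span ⟨x, rfl⟩)

namespace BarComplex

/-- The filtration on `K ⊗ U`, for a graded module `N` with a map `U → N` that is generically an
isomorphism. -/
lemma hasFiltration_baseChange {k R : Type u} [Field k] [CommRing R] [Algebra k R] {I : Ideal R}
    {𝒜 : ℕ → Submodule k R} (hR : ConnectedGrading I 𝒜) {N U : Type u} [AddCommGroup N]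
    [Module k N] [Module R N] [IsScalarTower k R N] [AddCommGroup U] [Module k U]
    [FiniteDimensional k U] {𝒩 : ℕ → Submodule k N} (g : Grading 𝒩) (hs : IsGradedSMul 𝒜 𝒩)
    (K : Type u) [Field K] [Algebra R K] [Algebra k K] [IsScalarTower k R K]
    [Module.Finite k (N ⊗[R] (R ⧸ I))] {Γ : Type v} [Group Γ]
    (ρ : Representation R Γ N) (h𝒩 : ∀ γ j, 𝒩 j ≤ (𝒩 j).comap (restrictRep k ρ γ))
    (τ : Representation k Γ U) (t : U →ₗ[k] N) (ht : ∀ γ u, t (τ γ u) = ρ γ (t u))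
    (T : K ⊗[k] U ≃ₗ[K] K ⊗[R] N) (hT : ∀ a u, T (a ⊗ₜ u) = a ⊗ₜ t u)
    (hrank : Module.finrank k U = Module.finrank k (N ⊗[R] (R ⧸ I))) :
    HasFiltration (baseChangeRep K τ) fun j => baseChangeRep K (fiberDegreeRep I ρ 𝒩 h𝒩 j) := by
  have hTγ (γ : Γ) (x : K ⊗[k] U) : T (baseChangeRep K τ γ x) = (ρ γ).baseChange K (T x) := by
    induction x using TensorProduct.induction_on with
    | zero => simp only [map_zero]
    | add x y hx hy => simp only [map_add, hx, hy]
    | tmul a u =>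
      have h : baseChangeRep K τ γ (a ⊗ₜ u) = a ⊗ₜ τ γ u := rfl
      rw [h, hT, hT, ht, LinearMap.baseChange_tmul]
  -- The filtration by degree of `N` is carried to `K ⊗ U` through the generic isomorphism.
  let θ : N →ₗ[R] K ⊗[k] U := T.symm.toLinearMap.restrictScalars R ∘ₗ TensorProduct.mk R K N 1
  refine hasFiltration_of_span_eq_top hR g θ hs ρ h𝒩 _ (fun γ x => T.injective ?_)
    (span_range_symm_mk_eq_top T) ((Module.finrank_baseChange).trans hrank)
  rw [hTγ]
  change T (T.symm _) = (ρ γ).baseChange K (T (T.symm _))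
  rw [T.apply_symm_apply, T.apply_symm_apply]
  rfl

end BarComplex

/-! ### Assembly of the three parts -/

namespace RelativeInvariants

variable {k V U : Type u} {Γ : Type v} [Field k]
    [AddCommGroup V] [Module k V] [FiniteDimensional k V]
    [AddCommGroup U] [Module k U] [FiniteDimensional k U]
    (G : Subgroup (LinearMap.GeneralLinearGroup k V)) [Finite G] [Group Γ]
    (ρ : Representation k Γ U) (σ : Representation k (G)ᵐᵒᵖ U)
    (hcomm : ∀ (γ : Γ) (g : G), Commute (ρ γ) (σ (MulOpposite.op g)))

lemma exists_sum_finrank_relTor (m : ℕ) :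
    ∃ s : ℕ, ∑ i ∈ Finset.range (m + 1), (-1 : ℤ) ^ i * Module.finrank k (RelTor G σ i) =
      Module.finrank k U + (-1) ^ m * s ∧
        (s = 0 ↔ ∀ i, m < i → Subsingleton (RelTor G σ i)) := by
  rw [← finrank_relInv G σ]
  exact BarComplex.exists_sum_finrank_tor (invariantsConnectedGrading G) (relInvGrading G σ)
    (isGradedSMul_relInvDegree G σ) m

lemma free_relInv_iff : Module.Free (invariants G) (RelInv G σ) ↔
    ∀ i, 0 < i → Subsingleton (RelTor G σ i) :=
  BarComplex.free_iff_subsingleton_tor (invariantsConnectedGrading G) (relInvGrading G σ)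
    (isGradedSMul_relInvDegree G σ)

/-- Freeness enters only numerically: it makes the dimension of the fibre equal to `dim U`. -/
lemma hasFiltration_of_free (h : Module.Free (invariants G) (RelInv G σ)) :
    HasFiltration (baseChangeRep (FractionRing (invariants G)) ρ) (fun j =>
      baseChangeRep (FractionRing (invariants G)) (relFiberDegreeRep G σ ρ hcomm j)) := by
  obtain ⟨t, T, ht, hT⟩ := exists_generic_equiv G σ ρ hcomm
  refine BarComplex.hasFiltration_baseChange (invariantsConnectedGrading G) (relInvGrading G σ)
    (isGradedSMul_relInvDegree G σ) (FractionRing (invariants G)) (relInvRep G σ ρ hcomm)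
    (relInvDegree_invariant G σ ρ hcomm) ρ t ht T hT ?_
  obtain ⟨s, hs, hs'⟩ := exists_sum_finrank_relTor G σ 0
  rw [hs'.2 ((free_relInv_iff G σ).1 h)] at hs
  rw [← (BarComplex.torZeroEquivFiber k (invariantsPlus G) (RelInv G σ)).finrank_eq]
  simp only [zero_add, Finset.range_one, Finset.sum_singleton, pow_zero, one_mul, Nat.cast_zero,
    add_zero] at hs
  exact_mod_cast hs.symm

/-- The partial Euler characteristic of `Tor` in the Grothendieck group. -/
noncomputable def partialEuler (m : ℕ) : Groth k Γ :=
  ∑ i ∈ Finset.range (m + 1),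
    (-1 : ℤ) ^ i • ∑ᶠ j, Groth.cls (relTorDegreeRep G σ ρ hcomm i j)

/-- This is the numerical statement for `eU`; the sign of the defect depends only on the parity of
`m`. -/
lemma exists_idemDim_partialEuler (m : ℕ) {e : MonoidAlgebra k Γ} (he : IsIdempotentElem e) :
    ∃ s : ℕ, Groth.idemDim he (partialEuler G ρ σ hcomm m) =
      Groth.idemDim he (Groth.cls ρ) + (-1) ^ m * s ∧
        (s = 0 ↔ ∀ i, m < i → Subsingleton (RelTor G (idemAction G σ hcomm e) i)) := by
  obtain ⟨s, hs, hs'⟩ := exists_sum_finrank_relTor G (idemAction G σ hcomm e) m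
  refine ⟨s, ?_, hs'⟩
  rw [Groth.idemDim_cls, partialEuler, map_sum]
  refine Eq.trans (Finset.sum_congr rfl fun i _ => ?_) hs
  rw [map_zsmul, idemDim_finsum_relTorDegreeRep, smul_eq_mul]

lemma subsingleton_relTor_idemAction (i : ℕ) {e : MonoidAlgebra k Γ} (he : IsIdempotentElem e)
    [Subsingleton (RelTor G σ i)] : Subsingleton (RelTor G (idemAction G σ hcomm e) i) := by
  have h := idemRank_relTorRep G hcomm he i
  rw [idemRank, Module.finrank_zero_of_subsingleton] at h
  exact Module.finrank_zero_iff.1 h.symm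

variable [Finite Γ]

lemma cls_le_partialEuler {m : ℕ} (hm : Even m) : Groth.cls ρ ≤ partialEuler G ρ σ hcomm m :=
  Groth.le_of_idemDim_le fun e he => by
    obtain ⟨s, hs, -⟩ := exists_idemDim_partialEuler G ρ σ hcomm m he
    rw [hs, hm.neg_one_pow]
    omega

lemma partialEuler_le_cls {m : ℕ} (hm : Odd m) : partialEuler G ρ σ hcomm m ≤ Groth.cls ρ :=
  Groth.le_of_idemDim_le fun e he => by
    obtain ⟨s, hs, -⟩ := exists_idemDim_partialEuler G ρ σ hcomm m he
    rw [hs, hm.neg_one_pow]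
    omega

lemma partialEuler_eq_cls_iff (m : ℕ) : partialEuler G ρ σ hcomm m = Groth.cls ρ ↔
    ∀ i, m < i → Subsingleton (RelTor G σ i) := by
  constructor
  · intro h i hi
    -- The idempotent `1` alone detects the vanishing of the whole of `Tor`.
    have he : IsIdempotentElem (1 : MonoidAlgebra k Γ) := IsIdempotentElem.one
    obtain ⟨s, hs, hs'⟩ := exists_idemDim_partialEuler G ρ σ hcomm m he
    rw [h, left_eq_add, mul_eq_zero, or_iff_right (pow_ne_zero _ (by norm_num)),
      Nat.cast_eq_zero] at hs
    have := hs'.1 hs i hi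
    have h2 := idemRank_relTorRep G hcomm he i
    rw [idemRank, map_one, Module.End.one_eq_id, LinearMap.range_id, finrank_top] at h2
    exact Module.finrank_zero_iff.1 (h2.trans Module.finrank_zero_of_subsingleton)
  · intro h
    refine Groth.eq_of_idemDim_eq fun e he => ?_
    obtain ⟨s, hs, hs'⟩ := exists_idemDim_partialEuler G ρ σ hcomm m he
    rw [hs, hs'.2 fun i hi => ?_, Nat.cast_zero, mul_zero, add_zero]
    have := h i hi
    exact subsingleton_relTor_idemAction G ρ σ hcomm i he

lemma partialEuler_zero :
    partialEuler G ρ σ hcomm 0 = Groth.cls (relFiberRep G σ ρ hcomm) := by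
  rw [partialEuler, cls_relFiberRep, zero_add, Finset.sum_range_one, pow_zero, one_smul]

open scoped RatFunc in
-- For the idempotent `e` attached to `S`, the Euler series of `M_{eU}` is `c` times the series of
-- multiplicities. Its value at `1` is the rank `dim eU`, which is `c` times the multiplicity of `S`
-- in `U`.
lemma exists_ratFunc_mult (S : FDRep k Γ) (hS : S.rep.IsIrreducible) : ∃ f : RatFunc ℚ,
    ((PowerSeries.mk fun j => (Groth.mult S
        (∑ᶠ i, (-1 : ℤ) ^ i • Groth.cls (relTorDegreeRep G σ ρ hcomm i j)) : ℚ) :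
      PowerSeries ℚ) : LaurentSeries ℚ) = (f : LaurentSeries ℚ) ∧
    f.denom.eval 1 ≠ 0 ∧
    f.eval (RingHom.id ℚ) 1 = Groth.mult S (Groth.cls ρ) := by
  obtain ⟨e, he, c, hc, h⟩ := Groth.exists_idemDim_eq_mult S hS
  obtain ⟨f, hf, hf', hf1⟩ := BarComplex.exists_ratFunc_tor (invariantsConnectedGrading G)
    (relInvGrading G (idemAction G σ hcomm e)) (isGradedSMul_relInvDegree G _) hc
    (fun j => Groth.mult S (∑ᶠ i, (-1 : ℤ) ^ i • Groth.cls (relTorDegreeRep G σ ρ hcomm i j)))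
    (fun j => (h _).symm.trans (idemDim_finsum_relTorDegreeRep_internal G σ hcomm he j))
  refine ⟨f, hf, hf', ?_⟩
  have h1 := idemDim_cls_eq_finrank_relInv G σ hcomm he
  rw [h] at h1
  have h2 : (c : ℚ) * (Groth.mult S (Groth.cls ρ) : ℤ) =
      (Module.finrank (invariants G) (RelInv G (idemAction G σ hcomm e)) : ℕ) := by
    exact_mod_cast h1
  rw [hf1, ← h2, mul_div_cancel_left₀ _ (by exact_mod_cast hc.ne')]

end RelativeInvariants

open RelativeInvariants in
theorem mainTheorem1 {k V U : Type u} {Γ : Type v} [Field k]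
    [AddCommGroup V] [Module k V] [FiniteDimensional k V]
    [AddCommGroup U] [Module k U] [FiniteDimensional k U]
    (G : Subgroup (LinearMap.GeneralLinearGroup k V)) [Finite G] [Group Γ] [Finite Γ]
    (ρ : Representation k Γ U) (σ : Representation k (G)ᵐᵒᵖ U)
    (hcomm : ∀ (γ : Γ) (g : G), Commute (ρ γ) (σ (MulOpposite.op g))) :
    ∃ (_ : Module.Finite k (Fiber G σ)) (_ : ∀ i, Module.Finite k (RelTor G σ i)),
      -- (i)
      (Groth.cls ρ ≤ Groth.cls (relFiberRep G σ ρ hcomm) ∧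
        (Groth.cls (relFiberRep G σ ρ hcomm) = Groth.cls ρ ↔
          Module.Free (invariants G) (RelInv G σ)) ∧
        (Module.Free (invariants G) (RelInv G σ) →
          HasFiltration (baseChangeRep (FractionRing (invariants G)) ρ)
            (fun j => baseChangeRep (FractionRing (invariants G))
              (relFiberDegreeRep G σ ρ hcomm j)))) ∧
      -- the sums below are finite
      ((∀ i, {j | relTorDegree G σ i j ≠ ⊥}.Finite) ∧
        (∀ j, {i | relTorDegree G σ i j ≠ ⊥}.Finite)) ∧
      -- (ii)
      (∀ m : ℕ,
        (Even m → Groth.cls ρ ≤ ∑ i ∈ Finset.range (m + 1),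
          (-1 : ℤ) ^ i • ∑ᶠ j, Groth.cls (relTorDegreeRep G σ ρ hcomm i j)) ∧
        (Odd m → ∑ i ∈ Finset.range (m + 1),
          (-1 : ℤ) ^ i • ∑ᶠ j, Groth.cls (relTorDegreeRep G σ ρ hcomm i j) ≤ Groth.cls ρ) ∧
        (∑ i ∈ Finset.range (m + 1),
            (-1 : ℤ) ^ i • ∑ᶠ j, Groth.cls (relTorDegreeRep G σ ρ hcomm i j) = Groth.cls ρ ↔
          ∀ i, m < i → Subsingleton (RelTor G σ i))) ∧
      -- (iii)
      (∀ S : FDRep k Γ, S.rep.IsIrreducible → ∃ f : RatFunc ℚ,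
        ((PowerSeries.mk fun j => (Groth.mult S
            (∑ᶠ i, (-1 : ℤ) ^ i • Groth.cls (relTorDegreeRep G σ ρ hcomm i j)) : ℚ) :
          PowerSeries ℚ) : LaurentSeries ℚ) = (f : LaurentSeries ℚ) ∧
        f.denom.eval 1 ≠ 0 ∧
        f.eval (RingHom.id ℚ) 1 = Groth.mult S (Groth.cls ρ)) := by
  refine ⟨finite_fiber G σ, finite_relTor G σ, ⟨?_, ?_, hasFiltration_of_free G ρ σ hcomm⟩,
    ⟨fun i => (relTorGrading G σ i).finite_ne_bot, finite_relTorDegree_ne_bot G σ⟩,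
    fun m => ⟨cls_le_partialEuler G ρ σ hcomm, partialEuler_le_cls G ρ σ hcomm,
      partialEuler_eq_cls_iff G ρ σ hcomm m⟩, exists_ratFunc_mult G ρ σ hcomm⟩
  -- The fibre is `Tor₀`, so the comparison in (i) is the case `m = 0` of (ii).
  · rw [← partialEuler_zero]
    exact cls_le_partialEuler G ρ σ hcomm Even.zero
  · rw [← partialEuler_zero, partialEuler_eq_cls_iff, free_relInv_iff]
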